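/- There is a deterministic algorithm which, given three finite lists $P,Q,R$ of $O(n)$ closed axis-parallel cubes in $\mathbb{R}^3$ each (of arbitrary positive side lengths), decides in time $\tilde{O}(n^{9/5})$ whether for all $(p,r)\in P\times R$ there exists $q\in Q$ that intersects both $p$ and $r$. Precisely: there are a real RAM program $\Pi$ and integers $\kappa\ge 1$, $k\ge 0$ such that for every integer $c\ge 0$ there is a constant $C$ with the following property. Let $n\ge 2$, let $P,Q,R$ be finite lists of at most $cn$ cubes each, put $N=|P|+|Q|+|R|$, and let the word length be any $w\ge\kappa(\lfloor\log_2 \max(N,1)\rfloor+1)$. Then $\Pi$, given $|P|,|Q|,|R|$ as words and each cube by the three coordinates of its lower corner and its side length as real numbers, halts within $C\,n^{9/5}(\log n)^k$ steps with output $1$ if every pair $(p,r)\in P\times R$ has a $q\in Q$ intersecting both $p$ and $r$, and with output $0$ otherwise. Here the real RAM has random-access arrays of $w$-bit words and of real numbers; addition, truncated subtraction, multiplication, integer division, remainder and comparison of words (sums and products taken modulo $2^w$), the operations $+,-,\times,/$ and comparison of reals, conversion of a word to a real, memory accesses and assignments take one step each; reals cannot be rounded to words, and programs contain no real constants. -/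

import Mathlib

/-- A closed axis-parallel cube in `ℝ³`, given by its lower corner and its side length. -/
structure Cube3 where
  /-- The corner with the least coordinates. -/
  corner : Fin 3 → ℝ
  /-- The common length of all edges. -/
  side : ℝ
  side_pos : 0 < side

namespace Cube3

/-- The set of points of a cube. -/
def toSet (p : Cube3) : Set (Fin 3 → ℝ) :=
  {v | ∀ i, p.corner i ≤ v i ∧ v i ≤ p.corner i + p.side}

/-- Two cubes intersect if they share a point. -/
def Intersects (p q : Cube3) : Prop :=
  (p.toSet ∩ q.toSet).Nonempty

/-- The four real numbers by which a cube is given to an algorithm. -/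
def record (p : Cube3) : List ℝ :=
  [p.corner 0, p.corner 1, p.corner 2, p.side]

end Cube3

/-- Every `p` in `P` and every `r` in `R` have a common neighbor in `Q`. -/
def AllPairsHaveCommonNeighbor (P Q R : List Cube3) : Prop :=
  ∀ p ∈ P, ∀ r ∈ R, ∃ q ∈ Q, q.Intersects p ∧ q.Intersects r

/-! ## The real RAM

A deterministic machine with `w`-bit words and exact real numbers, programmed by structured
programs. A program uses finitely many word arrays and finitely many real arrays; the arrays are
fixed in the program text, and their cells are addressed by computed words. Every arithmetic
operation, comparison, memory access and assignment takes one unit of time. Real numbers can be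
compared and combined by the four field operations; there is no rounding from reals to words, and
a program contains no real constants (natural numbers only). -/

namespace RealRAM

/-- The memory: cell `i` of the word array `a` is `words a i`, and cell `i` of the real array `a`
is `reals a i`. -/
structure Store where
  words : ℕ → ℕ → ℕ
  reals : ℕ → ℕ → ℝ

/-- Expressions with a word as their value. -/
inductive WExp : Type
  | lit (n : ℕ)
  | get (a : ℕ) (i : WExp)
  | add (e f : WExp)
  | sub (e f : WExp)
  | mul (e f : WExp)
  | div (e f : WExp)
  | mod (e f : WExp)

/-- Expressions with a real number as their value. -/
inductive RExp : Type
  | get (a : ℕ) (i : WExp)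
  | ofWord (e : WExp)
  | add (e f : RExp)
  | sub (e f : RExp)
  | mul (e f : RExp)
  | div (e f : RExp)

/-- Tests. -/
inductive BExp : Type
  | wordLe (e f : WExp)
  | realLe (e f : RExp)
  | not (b : BExp)
  | and (b d : BExp)

/-- Programs. -/
inductive Cmd : Type
  | nop
  | setWord (a : ℕ) (i e : WExp)
  | setReal (a : ℕ) (i : WExp) (e : RExp)
  | seq (p q : Cmd)
  | cond (b : BExp) (p q : Cmd)
  | loop (b : BExp) (p : Cmd)

/-- The value of a word expression for word length `w`. Sums and products are reduced modulo
`2 ^ w`; the difference is cut off at `0`; quotient and remainder are those of natural numbers. -/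
def WExp.eval (w : ℕ) (s : Store) : WExp → ℕ
  | .lit n => n % 2 ^ w
  | .get a i => s.words a (i.eval w s)
  | .add e f => (e.eval w s + f.eval w s) % 2 ^ w
  | .sub e f => e.eval w s - f.eval w s
  | .mul e f => (e.eval w s * f.eval w s) % 2 ^ w
  | .div e f => e.eval w s / f.eval w s
  | .mod e f => e.eval w s % f.eval w s

/-- The time for evaluating a word expression: the number of its operations. -/
def WExp.cost : WExp → ℕ
  | .lit _ => 1
  | .get _ i => i.cost + 1
  | .add e f => e.cost + f.cost + 1
  | .sub e f => e.cost + f.cost + 1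
  | .mul e f => e.cost + f.cost + 1
  | .div e f => e.cost + f.cost + 1
  | .mod e f => e.cost + f.cost + 1

/-- The value of a real expression. -/
noncomputable def RExp.eval (w : ℕ) (s : Store) : RExp → ℝ
  | .get a i => s.reals a (i.eval w s)
  | .ofWord e => (e.eval w s : ℝ)
  | .add e f => e.eval w s + f.eval w s
  | .sub e f => e.eval w s - f.eval w s
  | .mul e f => e.eval w s * f.eval w s
  | .div e f => e.eval w s / f.eval w s

/-- The time for evaluating a real expression. -/
def RExp.cost : RExp → ℕ
  | .get _ i => i.cost + 1
  | .ofWord e => e.cost + 1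
  | .add e f => e.cost + f.cost + 1
  | .sub e f => e.cost + f.cost + 1
  | .mul e f => e.cost + f.cost + 1
  | .div e f => e.cost + f.cost + 1

/-- The truth of a test. -/
def BExp.Holds (w : ℕ) (s : Store) : BExp → Prop
  | .wordLe e f => e.eval w s ≤ f.eval w s
  | .realLe e f => e.eval w s ≤ f.eval w s
  | .not b => ¬ b.Holds w s
  | .and b d => b.Holds w s ∧ d.Holds w s

/-- The time for evaluating a test. -/
def BExp.cost : BExp → ℕ
  | .wordLe e f => e.cost + f.cost + 1
  | .realLe e f => e.cost + f.cost + 1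
  | .not b => b.cost + 1
  | .and b d => b.cost + d.cost + 1

/-- Overwrite cell `i` of the word array `a` by `v`. -/
def Store.setWord (s : Store) (a i v : ℕ) : Store :=
  { s with words := fun b j => if b = a ∧ j = i then v else s.words b j }

/-- Overwrite cell `i` of the real array `a` by `v`. -/
noncomputable def Store.setReal (s : Store) (a i : ℕ) (v : ℝ) : Store :=
  { s with reals := fun b j => if b = a ∧ j = i then v else s.reals b j }

/-- `Exec w c s t s'`: with word length `w`, the program `c` started on the memory `s` halts after
exactly `t` units of time with the memory `s'`. -/
inductive Exec (w : ℕ) : Cmd → Store → ℕ → Store → Prop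
  | nop (s : Store) : Exec w .nop s 1 s
  | setWord (a : ℕ) (i e : WExp) (s : Store) :
      Exec w (.setWord a i e) s (i.cost + e.cost + 1)
        (s.setWord a (i.eval w s) (e.eval w s))
  | setReal (a : ℕ) (i : WExp) (e : RExp) (s : Store) :
      Exec w (.setReal a i e) s (i.cost + e.cost + 1)
        (s.setReal a (i.eval w s) (e.eval w s))
  | seq {p q : Cmd} {s s₁ s₂ : Store} {t₁ t₂ : ℕ} :
      Exec w p s t₁ s₁ → Exec w q s₁ t₂ s₂ → Exec w (.seq p q) s (t₁ + t₂) s₂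
  | cond_true {b : BExp} {p q : Cmd} {s s' : Store} {t : ℕ} :
      b.Holds w s → Exec w p s t s' → Exec w (.cond b p q) s (b.cost + t + 1) s'
  | cond_false {b : BExp} {p q : Cmd} {s s' : Store} {t : ℕ} :
      ¬ b.Holds w s → Exec w q s t s' → Exec w (.cond b p q) s (b.cost + t + 1) s'
  | loop_true {b : BExp} {p : Cmd} {s s₁ s₂ : Store} {t₁ t₂ : ℕ} :
      b.Holds w s → Exec w p s t₁ s₁ → Exec w (.loop b p) s₁ t₂ s₂ →
        Exec w (.loop b p) s (b.cost + t₁ + t₂ + 1) s₂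
  | loop_false {b : BExp} {p : Cmd} {s : Store} :
      ¬ b.Holds w s → Exec w (.loop b p) s (b.cost + 1) s

/-- The memory at the start: the first three cells of word array `0` hold the numbers of cubes,
the real arrays `0`, `1`, `2` hold the cubes of `P`, `Q`, `R`, four consecutive cells per cube,
and every other cell is `0`. -/
noncomputable def inputStore (P Q R : List Cube3) : Store where
  words := fun a i => if a = 0 then [P.length, Q.length, R.length].getD i 0 else 0
  reals := fun a i => ([P, Q, R].getD a []).flatMap Cube3.record |>.getD i 0

/-- The answer of the machine: `1` for yes and `0` for no, in cell `0` of word array `0`. -/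
def Store.output (s : Store) : ℕ :=
  s.words 0 0

end RealRAM

/-!
# Common neighbours of pairs of cubes in time `Õ(n ^ (9/5))` on the real RAM

**Dominance.** Two cubes intersect if and only if six inequalities hold between coordinates of the
one and coordinates of the other (`low_le_high_iff`). Only the order of these numbers matters, so
each cube of `Q` is replaced by its ranks `pos j` and each cube of `P` and `R` by its counts `cP j`
and `cR j`; then `q` meets `p` if and only if `pos j q < cP j p` for all `j < 6`
(`rankedInst_bad_iff`). The ranks are found without moving real numbers: indices are sorted within
blocks, and the ranks within all blocks, found by binary search, are summed.

**Splitting the coordinates.** A pair `(p, r)` has no common neighbour if and only if no `q` is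
below `p` in the coordinates where `p` gives the smaller count, and below `r` in the others
(`Inst.bad_iff`). One of the two cubes, say `p` by symmetry, takes at least three of the six
coordinates.

* If `p` takes at least five of them, the bound from `r` in the remaining coordinate can be replaced
  by the minimum over all `r`. One query per `p` to a six-dimensional dominance table decides
  (`run_minCheck`).
* If `p` takes three or four of them, every coordinate is cut into `b ≈ N ^ (1/5)` slabs of about
  `N / b` ranks, where `N` is the number of all cubes, and the cubes `p` are distributed to `b ^ 4`
  cells by their slabs in four coordinates. For a fixed cell, a `q` that is in lower slabs in all
  four coordinates is below every `p` of the cell. These `q` are treated once per cell: those `r`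
  that are above none of them in the other three coordinates remain, and are put into a table
  (`run_searchCell`). The `q` that share a slab with the cell in some coordinate number at most
  `4 (N / b + 1)`, and are treated for every `p` of the cell: those below `p` are swept in the order
  of one of the three coordinates of `r`, and the staircase which bounds the area of the other two
  coordinates not above any `q` swept so far is searched for remaining `r` (`run_sweep`). A
  corner of the staircase is queried when a new `q` is about to cut it off, and at the end if it has
  survived. Up to two for each `q`, these queries are charged to minimal points of the staircase
  that `q` removes; as `q` adds only one, their number is linear in the number of steps of the sweep
  (`run_walk`).

The cells cost about `b ^ 4 * N`, the sweeps about `N * (N / b)`, and both are `N ^ (9/5)` up to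
logarithmic factors.

**Tables.** A dominance table stores a point at all tuples of ancestors of its coordinates in a
binary heap of leaves, by direct addressing; a query looks up the logarithmically many maximal
subtrees to the left of each coordinate (`run_insTab`, `run_qryTab`). Entries are stamps, so that
raising the stamp empties the table.

**Programs.** `Run w c s Φ` says that the program `c` halts when started on the memory `s`, with
time and final memory satisfying `Φ`. Each program comes with a lemma on `Run`, from which the lemma
for the next larger program is derived; that most arrays are unchanged follows from the program text
(`Run.frame`).
-/

namespace RealRAM

/-! ### Reasoning about programs -/

/-- The program `c`, started on `s`, halts after some time `t` on a memory `s'` with `Φ t s'`. -/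
def Run (w : ℕ) (c : Cmd) (s : Store) (Φ : ℕ → Store → Prop) : Prop :=
  ∃ t s', Exec w c s t s' ∧ Φ t s'

/-- The word array `a` occurs as the target of an assignment in a program. -/
def Cmd.Writes : Cmd → ℕ → Prop
  | .nop, _ => False
  | .setWord b _ _, a => a = b
  | .setReal _ _ _, _ => False
  | .seq p q, a => p.Writes a ∨ q.Writes a
  | .cond _ p q, a => p.Writes a ∨ q.Writes a
  | .loop _ p, a => p.Writes a

/-- A program without assignments to real cells. -/
def Cmd.RealFree : Cmd → Prop
  | .nop => True
  | .setWord _ _ _ => True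
  | .setReal _ _ _ => False
  | .seq p q => p.RealFree ∧ q.RealFree
  | .cond _ p q => p.RealFree ∧ q.RealFree
  | .loop _ p => p.RealFree

theorem words_setWord (s : Store) (a i v b j : ℕ) :
    (s.setWord a i v).words b j = if b = a ∧ j = i then v else s.words b j := rfl

theorem words_setWord_of_ne (s : Store) {a b : ℕ} (i v : ℕ) (h : b ≠ a) :
    (s.setWord a i v).words b = s.words b := by
  funext j; simp [words_setWord, h]

theorem reals_setWord (s : Store) (a i v : ℕ) : (s.setWord a i v).reals = s.reals := rfl

/-- A program changes only the word arrays that occur on the left of its assignments. -/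
theorem Exec.words_eq {w : ℕ} {c : Cmd} {s s' : Store} {t : ℕ} (h : Exec w c s t s') (a : ℕ)
    (ha : ¬ c.Writes a) : s'.words a = s.words a := by
  induction h with
  | nop s => rfl
  | setWord b i e s => exact words_setWord_of_ne _ _ _ ha
  | setReal b i e s => rfl
  | seq _ _ ih₁ ih₂ =>
    simp only [Cmd.Writes, not_or] at ha
    rw [ih₂ ha.2, ih₁ ha.1]
  | cond_true _ _ ih => simp only [Cmd.Writes, not_or] at ha; exact ih ha.1
  | cond_false _ _ ih => simp only [Cmd.Writes, not_or] at ha; exact ih ha.2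
  | loop_true _ _ _ ih₁ ih₂ => rw [ih₂ ha, ih₁ ha]
  | loop_false _ => rfl

theorem Exec.reals_eq {w : ℕ} {c : Cmd} {s s' : Store} {t : ℕ} (h : Exec w c s t s')
    (hc : c.RealFree) : s'.reals = s.reals := by
  induction h with
  | nop s => rfl
  | setWord b i e s => rfl
  | setReal b i e s => exact hc.elim
  | seq _ _ ih₁ ih₂ => rw [ih₂ hc.2, ih₁ hc.1]
  | cond_true _ _ ih => exact ih hc.1
  | cond_false _ _ ih => exact ih hc.2
  | loop_true _ _ _ ih₁ ih₂ => rw [ih₂ hc, ih₁ hc]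
  | loop_false _ => rfl

namespace Run

variable {w : ℕ} {s : Store} {Φ Ψ : ℕ → Store → Prop}

theorem mono {c : Cmd} (h : Run w c s Φ) (hΦ : ∀ t s', Φ t s' → Ψ t s') : Run w c s Ψ := by
  obtain ⟨t, s', he, hp⟩ := h
  exact ⟨t, s', he, hΦ _ _ hp⟩

/-- What a program does not write stays as it is. -/
theorem frame {c : Cmd} (h : Run w c s Φ) :
    Run w c s (fun t s' => Φ t s' ∧ ∀ a, ¬ c.Writes a → s'.words a = s.words a) := by
  obtain ⟨t, s', he, hp⟩ := h
  exact ⟨t, s', he, hp, he.words_eq⟩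

theorem frame_reals {c : Cmd} (h : Run w c s Φ) (hc : c.RealFree) :
    Run w c s (fun t s' => Φ t s' ∧ s'.reals = s.reals ∧
      ∀ a, ¬ c.Writes a → s'.words a = s.words a) := by
  obtain ⟨t, s', he, hp⟩ := h
  exact ⟨t, s', he, hp, he.reals_eq hc, he.words_eq⟩

theorem nop (h : Φ 1 s) : Run w .nop s Φ := ⟨_, _, Exec.nop s, h⟩

theorem setWord {a : ℕ} {i e : WExp}
    (h : Φ (i.cost + e.cost + 1) (s.setWord a (i.eval w s) (e.eval w s))) :
    Run w (.setWord a i e) s Φ :=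
  ⟨_, _, Exec.setWord a i e s, h⟩

theorem seq {p q : Cmd}
    (h : Run w p s (fun t₁ s₁ => Run w q s₁ (fun t₂ s₂ => Φ (t₁ + t₂) s₂))) :
    Run w (.seq p q) s Φ := by
  obtain ⟨t₁, s₁, h₁, t₂, s₂, h₂, hp⟩ := h
  exact ⟨_, _, Exec.seq h₁ h₂, hp⟩

theorem cond {b : BExp} {p q : Cmd}
    (h₁ : b.Holds w s → Run w p s (fun t s' => Φ (b.cost + t + 1) s'))
    (h₂ : ¬ b.Holds w s → Run w q s (fun t s' => Φ (b.cost + t + 1) s')) :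
    Run w (.cond b p q) s Φ := by
  by_cases hb : b.Holds w s
  · obtain ⟨t, s', h, hp⟩ := h₁ hb
    exact ⟨_, _, Exec.cond_true hb h, hp⟩
  · obtain ⟨t, s', h, hp⟩ := h₂ hb
    exact ⟨_, _, Exec.cond_false hb h, hp⟩

/-- The rule for loops. The invariant mentions the credit that is left for the remaining
iterations; each iteration pays for itself, so the credit also proves termination. -/
theorem loop {b : BExp} {c : Cmd} (Inv : ℕ → Store → Prop)
    (hstep : ∀ φ s, Inv φ s → b.Holds w s →
      Run w c s (fun t s' => ∃ φ', b.cost + t + 1 + φ' ≤ φ ∧ Inv φ' s'))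
    {φ : ℕ} (h : Inv φ s) :
    Run w (.loop b c) s (fun t s' =>
      ∃ φ', t + φ' ≤ φ + (b.cost + 1) ∧ Inv φ' s' ∧ ¬ b.Holds w s') := by
  induction φ using Nat.strong_induction_on generalizing s with
  | _ φ ih =>
    by_cases hb : b.Holds w s
    · obtain ⟨t, s₁, h₁, φ', hle, hi⟩ := hstep φ s h hb
      obtain ⟨t₂, s₂, h₂, φ₂, hle₂, hi₂, hn⟩ := ih φ' (by omega) hi
      exact ⟨_, _, Exec.loop_true hb h₁ h₂, φ₂, by omega, hi₂, hn⟩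
    · exact ⟨_, _, Exec.loop_false hb, φ, by omega, h, hb⟩

end Run

/-- A word variable: cell `0` of its own array. -/
def var (x : ℕ) : WExp := .get x (.lit 0)

@[simp] theorem eval_var (w : ℕ) (s : Store) (x : ℕ) : (var x).eval w s = s.words x 0 := by
  simp [var, WExp.eval]

@[simp] theorem cost_var (x : ℕ) : (var x).cost = 2 := rfl

/-- Assignment to a word variable. -/
def assign (x : ℕ) (e : WExp) : Cmd := .setWord x (.lit 0) e

@[simp] theorem writes_assign (x : ℕ) (e : WExp) (a : ℕ) : (assign x e).Writes a ↔ a = x := Iff.rfl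

@[simp] theorem realFree_assign (x : ℕ) (e : WExp) : (assign x e).RealFree := trivial

theorem Run.assign {w : ℕ} {s : Store} {Φ : ℕ → Store → Prop} {x : ℕ} {e : WExp}
    (h : Φ (e.cost + 2) (s.setWord x 0 (e.eval w s))) : Run w (assign x e) s Φ := by
  refine Run.setWord ?_
  have h0 : WExp.eval w s (.lit 0) = 0 := by simp [WExp.eval]
  have h1 : WExp.cost (.lit 0) + e.cost + 1 = e.cost + 2 := by simp only [WExp.cost]; omega
  rw [h0, h1]
  exact h

/-- Do `c` for each value of the variable `i` from `0` on, below `n`. -/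
def forUp (i : ℕ) (n : WExp) (c : Cmd) : Cmd :=
  .seq (assign i (.lit 0))
    (.loop (.not (.wordLe n (var i))) (.seq c (assign i (.add (var i) (.lit 1)))))

@[simp] theorem writes_forUp (i : ℕ) (n : WExp) (c : Cmd) (a : ℕ) :
    (forUp i n c).Writes a ↔ a = i ∨ c.Writes a := by
  simp only [forUp, Cmd.Writes, writes_assign]; tauto

@[simp] theorem realFree_forUp (i : ℕ) (n : WExp) (c : Cmd) :
    (forUp i n c).RealFree ↔ c.RealFree := by
  simp [forUp, Cmd.RealFree]

/-- The rule for counting loops. The invariant mentions a potential, which an iteration may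
draw on or increase, on top of its own allowance `T k`. -/
theorem Run.forUp {w : ℕ} {s : Store} {i : ℕ} {n : WExp} {c : Cmd} {N : ℕ}
    (Inv : ℕ → ℕ → Store → Prop) (T : ℕ → ℕ) {φ₀ : ℕ}
    (hN : N < 2 ^ w) (hi : ¬ c.Writes i)
    (hn : ∀ k φ s, Inv k φ s → n.eval w s = N)
    (hst : ∀ k φ s v, Inv k φ s → Inv k φ (s.setWord i 0 v))
    (h0 : Inv 0 φ₀ s)
    (hstep : ∀ k φ s, k < N → Inv k φ s → s.words i 0 = k →
      Run w c s (fun t s' => ∃ φ', t + φ' ≤ T k + φ ∧ Inv (k + 1) φ' s')) :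
    Run w (forUp i n c) s (fun t s' => ∃ φ',
      t + φ' ≤ ∑ k ∈ Finset.range N, (T k + (n.cost + 11)) + (n.cost + 11) + φ₀ ∧
        Inv N φ' s') := by
  refine Run.seq (Run.assign ?_)
  have hcost : (BExp.not (.wordLe n (var i))).cost = n.cost + 4 := by
    simp only [BExp.cost, cost_var]
  have hcost1 : (WExp.add (var i) (.lit 1)).cost = 4 := rfl
  have key := Run.loop (w := w) (b := .not (.wordLe n (var i)))
    (c := .seq c (RealRAM.assign i (.add (var i) (.lit 1))))
    (s := s.setWord i 0 (WExp.eval w s (.lit 0)))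
    (fun ψ s => ∃ k φ, k ≤ N ∧ s.words i 0 = k ∧ Inv k φ s ∧
      ψ = ∑ j ∈ Finset.Ico k N, (T j + (n.cost + 11)) + φ)
    (φ := ∑ j ∈ Finset.Ico 0 N, (T j + (n.cost + 11)) + φ₀)
    (by
      rintro ψ s ⟨k, φ, hk, hik, hinv, rfl⟩ hb
      simp only [BExp.Holds, eval_var, hn _ _ _ hinv, hik, not_le] at hb
      refine Run.seq ((hstep k φ s hb hinv hik).frame.mono ?_)
      rintro t s' ⟨⟨φ', hle, hinv'⟩, hfr⟩
      refine Run.assign ⟨∑ j ∈ Finset.Ico (k + 1) N, (T j + (n.cost + 11)) + φ', ?_, k + 1, φ', hb,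
        ?_, hst _ _ _ _ hinv', rfl⟩
      · rw [Finset.sum_eq_sum_Ico_succ_bot hb, hcost, hcost1]
        omega
      · have h1 : 1 % 2 ^ w = 1 := Nat.mod_eq_of_lt (by omega)
        have h2 : (k + 1) % 2 ^ w = k + 1 := Nat.mod_eq_of_lt (by omega)
        simp [words_setWord, WExp.eval, hfr i hi, hik, h1, h2])
    ⟨0, φ₀, Nat.zero_le _, by simp [words_setWord, WExp.eval], hst _ _ _ _ h0, rfl⟩
  refine key.mono ?_
  rintro t s' ⟨ψ, hle, ⟨k, φ, hk, hik, hinv, rfl⟩, hb⟩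
  simp only [BExp.Holds, eval_var, hn _ _ _ hinv, hik, not_le, not_lt] at hb
  obtain rfl : k = N := by omega
  refine ⟨φ, ?_, hinv⟩
  rw [hcost] at hle
  simp only [Finset.Ico_self, Finset.sum_empty, Nat.Ico_zero_eq_range, zero_add] at hle
  simp only [WExp.cost]
  omega

/-- The rule for counting loops whose iterations all have the same allowance. -/
theorem Run.forUp_const {w : ℕ} {s : Store} {i : ℕ} {n : WExp} {c : Cmd} {N : ℕ}
    (Inv : ℕ → Store → Prop) (T : ℕ)
    (hN : N < 2 ^ w) (hi : ¬ c.Writes i)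
    (hn : ∀ k s, Inv k s → n.eval w s = N)
    (hst : ∀ k s v, Inv k s → Inv k (s.setWord i 0 v))
    (h0 : Inv 0 s)
    (hstep : ∀ k s, k < N → Inv k s → s.words i 0 = k →
      Run w c s (fun t s' => t ≤ T ∧ Inv (k + 1) s')) :
    Run w (RealRAM.forUp i n c) s (fun t s' =>
      t ≤ N * (T + (n.cost + 11)) + (n.cost + 11) ∧ Inv N s') := by
  refine (Run.forUp (fun k _ s => Inv k s) (fun _ => T) (φ₀ := 0) hN hi (fun k _ => hn k)
    (fun k _ => hst k) h0 (fun k φ s hk h hik => (hstep k s hk h hik).mono ?_)).mono ?_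
  · rintro t s' ⟨h1, h2⟩
    exact ⟨0, by omega, h2⟩
  · rintro t s' ⟨φ', h1, h2⟩
    simp only [Finset.sum_const, Finset.card_range, smul_eq_mul] at h1
    exact ⟨by omega, h2⟩

/-- While cell `i` of the array `A` is at least `l`, do `c` and halve the cell. -/
def halving (A i l : ℕ) (c : Cmd) : Cmd :=
  .loop (.wordLe (.lit l) (.get A (.lit i)))
    (.seq c (.setWord A (.lit i) (.div (.get A (.lit i)) (.lit 2))))

@[simp] theorem writes_halving (A i l : ℕ) (c : Cmd) (a : ℕ) :
    (halving A i l c).Writes a ↔ c.Writes a ∨ a = A := Iff.rfl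

@[simp] theorem realFree_halving (A i l : ℕ) (c : Cmd) :
    (halving A i l c).RealFree ↔ c.RealFree := by
  simp [halving, Cmd.RealFree]

/-- The rule for halving loops. The invariant mentions the current value of the halved cell; since
`v < 2 ^ f` at the start, there are at most `f` iterations. -/
theorem Run.halving {w : ℕ} {s : Store} {A i l : ℕ} {c : Cmd}
    (Inv : ℕ → Store → Prop) (T : ℕ) {v f : ℕ} (hv : v < 2 ^ f)
    (hl : 1 ≤ l) (hlw : l < 2 ^ w) (h2w : 2 < 2 ^ w) (hiw : i < 2 ^ w)
    (hA : s.words A i = v) (h0 : Inv v s)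
    (hstep : ∀ v s, l ≤ v → Inv v s → s.words A i = v →
      Run w c s (fun t s' => t ≤ T ∧ s'.words A i = v ∧ Inv (v / 2) (s'.setWord A i (v / 2)))) :
    Run w (halving A i l c) s (fun t s' => t ≤ f * (T + 12) + 5 ∧ ∃ v, v < l ∧ Inv v s') := by
  have hm : ∀ m, m < 2 ^ w → m % 2 ^ w = m := fun m h => Nat.mod_eq_of_lt h
  have key := Run.loop (w := w) (b := .wordLe (.lit l) (.get A (.lit i)))
    (c := .seq c (.setWord A (.lit i) (.div (.get A (.lit i)) (.lit 2)))) (s := s)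
    (fun ψ s => ∃ v f, v < 2 ^ f ∧ s.words A i = v ∧ Inv v s ∧ ψ = f * (T + 12))
    (φ := f * (T + 12))
    (by
      rintro ψ s ⟨v, f, hvf, hA, hinv, rfl⟩ hb
      simp only [BExp.Holds, WExp.eval, hm _ hlw, hm _ hiw, hA] at hb
      refine Run.seq ((hstep v s hb hinv hA).mono ?_)
      rintro t s' ⟨ht, hA', hinv'⟩
      obtain ⟨f, rfl⟩ : ∃ g, f = g + 1 := by
        rcases f with _ | f
        · simp at hvf; omega
        · exact ⟨f, rfl⟩
      refine Run.setWord ⟨f * (T + 12), ?_, v / 2, f, ?_, ?_, ?_, rfl⟩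
      · simp only [BExp.cost, WExp.cost]
        rw [Nat.add_mul]
        omega
      · rw [pow_succ] at hvf; omega
      · simp [words_setWord, WExp.eval, hm _ hiw, hm _ h2w, hA']
      · simpa [WExp.eval, hm _ hiw, hm _ h2w, hA'] using hinv')
    ⟨v, f, hv, hA, h0, rfl⟩
  refine key.mono ?_
  rintro t s' ⟨ψ, hle, ⟨v, f, hvf, hA, hinv, rfl⟩, hb⟩
  simp only [BExp.Holds, WExp.eval, hm _ hlw, hm _ hiw, hA, not_le] at hb
  refine ⟨?_, v, hb, hinv⟩
  simp only [BExp.cost, WExp.cost] at hle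
  omega

/-! ### Dominance tables -/

-- Numbers of word arrays have names: `v…` is a variable, which is cell `0` of its own array, and
-- `a…` is an array of many cells. The arrays from `1000` on are used as tables.
notation "vLeaf" => 7
notation "vMul" => 9
notation "aCx" => 60
notation "aNd" => 61
notation "aKy" => 62
notation "vFd" => 63
notation "vSt" => 64

/-- `u` lies on the way from the node `v`, inclusive, to the root of the binary heap: the children
of `u` are `2 * u` and `2 * u + 1`, and the root is `1`. The condition `1 ≤ u` excludes the value
that repeated halving reaches beyond the root. -/
def Anc (v u : ℕ) : Prop := ∃ j, u = v / 2 ^ j ∧ 1 ≤ u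

theorem not_anc_zero (u : ℕ) : ¬ Anc 0 u := by
  rintro ⟨j, rfl, h⟩
  simp at h

theorem anc_iff (v u : ℕ) : Anc v u ↔ (1 ≤ v ∧ u = v) ∨ Anc (v / 2) u := by
  constructor
  · rintro ⟨j, rfl, h⟩
    rcases j with _ | j
    · left; simpa using h
    · right
      refine ⟨j, ?_, h⟩
      rw [Nat.div_div_eq_div_mul, pow_succ, mul_comm]
  · rintro (⟨h, rfl⟩ | ⟨j, rfl, h⟩)
    · exact ⟨0, by simp, h⟩
    · refine ⟨j + 1, ?_, h⟩
      rw [Nat.div_div_eq_div_mul, pow_succ, mul_comm]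

theorem Anc.le {v u : ℕ} (h : Anc v u) : u ≤ v := by
  obtain ⟨j, rfl, -⟩ := h
  exact Nat.div_le_self _ _

theorem Anc.of_half {v u : ℕ} (h : Anc (v / 2) u) : Anc v u := (anc_iff v u).2 (Or.inr h)

theorem Anc.self {v : ℕ} (h : 1 ≤ v) : Anc v v := (anc_iff v v).2 (Or.inl ⟨h, rfl⟩)

/-- Of two leaves, `a` is to the left of `b` exactly if the left sibling of some right child above
`b` is above `a`. -/
theorem exists_anc_sibling_iff (L a b : ℕ) (ha : 2 ^ L ≤ a) (ha' : a < 2 ^ (L + 1)) (hb : 2 ^ L ≤ b)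
    (hb' : b < 2 ^ (L + 1)) :
    (∃ u, Anc b u ∧ u % 2 = 1 ∧ 2 ≤ u ∧ Anc a (u - 1)) ↔ a < b := by
  induction L generalizing a b with
  | zero =>
    constructor
    · rintro ⟨u, h, -, h2, -⟩
      have := h.le
      simp at *
      omega
    · intro h; simp at *; omega
  | succ L ih =>
    have hp : 1 ≤ 2 ^ L := Nat.one_le_two_pow
    have e1 : 2 ^ (L + 1) = 2 * 2 ^ L := by ring
    have e2 : 2 ^ (L + 1 + 1) = 4 * 2 ^ L := by ring
    rw [e1] at ha hb
    rw [e2] at ha' hb'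
    have ih' := ih (a / 2) (b / 2) (by omega) (by omega) (by omega) (by omega)
    constructor
    · rintro ⟨u, hu, hodd, h2, hs⟩
      rw [anc_iff] at hu hs
      rcases hu with ⟨-, rfl⟩ | hu
      · rcases hs with ⟨-, hs⟩ | hs
        · omega
        · have := hs.le; omega
      · rcases hs with ⟨-, hs⟩ | hs
        · have := hu.le; omega
        · have := ih'.1 ⟨u, hu, hodd, h2, hs⟩; omega
    · intro hab
      by_cases hc : a / 2 < b / 2
      · obtain ⟨u, hu, hodd, h2, hs⟩ := ih'.2 hc
        exact ⟨u, hu.of_half, hodd, h2, hs.of_half⟩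
      · obtain rfl : b = a + 1 := by omega
        exact ⟨a + 1, Anc.self (by omega), by omega, by omega, Anc.self (by omega)⟩

/-- The addresses at which a point with the coordinates `xs` is entered into a table: one node
above each coordinate, packed into one number behind the prefix `κ`. -/
def InsKey (H : ℕ) : List ℕ → ℕ → ℕ → Prop
  | [], κ, k => k = κ
  | x :: xs, κ, k => ∃ u, Anc (H + x) u ∧ InsKey H xs (κ * (2 * H) + u) k

/-- The addresses that are inspected in order to find a point below `ys`. -/
def QryKey (H : ℕ) : List ℕ → ℕ → ℕ → Prop
  | [], κ, k => k = κ
  | y :: ys, κ, k => ∃ u, Anc (H + y) u ∧ u % 2 = 1 ∧ 2 ≤ u ∧ QryKey H ys (κ * (2 * H) + (u - 1)) k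

/-- Strict dominance, coordinate by coordinate. -/
abbrev Below (xs ys : List ℕ) : Prop := List.Forall₂ (· < ·) xs ys

/-- An address that is common to a point and a query has the same ancestor in each coordinate, and
this ancestor separates the coordinates. -/
theorem below_of_keys {L : ℕ} : ∀ (xs ys : List ℕ) (κ κ' k : ℕ), xs.length = ys.length →
    (∀ x ∈ xs, x < 2 ^ L) → (∀ y ∈ ys, y < 2 ^ L) →
    InsKey (2 ^ L) xs κ k → QryKey (2 ^ L) ys κ' k → κ = κ' ∧ Below xs ys
  | [], [], κ, κ', k, _, _, _, h₁, h₂ => ⟨h₁.symm.trans h₂, List.Forall₂.nil⟩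
  | x :: xs, y :: ys, κ, κ', k, hlen, hx, hy, ⟨u, hu, h₁⟩, ⟨u', hu', hodd, h2, h₂⟩ => by
    obtain ⟨he, hb⟩ := below_of_keys xs ys _ _ k (by simpa using hlen)
      (fun x h => hx x (List.mem_cons_of_mem _ h)) (fun y h => hy y (List.mem_cons_of_mem _ h))
      h₁ h₂
    have hxl := hx x List.mem_cons_self
    have hyl := hy y List.mem_cons_self
    have hul := hu.le
    have hul' := hu'.le
    -- The last node and the rest of the address are recovered by division with remainder.
    have e1 : (κ * (2 * 2 ^ L) + u) / (2 * 2 ^ L) = κ := by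
      rw [mul_comm, Nat.mul_add_div (by positivity), Nat.div_eq_of_lt (by omega), add_zero]
    have e2 : (κ' * (2 * 2 ^ L) + (u' - 1)) / (2 * 2 ^ L) = κ' := by
      rw [mul_comm, Nat.mul_add_div (by positivity), Nat.div_eq_of_lt (by omega), add_zero]
    have hκ : κ = κ' := by rw [← e1, ← e2, he]
    subst hκ
    -- Now the last digits agree as well.
    obtain rfl : u = u' - 1 := by omega
    have hpw : 2 ^ (L + 1) = 2 * 2 ^ L := by ring
    have := (exists_anc_sibling_iff L (2 ^ L + x) (2 ^ L + y) (by omega) (by omega) (by omega)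
      (by omega)).1 ⟨u', hu', hodd, h2, hu⟩
    exact ⟨rfl, List.Forall₂.cons (by omega) hb⟩

theorem exists_keys_of_below {L : ℕ} : ∀ (xs ys : List ℕ) (κ : ℕ),
    (∀ x ∈ xs, x < 2 ^ L) → (∀ y ∈ ys, y < 2 ^ L) → Below xs ys →
    ∃ k, InsKey (2 ^ L) xs κ k ∧ QryKey (2 ^ L) ys κ k
  | [], [], κ, _, _, _ => ⟨κ, rfl, rfl⟩
  | x :: xs, y :: ys, κ, hx, hy, .cons hxy hb => by
    have hxl := hx x List.mem_cons_self
    have hyl := hy y List.mem_cons_self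
    have hpw : 2 ^ (L + 1) = 2 * 2 ^ L := by ring
    obtain ⟨u, hu, hodd, h2, hs⟩ := (exists_anc_sibling_iff L (2 ^ L + x) (2 ^ L + y) (by omega)
      (by omega) (by omega) (by omega)).2 (by omega)
    obtain ⟨k, h₁, h₂⟩ := exists_keys_of_below xs ys (κ * (2 * 2 ^ L) + (u - 1))
      (fun x h => hx x (List.mem_cons_of_mem _ h)) (fun y h => hy y (List.mem_cons_of_mem _ h)) hb
    exact ⟨k, ⟨u - 1, hs, h₁⟩, ⟨u, hu, hodd, h2, h₂⟩⟩

/-- Enter a point into the table `T`: its coordinates from number `i` on are in `aCx`, the address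
built from the earlier ones is in cell `i` of `aKy`, and `m` coordinates remain. -/
def insTree (T : ℕ) : ℕ → ℕ → Cmd
  | 0, i => .setWord T (.get aKy (.lit i)) (var vSt)
  | m + 1, i => .seq (.setWord aNd (.lit i) (.add (var vLeaf) (.get aCx (.lit i))))
      (halving aNd i 1
        (.seq (.setWord aKy (.lit (i + 1))
            (.add (.mul (.get aKy (.lit i)) (var vMul)) (.get aNd (.lit i))))
          (insTree T m (i + 1))))

/-- Look for a point below the one with coordinates in `aCx`, in the same way. -/
def qryTree (T : ℕ) : ℕ → ℕ → Cmd
  | 0, i => .cond (.and (.wordLe (.get T (.get aKy (.lit i))) (var vSt))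
      (.wordLe (var vSt) (.get T (.get aKy (.lit i))))) (assign vFd (.lit 1)) .nop
  | m + 1, i => .seq (.setWord aNd (.lit i) (.add (var vLeaf) (.get aCx (.lit i))))
      (halving aNd i 2
        (.cond (.wordLe (.lit 1) (.mod (.get aNd (.lit i)) (.lit 2)))
          (.seq (.setWord aKy (.lit (i + 1)) (.add (.mul (.get aKy (.lit i)) (var vMul))
              (.sub (.get aNd (.lit i)) (.lit 1))))
            (qryTree T m (i + 1))) .nop))

theorem writes_insTree {T a : ℕ} : ∀ {m i : ℕ}, (insTree T m i).Writes a → a = T ∨ a = aKy ∨ a = aNd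
  | 0, i => by simp only [insTree, Cmd.Writes]; tauto
  | m + 1, i => by
    have := @writes_insTree T a m (i + 1)
    simp only [insTree, Cmd.Writes, writes_halving]; tauto

theorem writes_qryTree {T a : ℕ} :
    ∀ {m i : ℕ}, (qryTree T m i).Writes a → a = aKy ∨ a = aNd ∨ a = vFd
  | 0, i => by simp only [qryTree, Cmd.Writes, writes_assign]; tauto
  | m + 1, i => by
    have := @writes_qryTree T a m (i + 1)
    simp only [qryTree, Cmd.Writes, writes_halving]; tauto

/-- A bound for the time of an operation on an `m`-dimensional table of depth `f`. -/
def treeTime (f : ℕ) : ℕ → ℕ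
  | 0 => 20
  | m + 1 => f * (treeTime f m + 40) + 20

/-- The prefix `κ` is what the earlier coordinates have contributed to the address. All cells of
`aKy` and `aNd` that the outer levels of the recursion still need are preserved. -/
theorem run_insTree {w H f g T : ℕ}
    (hT : T ≠ vLeaf ∧ T ≠ vMul ∧ T ≠ aCx ∧ T ≠ aNd ∧ T ≠ aKy ∧ T ≠ vSt)
    (hf : 2 * H ≤ 2 ^ f) (hH : 1 ≤ H) : ∀ (m i κ : ℕ) (xs : List ℕ) (s : Store), xs.length = m →
    (∀ x ∈ xs, x < H) → i + m + 2 < 2 ^ w → (κ + 1) * (2 * H) ^ m ≤ 2 ^ w →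
    s.words vLeaf 0 = H → s.words vMul 0 = 2 * H →
    (∀ j x, xs[j]? = some x → s.words aCx (i + j) = x) → s.words aKy i = κ → s.words vSt 0 = g →
    Run w (insTree T m i) s (fun t s' => t ≤ treeTime f m ∧
      (∀ k, (InsKey H xs κ k → s'.words T k = g) ∧
        (¬ InsKey H xs κ k → s'.words T k = s.words T k)) ∧
      (∀ j ≤ i, s'.words aKy j = s.words aKy j) ∧ (∀ j < i, s'.words aNd j = s.words aNd j)) := by
  intro m
  obtain ⟨h1, h2, h3, h4, h5, h6⟩ := hT
  induction m with
  | zero =>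
    intro i κ xs s hlen hx hi hk hL hM hcx hky hst
    obtain rfl : xs = [] := by simpa using hlen
    have hi' : i % 2 ^ w = i := Nat.mod_eq_of_lt (by omega)
    refine Run.setWord ⟨by simp [treeTime, WExp.cost], ?_, ?_, ?_⟩
    · intro k
      simp [InsKey, words_setWord, WExp.eval, hi', hky, hst]
      tauto
    · intro j _; rw [words_setWord_of_ne _ _ _ h5.symm]
    · intro j _; rw [words_setWord_of_ne _ _ _ h4.symm]
  | succ m ih =>
    intro i κ xs s hlen hx hi hk hL hM hcx hky hst
    rcases xs with _ | ⟨x, xs⟩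
    · simp at hlen
    have hxH : x < H := hx x List.mem_cons_self
    have hp1 : 1 ≤ (2 * H) ^ m := Nat.one_le_pow _ _ (by omega)
    have hk1 : (κ + 1) * (2 * H) ≤ 2 ^ w := by
      refine le_trans ?_ hk
      rw [pow_succ]
      exact Nat.mul_le_mul_left _ (Nat.le_mul_of_pos_left _ hp1)
    have hHw : 2 * H ≤ 2 ^ w := le_trans (by nlinarith) hk1
    have hi' : i % 2 ^ w = i := Nat.mod_eq_of_lt (by omega)
    have hi1 : (i + 1) % 2 ^ w = i + 1 := Nat.mod_eq_of_lt (by omega)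
    have hcx0 : s.words aCx i = x := by simpa using hcx 0 x rfl
    have hsum : (H + x) % 2 ^ w = H + x := Nat.mod_eq_of_lt (by omega)
    refine Run.seq (Run.setWord ?_)
    simp only [WExp.eval, eval_var, hi', hL, hcx0, hsum]
    set s₁ := s.setWord aNd i (H + x) with hs₁
    refine (Run.halving (w := w) (s := s₁) (A := aNd) (i := i) (l := 1) (v := H + x) (f := f)
      -- While `v` climbs to the root, the entries are complete except for the addresses that use an
      -- ancestor of `v`.
      (fun v s' => (∀ a, a ≠ T → a ≠ aKy → a ≠ aNd → s'.words a = s.words a) ∧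
        (∀ j ≤ i, s'.words aKy j = s.words aKy j) ∧ (∀ j < i, s'.words aNd j = s.words aNd j) ∧
        (∀ k, (InsKey H (x :: xs) κ k → s'.words T k = g ∨
            ∃ u, Anc v u ∧ InsKey H xs (κ * (2 * H) + u) k) ∧
          (¬ InsKey H (x :: xs) κ k → s'.words T k = s.words T k)) ∧
        (∀ u, Anc v u → Anc (H + x) u)) (treeTime f m + 28) (by omega) le_rfl (by omega) (by omega)
      (by omega) (by simp [hs₁, words_setWord]) ?_ ?_).mono ?_
    · refine ⟨fun a _ _ h => words_setWord_of_ne _ _ _ h, ?_, ?_, ?_, fun _ h => h⟩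
      · intro j _; rw [hs₁, words_setWord_of_ne _ _ _ (by decide)]
      · intro j hj; simp [hs₁, words_setWord, hj.ne]
      · intro k
        rw [hs₁, words_setWord_of_ne _ _ _ h4]
        exact ⟨fun h => Or.inr h, fun _ => rfl⟩
    · rintro v s₂ hv ⟨hfr, hkyp, hndp, htab, hsub⟩ hnd
      have hvle : v ≤ H + x := (hsub v (Anc.self hv)).le
      have hkv : κ * (2 * H) + v < 2 ^ w := by nlinarith
      have hmul : (κ * (2 * H)) % 2 ^ w = κ * (2 * H) := Nat.mod_eq_of_lt (by omega)
      have hadd : (κ * (2 * H) + v) % 2 ^ w = κ * (2 * H) + v := Nat.mod_eq_of_lt hkv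
      refine Run.seq (Run.setWord ?_)
      simp only [WExp.eval, eval_var, hi', hi1, hfr vMul h2.symm (by decide) (by decide), hM,
        hkyp i le_rfl, hky, hnd, hmul, hadd]
      refine ((ih (i + 1) (κ * (2 * H) + v) xs (s₂.setWord aKy (i + 1) (κ * (2 * H) + v))
        (by simpa using hlen) (fun y hy => hx y (List.mem_cons_of_mem _ hy)) (by omega) ?_ ?_ ?_ ?_
        ?_ ?_).frame).mono ?_
      · refine le_trans ?_ hk
        rw [pow_succ, mul_comm ((2 * H) ^ m), ← mul_assoc (κ + 1)]
        refine Nat.mul_le_mul_right _ ?_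
        rw [Nat.add_mul]
        omega
      · rw [words_setWord_of_ne _ _ _ (by decide), hfr _ h1.symm (by decide) (by decide), hL]
      · rw [words_setWord_of_ne _ _ _ (by decide), hfr _ h2.symm (by decide) (by decide), hM]
      · intro j y hj
        rw [words_setWord_of_ne _ _ _ (by decide), hfr _ h3.symm (by decide) (by decide),
          add_assoc, add_comm 1 j]
        exact hcx (j + 1) y (by simpa using hj)
      · simp [words_setWord]
      · rw [words_setWord_of_ne _ _ _ (by decide), hfr _ h6.symm (by decide) (by decide), hst]
      rintro t s' ⟨⟨ht, htab', hky', hnd'⟩, hfr'⟩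
      refine ⟨?_, ?_, ?_, ?_, ?_, ?_, ?_⟩
      · simp only [WExp.cost, cost_var]; omega
      · rw [hnd' i (by omega), words_setWord_of_ne _ _ _ (by decide), hnd]
      · intro a ha1 ha2 ha3
        rw [words_setWord_of_ne _ _ _ ha3, hfr' a (fun h => by
          rcases writes_insTree h with h | h | h <;> contradiction),
          words_setWord_of_ne _ _ _ ha2, hfr a ha1 ha2 ha3]
      · intro j hj
        rw [words_setWord_of_ne _ _ _ (by decide), hky' j (by omega), words_setWord,
          if_neg (by omega), hkyp j hj]
      · intro j hj
        rw [words_setWord, if_neg (by omega), hnd' j (by omega),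
          words_setWord_of_ne _ _ _ (by decide), hndp j hj]
      · intro k
        rw [words_setWord_of_ne _ _ _ h4]
        constructor
        · intro hfull
          by_cases hkk : InsKey H xs (κ * (2 * H) + v) k
          · exact Or.inl ((htab' k).1 hkk)
          · rcases (htab k).1 hfull with h | ⟨u, hu, hku⟩
            · left
              rw [(htab' k).2 hkk, words_setWord_of_ne _ _ _ h5, h]
            · right
              rw [anc_iff] at hu
              rcases hu with ⟨-, rfl⟩ | hu
              · exact absurd hku hkk
              · exact ⟨u, hu, hku⟩
        · intro hfull
          have hkk : ¬ InsKey H xs (κ * (2 * H) + v) k :=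
            fun h => hfull ⟨v, hsub v (Anc.self hv), h⟩
          rw [(htab' k).2 hkk, words_setWord_of_ne _ _ _ h5, (htab k).2 hfull]
      · exact fun u hu => hsub u hu.of_half
    · rintro t s' ⟨ht, v, hv, hfr, hkyp, hndp, htab, hsub⟩
      refine ⟨?_, ?_, hkyp, hndp⟩
      · have hT : treeTime f m + 28 + 12 = treeTime f m + 40 := rfl
        rw [hT] at ht
        simp only [WExp.cost, cost_var, treeTime]
        omega
      · intro k
        refine ⟨fun h => ((htab k).1 h).resolve_right ?_, (htab k).2⟩
        rintro ⟨u, hu, -⟩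
        -- The climb has passed the root, so no ancestor is left.
        obtain rfl : v = 0 := by omega
        exact not_anc_zero _ hu

/-- As in `run_insTree`, but `vFd` records whether one of the inspected cells has the content `g`,
and only the left siblings of right children are inspected. -/
theorem run_qryTree {w H f g T : ℕ} (hT : T ≠ aNd ∧ T ≠ aKy ∧ T ≠ vFd)
    (hf : 2 * H ≤ 2 ^ f) (hH : 1 ≤ H) : ∀ (m i κ : ℕ) (ys : List ℕ) (s : Store), ys.length = m →
    (∀ y ∈ ys, y < H) → i + m + 2 < 2 ^ w → (κ + 1) * (2 * H) ^ m ≤ 2 ^ w →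
    s.words vLeaf 0 = H → s.words vMul 0 = 2 * H →
    (∀ j y, ys[j]? = some y → s.words aCx (i + j) = y) → s.words aKy i = κ → s.words vSt 0 = g →
    Run w (qryTree T m i) s (fun t s' => t ≤ treeTime f m ∧
      (s'.words vFd 0 = 1 ↔ s.words vFd 0 = 1 ∨ ∃ k, QryKey H ys κ k ∧ s.words T k = g) ∧
      (s.words vFd 0 ≤ 1 → s'.words vFd 0 ≤ 1) ∧
      (∀ j ≤ i, s'.words aKy j = s.words aKy j) ∧ (∀ j < i, s'.words aNd j = s.words aNd j)) := by
  intro m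
  obtain ⟨h1, h2, h3⟩ := hT
  induction m with
  | zero =>
    intro i κ xs s hlen hx hi hk hL hM hcx hky hst
    obtain rfl : xs = [] := by simpa using hlen
    have hi' : i % 2 ^ w = i := Nat.mod_eq_of_lt (by omega)
    have hone : 1 % 2 ^ w = 1 := Nat.mod_eq_of_lt (by omega)
    have hc : (BExp.and (.wordLe (.get T (.get aKy (.lit i))) (var vSt))
      (.wordLe (var vSt) (.get T (.get aKy (.lit i))))).cost = 13 := rfl
    refine Run.cond (fun hb => Run.assign ?_) (fun hb => Run.nop ?_)
    · simp only [BExp.Holds, WExp.eval, eval_var, hi', hky, hst] at hb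
      refine ⟨by rw [hc]; simp [treeTime, WExp.cost], ?_, ?_, ?_, ?_⟩
      · simp [words_setWord, WExp.eval, hone, QryKey]
        right; omega
      · simp [words_setWord, WExp.eval, hone]
      · intro j _; rw [words_setWord_of_ne _ _ _ (by decide)]
      · intro j _; rw [words_setWord_of_ne _ _ _ (by decide)]
    · simp only [BExp.Holds, WExp.eval, eval_var, hi', hky, hst] at hb
      refine ⟨by rw [hc]; simp [treeTime], ?_, fun h => h, fun _ _ => rfl, fun _ _ => rfl⟩
      simp only [QryKey, exists_eq_left]
      constructor
      · exact Or.inl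
      · rintro (h | h)
        · exact h
        · omega
  | succ m ih =>
    intro i κ ys s hlen hx hi hk hL hM hcx hky hst
    rcases ys with _ | ⟨x, xs⟩
    · simp at hlen
    have hxH : x < H := hx x List.mem_cons_self
    have hp1 : 1 ≤ (2 * H) ^ m := Nat.one_le_pow _ _ (by omega)
    have hk1 : (κ + 1) * (2 * H) ≤ 2 ^ w := by
      refine le_trans ?_ hk
      rw [pow_succ]
      exact Nat.mul_le_mul_left _ (Nat.le_mul_of_pos_left _ hp1)
    have hHw : 2 * H ≤ 2 ^ w := le_trans (by nlinarith) hk1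
    have hi' : i % 2 ^ w = i := Nat.mod_eq_of_lt (by omega)
    have hi1 : (i + 1) % 2 ^ w = i + 1 := Nat.mod_eq_of_lt (by omega)
    have hone : 1 % 2 ^ w = 1 := Nat.mod_eq_of_lt (by omega)
    have htwo : 2 % 2 ^ w = 2 := Nat.mod_eq_of_lt (by omega)
    have hcx0 : s.words aCx i = x := by simpa using hcx 0 x rfl
    have hsum : (H + x) % 2 ^ w = H + x := Nat.mod_eq_of_lt (by omega)
    refine Run.seq (Run.setWord ?_)
    simp only [WExp.eval, eval_var, hi', hL, hcx0, hsum]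
    set s₁ := s.setWord aNd i (H + x) with hs₁
    refine (Run.halving (w := w) (s := s₁) (A := aNd) (i := i) (l := 2) (v := H + x) (f := f)
      -- Found so far, or to be found at an ancestor of `v`: this alternative does not change while
      -- `v` climbs to the root.
      (fun v s' => (∀ a, a ≠ aKy → a ≠ aNd → a ≠ vFd → s'.words a = s.words a) ∧
        (∀ j ≤ i, s'.words aKy j = s.words aKy j) ∧ (∀ j < i, s'.words aNd j = s.words aNd j) ∧
        ((s'.words vFd 0 = 1 ∨ ∃ u, Anc v u ∧ u % 2 = 1 ∧ 2 ≤ u ∧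
            ∃ k, QryKey H xs (κ * (2 * H) + (u - 1)) k ∧ s.words T k = g) ↔
          (s.words vFd 0 = 1 ∨ ∃ k, QryKey H (x :: xs) κ k ∧ s.words T k = g)) ∧
        (s.words vFd 0 ≤ 1 → s'.words vFd 0 ≤ 1) ∧
        (∀ u, Anc v u → Anc (H + x) u)) (treeTime f m + 28) (by omega) (by omega) (by omega)
      (by omega) (by omega) (by simp [hs₁, words_setWord]) ?_ ?_).mono ?_
    · refine ⟨fun a _ h _ => words_setWord_of_ne _ _ _ h, ?_, ?_, ?_, ?_, fun _ h => h⟩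
      · intro j _; rw [hs₁, words_setWord_of_ne _ _ _ (by decide)]
      · intro j hj; simp [hs₁, words_setWord, hj.ne]
      · rw [hs₁, words_setWord_of_ne _ _ _ (by decide)]
        refine or_congr_right ⟨?_, ?_⟩
        · rintro ⟨u, a, b, c, k, d, e⟩; exact ⟨k, ⟨u, a, b, c, d⟩, e⟩
        · rintro ⟨k, ⟨u, a, b, c, d⟩, e⟩; exact ⟨u, a, b, c, k, d, e⟩
      · rw [hs₁, words_setWord_of_ne _ _ _ (by decide)]; exact fun h => h
    · rintro v s₂ hv ⟨hfr, hkyp, hndp, hfd, hfd1, hsub⟩ hnd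
      have hvle : v ≤ H + x := (hsub v (Anc.self (by omega))).le
      have hkv : κ * (2 * H) + v < 2 ^ w := by nlinarith
      have hmul : (κ * (2 * H)) % 2 ^ w = κ * (2 * H) := Nat.mod_eq_of_lt (by omega)
      have hadd : (κ * (2 * H) + (v - 1)) % 2 ^ w = κ * (2 * H) + (v - 1) :=
        Nat.mod_eq_of_lt (by omega)
      have hbc : (BExp.wordLe (.lit 1) (.mod (.get aNd (.lit i)) (.lit 2))).cost = 6 := rfl
      refine Run.cond (fun hb => Run.seq (Run.setWord ?_)) (fun hb => Run.nop ?_)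
      · simp only [BExp.Holds, WExp.eval, hi', hone, htwo, hnd] at hb
        simp only [WExp.eval, eval_var, hi', hi1, hfr vMul (by decide) (by decide) (by decide), hM,
          hkyp i le_rfl, hky, hnd, hmul, hone, hadd]
        refine ((ih (i + 1) (κ * (2 * H) + (v - 1)) xs
          (s₂.setWord aKy (i + 1) (κ * (2 * H) + (v - 1)))
          (by simpa using hlen) (fun y hy => hx y (List.mem_cons_of_mem _ hy)) (by omega) ?_ ?_ ?_
          ?_ ?_ ?_).frame).mono ?_
        · refine le_trans ?_ hk
          rw [pow_succ, mul_comm ((2 * H) ^ m), ← mul_assoc (κ + 1)]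
          refine Nat.mul_le_mul_right _ ?_
          rw [Nat.add_mul]
          omega
        · rw [words_setWord_of_ne _ _ _ (by decide), hfr _ (by decide) (by decide) (by decide), hL]
        · rw [words_setWord_of_ne _ _ _ (by decide), hfr _ (by decide) (by decide) (by decide), hM]
        · intro j y hj
          rw [words_setWord_of_ne _ _ _ (by decide), hfr _ (by decide) (by decide) (by decide),
            add_assoc, add_comm 1 j]
          exact hcx (j + 1) y (by simpa using hj)
        · simp [words_setWord]
        · rw [words_setWord_of_ne _ _ _ (by decide), hfr _ (by decide) (by decide) (by decide), hst]
        rintro t s' ⟨⟨ht, hfd', hfd1', hky', hnd'⟩, hfr'⟩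
        refine ⟨?_, ?_, ?_, ?_, ?_, ?_, ?_, ?_⟩
        · rw [hbc]; simp only [WExp.cost, cost_var]; omega
        · rw [hnd' i (by omega), words_setWord_of_ne _ _ _ (by decide), hnd]
        · intro a ha1 ha2 ha3
          rw [words_setWord_of_ne _ _ _ ha2, hfr' a (fun h => by
            rcases writes_qryTree h with h | h | h <;> contradiction),
            words_setWord_of_ne _ _ _ ha1, hfr a ha1 ha2 ha3]
        · intro j hj
          rw [words_setWord_of_ne _ _ _ (by decide), hky' j (by omega), words_setWord,
            if_neg (by omega), hkyp j hj]
        · intro j hj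
          rw [words_setWord, if_neg (by omega), hnd' j (by omega),
            words_setWord_of_ne _ _ _ (by decide), hndp j hj]
        · rw [words_setWord_of_ne _ _ _ (by decide), hfd', ← hfd,
            words_setWord_of_ne _ _ _ (by decide), words_setWord_of_ne _ _ _ h2, hfr T h2 h1 h3,
            or_assoc]
          refine or_congr_right ⟨?_, ?_⟩
          · rintro (⟨k, hk, hkg⟩ | ⟨u, hu, h⟩)
            · exact ⟨v, Anc.self (by omega), by omega, hv, k, hk, hkg⟩
            · exact ⟨u, hu.of_half, h⟩
          · rintro ⟨u, hu, hodd, h2u, k, hk, hkg⟩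
            rw [anc_iff] at hu
            rcases hu with ⟨-, rfl⟩ | hu
            · exact Or.inl ⟨k, hk, hkg⟩
            · exact Or.inr ⟨u, hu, hodd, h2u, k, hk, hkg⟩
        · intro h
          rw [words_setWord_of_ne _ _ _ (by decide)]
          refine hfd1' ?_
          rw [words_setWord_of_ne _ _ _ (by decide)]
          exact hfd1 h
        · exact fun u hu => hsub u hu.of_half
      · simp only [BExp.Holds, WExp.eval, hi', hone, htwo, hnd] at hb
        refine ⟨by rw [hbc]; omega, hnd, ?_, ?_, ?_, ?_, ?_, fun u hu => hsub u hu.of_half⟩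
        · intro a ha1 ha2 ha3
          rw [words_setWord_of_ne _ _ _ ha2, hfr a ha1 ha2 ha3]
        · intro j hj
          rw [words_setWord_of_ne _ _ _ (by decide), hkyp j hj]
        · intro j hj
          rw [words_setWord, if_neg (by omega), hndp j hj]
        · rw [words_setWord_of_ne _ _ _ (by decide), ← hfd]
          refine or_congr_right ⟨?_, ?_⟩
          · rintro ⟨u, hu, h⟩
            exact ⟨u, hu.of_half, h⟩
          · rintro ⟨u, hu, hodd, h⟩
            rw [anc_iff] at hu
            rcases hu with ⟨-, rfl⟩ | hu
            · omega
            · exact ⟨u, hu, hodd, h⟩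
        · intro h
          rw [words_setWord_of_ne _ _ _ (by decide)]
          exact hfd1 h
    · rintro t s' ⟨ht, v, hv, hfr, hkyp, hndp, hfd, hfd1, hsub⟩
      refine ⟨?_, ?_, hfd1, hkyp, hndp⟩
      · have hT : treeTime f m + 28 + 12 = treeTime f m + 40 := rfl
        rw [hT] at ht
        simp only [WExp.cost, cost_var, treeTime]
        omega
      · rw [← hfd]
        refine ⟨Or.inl, fun h => h.resolve_right ?_⟩
        rintro ⟨u, hu, -, h2u, -⟩
        have := hu.le
        omega

/-- The words are long enough for the addresses of tables with at most six dimensions and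
`2 ^ L` leaves in each. -/
structure Roomy (w L : ℕ) : Prop where
  addr : (2 * 2 ^ L) ^ 6 ≤ 2 ^ w
  const : 1024 < 2 ^ w

theorem Roomy.leaf {w L : ℕ} (h : Roomy w L) : 2 * 2 ^ L ≤ 2 ^ w :=
  le_trans (by
    calc 2 * 2 ^ L = (2 * 2 ^ L) ^ 1 := (pow_one _).symm
      _ ≤ (2 * 2 ^ L) ^ 6 := Nat.pow_le_pow_right (by positivity) (by norm_num)) h.addr

theorem Roomy.lit {w L : ℕ} (h : Roomy w L) {n : ℕ} (hn : n ≤ 1024) : n % 2 ^ w = n :=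
  Nat.mod_eq_of_lt (lt_of_le_of_lt hn h.const)

/-- The word array `T` represents the set `S` of points: exactly at the addresses of these points
it has the content `g`, and it has smaller contents everywhere else. -/
structure Tab (s : Store) (T L d g : ℕ) (S : Set (List ℕ)) : Prop where
  le : ∀ k, s.words T k ≤ g
  iff : ∀ k, s.words T k = g ↔ ∃ e ∈ S, InsKey (2 ^ L) e 0 k
  dim : ∀ e ∈ S, e.length = d ∧ ∀ x ∈ e, x < 2 ^ L

theorem Tab.congr {s s' : Store} {T L d g : ℕ} {S : Set (List ℕ)} (h : Tab s T L d g S)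
    (he : s'.words T = s.words T) : Tab s' T L d g S :=
  ⟨fun k => he ▸ h.le k, fun k => he ▸ h.iff k, h.dim⟩

/-- With a larger content as its mark, a table is empty. -/
theorem Tab.empty {s : Store} {T L d g : ℕ} (h : ∀ k, s.words T k < g) : Tab s T L d g ∅ :=
  ⟨fun k => (h k).le, fun k => by simpa using (h k).ne, by simp⟩

/-- The expression `e` has the value `v` in all memories that differ from `s` at most in the
working arrays of the tables. -/
def EvalsTo (w : ℕ) (s : Store) (e : WExp) (v : ℕ) : Prop :=
  ∀ s' : Store, (∀ a, a < 60 ∨ 64 < a → s'.words a = s.words a) → e.eval w s' = v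

/-- Store the values of expressions in `aCx`, from cell `i` on. -/
def setCx : ℕ → List WExp → Cmd
  | _, [] => .nop
  | i, e :: es => .seq (.setWord aCx (.lit i) e) (setCx (i + 1) es)

theorem writes_setCx {a : ℕ} : ∀ {i : ℕ} {es : List WExp}, (setCx i es).Writes a → a = aCx
  | _, [] => by simp [setCx, Cmd.Writes]
  | i, e :: es => by
    have := @writes_setCx a (i + 1) es
    simp only [setCx, Cmd.Writes]; tauto

theorem run_setCx {w : ℕ} {s₀ : Store} : ∀ (es : List WExp) (vs : List ℕ) (i : ℕ) (s : Store),
    i + es.length < 2 ^ w → List.Forall₂ (EvalsTo w s₀) es vs →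
    (∀ a, a < 60 ∨ 64 < a → s.words a = s₀.words a) →
    Run w (setCx i es) s (fun t s' => t ≤ (es.map fun e => e.cost + 2).sum + 1 ∧
      (∀ j x, vs[j]? = some x → s'.words aCx (i + j) = x) ∧
      ∀ j < i, s'.words aCx j = s.words aCx j)
  | [], [], i, s, _, _, _ => Run.nop ⟨by simp, by simp, fun _ _ => rfl⟩
  | e :: es, v :: vs, i, s, hi, .cons he hes, hs => by
    have hi' : i % 2 ^ w = i := Nat.mod_eq_of_lt (by omega)
    refine Run.seq (Run.setWord ?_)
    simp only [WExp.eval, hi', he s hs]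
    refine (run_setCx es vs (i + 1) (s.setWord aCx i v) (by simp at hi; omega) hes ?_).mono ?_
    · intro a ha
      rw [words_setWord_of_ne _ _ _ (by omega), hs a ha]
    · rintro t s' ⟨ht, hv, hlt⟩
      refine ⟨?_, ?_, ?_⟩
      · simp only [WExp.cost, List.map_cons, List.sum_cons]; omega
      · intro j x hj
        rcases j with _ | j
        · simp only [List.getElem?_cons_zero, Option.some.injEq] at hj
          subst hj
          rw [add_zero, hlt i (by omega)]
          simp [words_setWord]
        · rw [← hv j x (by simpa using hj)]
          congr 1; omega
      · intro j hj
        rw [hlt j (by omega), words_setWord, if_neg (by omega)]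

/-- Enter the point with coordinates `es` into the table `T` with the mark `st`. -/
def insTab (T : ℕ) (st : WExp) (es : List WExp) : Cmd :=
  .seq (setCx 0 es) (.seq (.setWord aKy (.lit 0) (.lit 0)) (.seq (assign vSt st)
    (insTree T es.length 0)))

/-- Set `vFd` to `1` if the table `T` with the mark `st` has a point below the point with
coordinates `es`, and to `0` otherwise. -/
def qryTab (T : ℕ) (st : WExp) (es : List WExp) : Cmd :=
  .seq (setCx 0 es) (.seq (.setWord aKy (.lit 0) (.lit 0)) (.seq (assign vSt st)
    (.seq (assign vFd (.lit 0)) (qryTree T es.length 0))))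

theorem writes_insTab {T a : ℕ} {st : WExp} {es : List WExp} (h : (insTab T st es).Writes a) :
    a = T ∨ (60 ≤ a ∧ a ≤ 64) := by
  simp only [insTab, Cmd.Writes, writes_assign] at h
  rcases h with h | h | h | h
  · have := writes_setCx h; omega
  · omega
  · omega
  · rcases writes_insTree h with h | h | h <;> omega

theorem writes_qryTab {T a : ℕ} {st : WExp} {es : List WExp} (h : (qryTab T st es).Writes a) :
    60 ≤ a ∧ a ≤ 64 := by
  simp only [qryTab, Cmd.Writes, writes_assign] at h
  rcases h with h | h | h | h | h
  · have := writes_setCx h; omega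
  · omega
  · omega
  · omega
  · rcases writes_qryTree h with h | h | h <;> omega

theorem realFree_setCx : ∀ (i : ℕ) (es : List WExp), (setCx i es).RealFree
  | _, [] => trivial
  | i, _ :: es => ⟨trivial, realFree_setCx (i + 1) es⟩

theorem realFree_qryTree (T : ℕ) : ∀ (m i : ℕ), (qryTree T m i).RealFree
  | 0, _ => ⟨trivial, trivial⟩
  | m + 1, i => by simpa [qryTree, Cmd.RealFree] using realFree_qryTree T m (i + 1)

/-- The time of an operation on a table. -/
def tabTime (L d c : ℕ) : ℕ := treeTime (L + 1) d + c + 20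

/-- The common beginning of `insTab` and `qryTab`. -/
theorem tab_prelude {w : ℕ} {s : Store} {st : WExp} {es : List WExp} {vs : List ℕ} {L g : ℕ}
    {c : Cmd} {Φ : ℕ → Store → Prop} (hroom : Roomy w L) (hes : List.Forall₂ (EvalsTo w s) es vs)
    (hst : EvalsTo w s st g) (hd : es.length ≤ 6)
    (h : ∀ s₁ t₁, t₁ ≤ (es.map fun e => e.cost + 2).sum + st.cost + 10 →
      (∀ a, a < 60 ∨ 64 < a → s₁.words a = s.words a) →
      (∀ j x, vs[j]? = some x → s₁.words aCx (0 + j) = x) → s₁.words aKy 0 = 0 →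
      s₁.words vSt 0 = g → Run w c s₁ (fun t s' => Φ (t₁ + t) s')) :
    Run w (.seq (setCx 0 es) (.seq (.setWord aKy (.lit 0) (.lit 0)) (.seq (assign vSt st) c)))
      s Φ := by
  have h1024 := hroom.const
  refine Run.seq ((run_setCx es vs 0 s (by omega) hes (fun _ _ => rfl)).frame.mono ?_)
  rintro t₁ s₁ ⟨⟨ht₁, hcx, -⟩, hfr⟩
  have hfr' : ∀ a, a < 60 ∨ 64 < a → s₁.words a = s.words a := fun a ha =>
    hfr a (fun h => by have := writes_setCx h; omega)
  refine Run.seq (Run.setWord ?_)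
  simp only [WExp.eval, Nat.zero_mod]
  refine Run.seq (Run.assign ?_)
  rw [hst (s₁.setWord aKy 0 0) (fun a ha => by
    rw [words_setWord_of_ne _ _ _ (by omega), hfr' a ha])]
  refine (h ((s₁.setWord aKy 0 0).setWord vSt 0 g) (t₁ + (3 + (st.cost + 2))) (by omega) ?_ ?_ ?_
    ?_).mono ?_
  · intro a ha
    rw [words_setWord_of_ne _ _ _ (by omega), words_setWord_of_ne _ _ _ (by omega), hfr' a ha]
  · intro j x hj
    rw [words_setWord_of_ne _ _ _ (by omega), words_setWord_of_ne _ _ _ (by omega), hcx j x hj]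
  · simp [words_setWord]
  · simp [words_setWord]
  · intro t s' hΦ
    convert hΦ using 1
    simp only [WExp.cost]; omega

/-- Insertion into a dominance table takes time `O(L ^ d)`, see `tabTime_le`. -/
theorem run_insTab {w : ℕ} {s : Store} {T : ℕ} {st : WExp} {es : List WExp} {vs : List ℕ}
    {L d g : ℕ} {S : Set (List ℕ)} (hroom : Roomy w L) (hleaf : s.words vLeaf 0 = 2 ^ L)
    (hmul : s.words vMul 0 = 2 * 2 ^ L) (htab : Tab s T L d g S)
    (hes : List.Forall₂ (EvalsTo w s) es vs) (hst : EvalsTo w s st g) (hd : es.length = d)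
    (hd6 : d ≤ 6) (hvs : ∀ x ∈ vs, x < 2 ^ L) (hT : 1000 ≤ T) :
    Run w (insTab T st es) s (fun t s' =>
      t ≤ tabTime L d ((es.map fun e => e.cost + 2).sum + st.cost) ∧
        Tab s' T L d g (insert vs S)) := by
  have h1024 := hroom.const
  have hlen : vs.length = d := by rw [← hes.length_eq, hd]
  refine tab_prelude hroom hes hst (by omega) ?_
  intro s₁ t₁ ht₁ hfr hcx hky hg
  have h1 : 1 ≤ 2 ^ L := Nat.one_le_two_pow
  refine (run_insTree (w := w) (H := 2 ^ L) (f := L + 1) (g := g) (T := T) (by omega)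
    (by rw [pow_succ]; omega) h1 es.length 0 0 vs s₁ (by omega) hvs (by omega) ?_
    (by rw [hfr _ (by omega), hleaf]) (by rw [hfr _ (by omega), hmul]) hcx hky hg).mono ?_
  · rw [zero_add, one_mul]
    exact le_trans (Nat.pow_le_pow_right (by positivity) (by omega)) hroom.addr
  · rintro t s' ⟨ht, hT', -, -⟩
    have hsT : s₁.words T = s.words T := hfr T (by omega)
    refine ⟨by simp only [tabTime]; rw [hd] at ht; omega, ?_, ?_, ?_⟩
    · intro k
      by_cases hk : InsKey (2 ^ L) vs 0 k
      · exact ((hT' k).1 hk).le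
      · rw [(hT' k).2 hk, hsT]; exact htab.le k
    · intro k
      by_cases hk : InsKey (2 ^ L) vs 0 k
      · simp only [(hT' k).1 hk, true_iff]
        exact ⟨vs, Set.mem_insert _ _, hk⟩
      · rw [(hT' k).2 hk, hsT, htab.iff k]
        simp [hk]
    · rintro e (rfl | he)
      · exact ⟨hlen, hvs⟩
      · exact htab.dim e he

/-- A query decides whether the table has a point strictly below the given one. -/
theorem run_qryTab {w : ℕ} {s : Store} {T : ℕ} {st : WExp} {es : List WExp} {vs : List ℕ}
    {L d g : ℕ} {S : Set (List ℕ)} (hroom : Roomy w L) (hleaf : s.words vLeaf 0 = 2 ^ L)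
    (hmul : s.words vMul 0 = 2 * 2 ^ L) (htab : Tab s T L d g S)
    (hes : List.Forall₂ (EvalsTo w s) es vs) (hst : EvalsTo w s st g) (hd : es.length = d)
    (hd6 : d ≤ 6) (hvs : ∀ x ∈ vs, x < 2 ^ L) (hT : 1000 ≤ T) :
    Run w (qryTab T st es) s (fun t s' =>
      t ≤ tabTime L d ((es.map fun e => e.cost + 2).sum + st.cost) ∧
        (s'.words vFd 0 = 1 ↔ ∃ e ∈ S, Below e vs) ∧ s'.words vFd 0 ≤ 1) := by
  have h1024 := hroom.const
  have hlen : vs.length = d := by rw [← hes.length_eq, hd]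
  refine tab_prelude hroom hes hst (by omega) ?_
  intro s₁ t₁ ht₁ hfr hcx hky hg
  have h1 : 1 ≤ 2 ^ L := Nat.one_le_two_pow
  refine Run.seq (Run.assign ?_)
  simp only [WExp.eval, Nat.zero_mod]
  refine (run_qryTree (w := w) (H := 2 ^ L) (f := L + 1) (g := g) (T := T) (by omega)
    (by rw [pow_succ]; omega) h1 es.length 0 0 vs (s₁.setWord vFd 0 0) (by omega) hvs (by omega) ?_
    (by rw [words_setWord_of_ne _ _ _ (by omega), hfr _ (by omega), hleaf])
    (by rw [words_setWord_of_ne _ _ _ (by omega), hfr _ (by omega), hmul])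
    (by simpa only [words_setWord_of_ne _ _ _ (show aCx ≠ vFd by decide)] using hcx)
    (by rw [words_setWord_of_ne _ _ _ (by omega), hky])
    (by rw [words_setWord_of_ne _ _ _ (by omega), hg])).mono ?_
  · rw [zero_add, one_mul]
    exact le_trans (Nat.pow_le_pow_right (by positivity) (by omega)) hroom.addr
  · rintro t s' ⟨ht, hfd, hfd1, -, -⟩
    refine ⟨by simp only [tabTime, WExp.cost]; rw [hd] at ht; omega, ?_,
      hfd1 (by simp [words_setWord])⟩
    rw [hfd, words_setWord_of_ne _ _ _ (show T ≠ vFd by omega), hfr T (by omega)]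
    simp only [words_setWord, and_self, if_true, zero_ne_one, false_or]
    constructor
    · rintro ⟨k, hk, hkg⟩
      obtain ⟨e, he, hek⟩ := (htab.iff k).1 hkg
      have hde := htab.dim e he
      exact ⟨e, he, (below_of_keys e vs 0 0 k (by omega) hde.2 hvs hek hk).2⟩
    · rintro ⟨e, he, hb⟩
      obtain ⟨k, hk₁, hk₂⟩ := exists_keys_of_below e vs 0 (htab.dim e he).2 hvs hb
      exact ⟨k, hk₂, (htab.iff k).2 ⟨e, he, hk₁⟩⟩

theorem treeTime_le (L : ℕ) : ∀ d, treeTime (L + 1) d ≤ (20 + 60 * d) * (L + 1) ^ d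
  | 0 => by simp [treeTime]
  | d + 1 => by
    have h1 : 1 ≤ (L + 1) ^ d := Nat.one_le_pow _ _ (by omega)
    have ih := treeTime_le L d
    have h2 : 1 ≤ (L + 1) ^ (d + 1) := Nat.one_le_pow _ _ (by omega)
    calc treeTime (L + 1) (d + 1) = (L + 1) * (treeTime (L + 1) d + 40) + 20 := rfl
      _ ≤ (L + 1) * ((20 + 60 * d) * (L + 1) ^ d + 40 * (L + 1) ^ d) + 20 * (L + 1) ^ (d + 1) := by
        gcongr <;> omega
      _ = (20 + 60 * (d + 1)) * (L + 1) ^ (d + 1) := by ring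

theorem tabTime_le (L d c : ℕ) : tabTime L d c ≤ (40 + 60 * d + c) * (L + 1) ^ d := by
  have h1 : 1 ≤ (L + 1) ^ d := Nat.one_le_pow _ _ (by omega)
  have h2 := treeTime_le L d
  have h3 : c ≤ c * (L + 1) ^ d := Nat.le_mul_of_pos_right _ h1
  have h4 : (40 + 60 * d + c) * (L + 1) ^ d =
    (20 + 60 * d) * (L + 1) ^ d + 20 * (L + 1) ^ d + c * (L + 1) ^ d := by ring
  simp only [tabTime]
  omega

/-! ### Binary search -/

notation "vHalf" => 8
notation "vBv" => 70
notation "vBs" => 71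
notation "vBc" => 72
notation "vTv" => 73

/-- Search for the last number that passes the test `tst`, which reads a candidate from `vBc` and
writes its verdict to `vTv`. -/
def bsearch (tst : Cmd) : Cmd :=
  .seq (assign vBv (.lit 0)) (.seq (assign vBs (var vHalf)) (halving vBs 0 1
    (.seq (assign vBc (.add (var vBv) (var vBs))) (.seq tst
      (.cond (.wordLe (.lit 1) (var vTv)) (assign vBv (var vBc)) .nop)))))

theorem writes_bsearch {tst : Cmd} {a : ℕ} :
    (bsearch tst).Writes a ↔ a = vBv ∨ a = vBs ∨ a = vBc ∨ tst.Writes a := by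
  simp only [bsearch, Cmd.Writes, writes_assign, writes_halving, or_false]; tauto

theorem realFree_bsearch {tst : Cmd} (h : tst.RealFree) : (bsearch tst).RealFree := by
  simp [bsearch, Cmd.RealFree, h]

/-- If `p` is true at `0` and false at `2 * 2 ^ l`, then binary search finds a place where `p`
changes from true to false. Monotonicity of `p` is not needed. -/
theorem run_bsearch {w : ℕ} {s : Store} {tst : Cmd} {l T : ℕ} (p : ℕ → Prop)
    (hw : 2 * 2 ^ l ≤ 2 ^ w) (hw2 : 2 < 2 ^ w) (hhalf : s.words vHalf 0 = 2 ^ l)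
    (hrf : tst.RealFree)
    (hwr : ¬ tst.Writes vBv ∧ ¬ tst.Writes vBs ∧ ¬ tst.Writes vBc) (h0 : p 0) (h1 : ¬ p (2 * 2 ^ l))
    (htst : ∀ (s₁ : Store) (c : ℕ), s₁.reals = s.reals →
      (∀ a, ¬ tst.Writes a → a ≠ vBv → a ≠ vBs → a ≠ vBc → s₁.words a = s.words a) →
      s₁.words vBc 0 = c → 1 ≤ c → c < 2 * 2 ^ l →
      Run w tst s₁ (fun t s' => t ≤ T ∧ (1 ≤ s'.words vTv 0 ↔ p c))) :
    Run w (bsearch tst) s (fun t s' => t ≤ (l + 1) * (T + 30) + 20 ∧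
      p (s'.words vBv 0) ∧ ¬ p (s'.words vBv 0 + 1) ∧ s'.words vBv 0 < 2 * 2 ^ l) := by
  obtain ⟨hw_v, hw_s, hw_c⟩ := hwr
  have hone : 1 % 2 ^ w = 1 := Nat.mod_eq_of_lt (by omega)
  refine Run.seq (Run.assign (Run.seq (Run.assign ?_)))
  simp only [WExp.eval, eval_var, Nat.zero_mod]
  rw [words_setWord_of_ne _ _ _ (show vHalf ≠ vBv by decide), hhalf]
  refine (Run.halving (w := w) (A := vBs) (i := 0) (l := 1) (v := 2 ^ l) (f := l + 1)
    -- `vBv` satisfies `p`, and `p` fails by `2 * v` further on, where `v` is the next step width;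
    -- after the last step, with `v = 0`, it fails at the next number.
    (fun v s₁ => (v = 0 ∨ ∃ j, v = 2 ^ j) ∧ s₁.reals = s.reals ∧
      (∀ a, ¬ tst.Writes a → a ≠ vBv → a ≠ vBs → a ≠ vBc → s₁.words a = s.words a) ∧
      p (s₁.words vBv 0) ∧ ¬ p (s₁.words vBv 0 + max (2 * v) 1) ∧
      s₁.words vBv 0 + max (2 * v) 1 ≤ 2 * 2 ^ l)
    (T + 17) (by rw [pow_succ]; have := Nat.one_le_two_pow (n := l); omega) le_rfl (by omega) hw2
    (by omega) (by simp [words_setWord]) ?_ ?_).mono ?_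
  · refine ⟨Or.inr ⟨l, rfl⟩, rfl, ?_, ?_, ?_, ?_⟩
    · intro a _ ha1 ha2 _
      rw [words_setWord_of_ne _ _ _ ha2, words_setWord_of_ne _ _ _ ha1]
    · simpa [words_setWord] using h0
    · have : max (2 * 2 ^ l) 1 = 2 * 2 ^ l := by have := Nat.one_le_two_pow (n := l); omega
      simpa [words_setWord, this] using h1
    · have := Nat.one_le_two_pow (n := l)
      simp [words_setWord]; omega
  · rintro v s₁ hv ⟨hpow, hre, hfr, hp, hnp, hle⟩ hvs
    have hmax : max (2 * v) 1 = 2 * v := by omega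
    rw [hmax] at hnp hle
    set b := s₁.words vBv 0 with hb
    have hmod : (b + v) % 2 ^ w = b + v := Nat.mod_eq_of_lt (by omega)
    have hhalfv : v / 2 = 0 ∨ ∃ j, v / 2 = 2 ^ j := by
      rcases hpow with h | ⟨j, rfl⟩
      · omega
      · rcases j with _ | j
        · left; norm_num
        · right; exact ⟨j, by rw [pow_succ]; omega⟩
    have hmax2 : max (2 * (v / 2)) 1 = v := by
      rcases hpow with h | ⟨j, rfl⟩
      · omega
      · rcases j with _ | j
        · norm_num
        · have := Nat.one_le_two_pow (n := j)
          rw [pow_succ]; omega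
    refine Run.seq (Run.assign (Run.seq ?_))
    simp only [WExp.eval, eval_var, hvs, ← hb, hmod]
    refine ((htst (s₁.setWord vBc 0 (b + v)) (b + v) hre ?_ (by simp [words_setWord]) (by omega)
      (by omega)).frame_reals hrf).mono ?_
    · intro a ha ha1 ha2 ha3
      rw [words_setWord_of_ne _ _ _ ha3, hfr a ha ha1 ha2 ha3]
    · rintro t s₂ ⟨⟨ht, hver⟩, hre₂, hfr₂⟩
      have hbv : s₂.words vBv 0 = b := by
        rw [hfr₂ _ hw_v, words_setWord_of_ne _ _ _ (by decide)]
      have hbs : s₂.words vBs 0 = v := by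
        rw [hfr₂ _ hw_s, words_setWord_of_ne _ _ _ (by decide), hvs]
      have hbc : s₂.words vBc 0 = b + v := by
        rw [hfr₂ _ hw_c]; simp [words_setWord]
      have hfr3 : ∀ a, ¬ tst.Writes a → a ≠ vBv → a ≠ vBs → a ≠ vBc →
          s₂.words a = s.words a := by
        intro a ha ha1 ha2 ha3
        rw [hfr₂ a ha, words_setWord_of_ne _ _ _ ha3, hfr a ha ha1 ha2 ha3]
      have hre3 : s₂.reals = s.reals := hre₂.trans hre
      have hbc' : (BExp.wordLe (.lit 1) (var vTv)).cost = 4 := rfl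
      refine Run.cond (fun hc => Run.assign ?_) (fun hc => Run.nop ?_)
      · simp only [BExp.Holds, WExp.eval, eval_var, hone] at hc
        have hpc := hver.1 hc
        simp only [eval_var, hbc, hbc', WExp.cost, cost_var]
        refine ⟨by omega, ?_, hhalfv, hre3, ?_, ?_, ?_, ?_⟩
        · rw [words_setWord_of_ne _ _ _ (by decide), hbs]
        · intro a ha ha1 ha2 ha3
          rw [words_setWord_of_ne _ _ _ ha2, words_setWord_of_ne _ _ _ ha1, hfr3 a ha ha1 ha2 ha3]
        · simpa [words_setWord] using hpc
        · rw [hmax2, words_setWord_of_ne _ _ _ (by decide)]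
          simp only [words_setWord, and_self, if_true]
          rwa [add_assoc, ← two_mul]
        · rw [hmax2, words_setWord_of_ne _ _ _ (by decide)]
          simp only [words_setWord, and_self, if_true]
          omega
      · simp only [BExp.Holds, WExp.eval, eval_var, hone] at hc
        have hpc := fun h => hc (hver.2 h)
        simp only [hbc', WExp.cost, cost_var]
        refine ⟨by omega, hbs, hhalfv, hre3, ?_, ?_, ?_, ?_⟩
        · intro a ha ha1 ha2 ha3
          rw [words_setWord_of_ne _ _ _ ha2, hfr3 a ha ha1 ha2 ha3]
        · rw [words_setWord_of_ne _ _ _ (by decide), hbv]; exact hp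
        · rw [hmax2, words_setWord_of_ne _ _ _ (by decide), hbv]; exact hpc
        · rw [hmax2, words_setWord_of_ne _ _ _ (by decide), hbv]; omega
  · rintro t s' ⟨ht, v, hv, hpow, hre, hfr, hp, hnp, hle⟩
    obtain rfl : v = 0 := by omega
    have hT : T + 17 + 12 ≤ T + 30 := by omega
    have := Nat.mul_le_mul_left (l + 1) hT
    simp only [mul_zero, Nat.zero_max] at hnp hle
    exact ⟨by simp only [WExp.cost, cost_var]; omega, hp, hnp, by omega⟩

/-! ### Walking along a staircase -/

notation "vNP" => 1
notation "vNQ" => 2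
notation "vNR" => 3
notation "vAns" => 10
notation "vWx" => 80
notation "vWy" => 81
notation "vGo" => 82
notation "vWg" => 83
notation "vYt" => 84
notation "vZt" => 85
notation "vMarkC" => 88
notation "vMarkP" => 89

/-- The orthant of points that are strictly above one of the points of `F` in both coordinates. -/
def Covers (F : Finset (ℕ × ℕ)) (x y : ℕ) : Prop := ∃ e ∈ F, e.1 < x ∧ e.2 < y

theorem Covers.mono {F : Finset (ℕ × ℕ)} {x y x' y' : ℕ} (h : Covers F x y) (hx : x ≤ x')
    (hy : y ≤ y') : Covers F x' y' := by
  obtain ⟨e, he, h1, h2⟩ := h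
  exact ⟨e, he, by omega, by omega⟩

/-- The points of `F` that are minimal in `F`. -/
noncomputable def minimals (F : Finset (ℕ × ℕ)) : Finset (ℕ × ℕ) :=
  open Classical in F.filter fun e => ∀ e' ∈ F, e' ≤ e → e' = e

/-- The minimal points with coordinates at least `x` and `y`. -/
noncomputable def minimalsAbove (F : Finset (ℕ × ℕ)) (x y : ℕ) : Finset (ℕ × ℕ) :=
  (minimals F).filter fun e => x ≤ e.1 ∧ y ≤ e.2

/-- The points of a set of pairs as coordinate lists. -/
def pairLists (F : Finset (ℕ × ℕ)) : Set (List ℕ) := {l | ∃ e ∈ F, l = [e.1, e.2]}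

theorem exists_below_pairLists {F : Finset (ℕ × ℕ)} {x y : ℕ} :
    (∃ e ∈ pairLists F, Below e [x, y]) ↔ Covers F x y := by
  constructor
  · rintro ⟨l, ⟨e, he, rfl⟩, hb⟩
    simp only [Below, List.forall₂_cons, List.Forall₂.nil, and_true] at hb
    exact ⟨e, he, hb⟩
  · rintro ⟨e, he, h⟩
    exact ⟨_, ⟨e, he, rfl⟩, by simpa [Below] using h⟩

/-- Each step of the staircase to the right of a free corner ends at a minimal point. -/
theorem card_minimalsAbove_lt {F : Finset (ℕ × ℕ)} {wx X Y y₀ : ℕ} (hX : ¬ Covers F X Y)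
    (hX1 : Covers F (X + 1) Y) (hy : ¬ Covers F (X + 1) y₀) (hwx : wx ≤ X) :
    (minimalsAbove F (X + 1) y₀).card < (minimalsAbove F wx y₀).card := by
  classical
  obtain ⟨e, he, he1, he2⟩ := hX1
  have heX : e.1 = X := by
    by_contra h
    exact hX ⟨e, he, by omega, he2⟩
  obtain ⟨e₀, he₀, hmin⟩ := Finset.exists_min_image (F.filter fun e => e.1 = X ∧ e.2 < Y)
    (fun e => e.2) ⟨e, by simp [he, heX, he2]⟩
  simp only [Finset.mem_filter] at he₀ hmin
  refine Finset.card_lt_card (Finset.ssubset_iff_of_subset ?_ |>.2 ⟨e₀, ?_, ?_⟩)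
  · intro e' he'
    simp only [minimalsAbove, Finset.mem_filter] at he' ⊢
    exact ⟨he'.1, by omega, he'.2.2⟩
  · simp only [minimalsAbove, minimals, Finset.mem_filter]
    refine ⟨⟨he₀.1, ?_⟩, by omega, ?_⟩
    · intro e' he' hle
      have h1 : e'.1 ≤ e₀.1 := hle.1
      have h2 : e'.2 ≤ e₀.2 := hle.2
      have h3 : e'.1 = X := by
        by_contra h
        exact hX ⟨e', he', by omega, by omega⟩
      have h4 := hmin e' ⟨he', h3, by omega⟩
      exact Prod.ext (by omega) (by omega)
    · by_contra h
      exact hy ⟨e₀, he₀.1, by omega, by omega⟩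
  · simp only [minimalsAbove, Finset.mem_filter, not_and]
    intro _ h
    omega

/-- Inserting a point removes the minimal points above it from the staircase. -/
theorem card_minimals_insert (F : Finset (ℕ × ℕ)) (x y : ℕ) :
    (minimals (insert (x, y) F)).card + (minimalsAbove F (x + 1) (y + 1)).card ≤
      (minimals F).card + 1 := by
  classical
  have hsub : minimals (insert (x, y) F) ⊆
      insert (x, y) (minimals F \ minimalsAbove F (x + 1) (y + 1)) := by
    intro e he
    simp only [minimals, Finset.mem_filter, Finset.mem_insert] at he
    rw [Finset.mem_insert]
    rcases he with ⟨rfl | heF, hmin⟩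
    · exact Or.inl rfl
    · by_cases hxy : e = (x, y)
      · exact Or.inl hxy
      right
      rw [Finset.mem_sdiff]
      refine ⟨?_, ?_⟩
      · simp only [minimals, Finset.mem_filter]
        exact ⟨heF, fun e' h => hmin e' (Or.inr h)⟩
      intro hab
      simp only [minimalsAbove, Finset.mem_filter] at hab
      exact hxy (hmin (x, y) (Or.inl rfl) ⟨by simp only; omega, by simp only; omega⟩).symm
  have h1 := (Finset.card_le_card hsub).trans (Finset.card_insert_le _ _)
  have hsub2 : minimalsAbove F (x + 1) (y + 1) ⊆ minimals F := Finset.filter_subset _ _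
  have h2 := Finset.card_sdiff_of_subset hsub2
  have h3 := Finset.card_le_card hsub2
  omega

/-- Test whether the point with the coordinates `e₁`, `e₂` is free of the points in table `T`, with
`vBc` not beyond the range of coordinates. -/
def freeTest (T : ℕ) (e₁ e₂ : WExp) : Cmd :=
  .cond (.wordLe (var vBc) (var vNQ))
    (.seq (qryTab T (var vMarkP) [e₁, e₂]) (assign vTv (.sub (.lit 1) (var vFd))))
    (assign vTv (.lit 0))

theorem writes_freeTest {T a : ℕ} {e₁ e₂ : WExp} (h : (freeTest T e₁ e₂).Writes a) :
    (60 ≤ a ∧ a ≤ 64) ∨ a = vTv := by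
  simp only [freeTest, Cmd.Writes, writes_assign] at h
  rcases h with (h | h) | h
  · exact Or.inl (writes_qryTab h)
  · exact Or.inr h
  · exact Or.inr h

theorem realFree_freeTest (T : ℕ) (e₁ e₂ : WExp) : (freeTest T e₁ e₂).RealFree :=
  ⟨⟨⟨realFree_setCx _ _, trivial, trivial, trivial, realFree_qryTree _ _ _⟩, trivial⟩, trivial⟩

theorem run_freeTest {w L g nQ T x y c : ℕ} {s : Store} {e₁ e₂ : WExp} {F : Finset (ℕ × ℕ)}
    (hroom : Roomy w L) (hleaf : s.words vLeaf 0 = 2 ^ L) (hmul : s.words vMul 0 = 2 * 2 ^ L)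
    (hT : 1000 ≤ T) (htab : Tab s T L 2 g (pairLists F)) (hmark : s.words vMarkP 0 = g)
    (hnQ : s.words vNQ 0 = nQ) (hc : s.words vBc 0 = c)
    (he₁ : EvalsTo w s e₁ x) (he₂ : EvalsTo w s e₂ y) (hx : x < 2 ^ L) (hy : y < 2 ^ L)
    (h1 : e₁.cost ≤ 2) (h2 : e₂.cost ≤ 2) :
    Run w (freeTest T e₁ e₂) s (fun t s' => t ≤ tabTime L 2 10 + 20 ∧
      (1 ≤ s'.words vTv 0 ↔ c ≤ nQ ∧ ¬ Covers F x y)) := by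
  have hbc : (BExp.wordLe (var vBc) (var vNQ)).cost = 5 := rfl
  refine Run.cond (fun hb => Run.seq ?_) (fun hb => Run.assign ?_)
  · simp only [BExp.Holds, eval_var, hc, hnQ] at hb
    refine (run_qryTab (vs := [x, y]) hroom hleaf hmul htab (.cons he₁ (.cons he₂ .nil))
      (fun s' h => by rw [eval_var, h _ (by omega), hmark]) rfl (by omega) (by simp [hx, hy])
      hT).mono ?_
    rintro t s' ⟨ht, hfd, hfd1⟩
    refine Run.assign ⟨?_, ?_⟩
    · simp only [List.map_cons, List.map_nil, List.sum_cons, List.sum_nil, cost_var] at ht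
      simp only [hbc, WExp.cost, cost_var]
      have : tabTime L 2 (e₁.cost + 2 + (e₂.cost + 2 + 0) + 2) ≤ tabTime L 2 10 := by
        simp only [tabTime]; omega
      omega
    · rw [exists_below_pairLists] at hfd
      simp only [words_setWord, and_self, if_true, WExp.eval, eval_var,
        hroom.lit (n := 1) (by omega), hb, true_and, ← hfd]
      omega
  · simp only [BExp.Holds, eval_var, hc, hnQ] at hb
    refine ⟨by simp only [hbc, WExp.cost]; omega, ?_⟩
    simp [words_setWord, WExp.eval, hb]

theorem writes_bsearch_freeTest {T a : ℕ} {e₁ e₂ : WExp}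
    (h : (bsearch (freeTest T e₁ e₂)).Writes a) : (60 ≤ a ∧ a ≤ 64) ∨ (70 ≤ a ∧ a ≤ 73) := by
  rw [writes_bsearch] at h
  rcases h with h | h | h | h
  · omega
  · omega
  · omega
  · have := writes_freeTest h; omega

/-- Visit the maximal free corners of the staircase of table `T₃`, from the abscissa `vWx` on and
down to the ordinate `vYt`, and clear `vAns` if table `T₂` has a point with third coordinate below
`vZt` in the quadrant of one of them. -/
def walk (T₂ T₃ : ℕ) : Cmd :=
  .seq (assign vGo (.lit 1)) (.loop (.wordLe (.lit 1) (var vGo))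
    (.seq (bsearch (freeTest T₃ (var vWx) (var vBc))) (.seq (assign vWy (var vBv))
      (.cond (.wordLe (var vYt) (var vWy))
        (.seq (bsearch (freeTest T₃ (var vBc) (var vWy))) (.seq (assign vWg (var vBv))
          (.seq (qryTab T₂ (var vMarkC)
              [.add (var vWg) (.lit 1), .add (var vWy) (.lit 1), var vZt])
            (.seq (.cond (.wordLe (.lit 1) (var vFd)) (assign vAns (.lit 0)) .nop)
              (.cond (.wordLe (var vNQ) (var vWg)) (assign vGo (.lit 0))
                (assign vWx (.add (var vWg) (.lit 1))))))))
        (assign vGo (.lit 0))))))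

theorem writes_walk {T₂ T₃ a : ℕ} (h : (walk T₂ T₃).Writes a) :
    (60 ≤ a ∧ a ≤ 64) ∨ (70 ≤ a ∧ a ≤ 73) ∨ (80 ≤ a ∧ a ≤ 83) ∨ a = vAns := by
  simp only [walk, Cmd.Writes, writes_assign] at h
  rcases h with h | h | h | (h | h | h | (h | h) | h | h) | h <;>
    first
    | exact False.elim h
    | omega
    | (have := writes_bsearch_freeTest h; omega)
    | (have := writes_qryTab h; omega)

/-- A bound for the time of one step of a walk. -/
def stepTime (l : ℕ) : ℕ :=
  2 * ((l + 1) * (tabTime (l + 1) 2 10 + 50) + 20) + tabTime (l + 1) 3 18 + 80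

/-- The invariant of a walk that began on the memory `s`: the answer is cleared only for a reason,
and for every free point before the current abscissa that the walk has to find. The credit `φ` pays
for one step per minimal point that is still ahead, and for the last two steps. -/
def WalkInv (l nQ x₀ y₀ z₀ : ℕ) (F : Finset (ℕ × ℕ)) (RS : Set (List ℕ)) (s : Store) (φ : ℕ)
    (s₁ : Store) : Prop :=
  open Classical in
  (∀ a, ¬ ((60 ≤ a ∧ a ≤ 64) ∨ (70 ≤ a ∧ a ≤ 73) ∨ (80 ≤ a ∧ a ≤ 83) ∨ a = vAns) →
    s₁.words a = s.words a) ∧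
  (s₁.words vAns 0 = 0 ∨ s₁.words vAns 0 = s.words vAns 0) ∧
  (s₁.words vAns 0 = 0 → s.words vAns 0 = 0 ∨
    ∃ r₁ r₂ r₃, [r₁, r₂, r₃] ∈ RS ∧ ¬ Covers F r₁ r₂ ∧ r₃ < z₀) ∧
  ((s₁.words vGo 0 = 0 ∧ ∀ r₁ r₂ r₃, [r₁, r₂, r₃] ∈ RS → ¬ Covers F r₁ r₂ → r₃ < z₀ → x₀ ≤ r₁ →
      y₀ ≤ r₂ → s₁.words vAns 0 = 0) ∨
    (s₁.words vGo 0 = 1 ∧ ∃ wx, s₁.words vWx 0 = wx ∧ x₀ ≤ wx ∧ wx ≤ nQ ∧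
      (∀ r₁ r₂ r₃, [r₁, r₂, r₃] ∈ RS → ¬ Covers F r₁ r₂ → r₃ < z₀ → x₀ ≤ r₁ →
        y₀ ≤ r₂ → r₁ < wx → s₁.words vAns 0 = 0) ∧
      stepTime l * ((minimalsAbove F wx y₀).card + (if Covers F wx y₀ then 1 else 2)) ≤ φ))

set_option maxHeartbeats 800000 in
/-- A walk finds every point of `T₂` that is free, beyond `(x₀, y₀)` and before `z₀`, and whatever
it finds is free and before `z₀`. Its time is proportional to the number of minimal points beyond
`(x₀, y₀)`, up to two additional steps. -/
theorem run_walk {w l g₂ g₃ nQ T₂ T₃ x₀ y₀ z₀ : ℕ} {s : Store} {F : Finset (ℕ × ℕ)}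
    {RS : Set (List ℕ)} (hroom : Roomy w (l + 1)) (hleaf : s.words vLeaf 0 = 2 ^ (l + 1))
    (hmul : s.words vMul 0 = 2 * 2 ^ (l + 1)) (hhalf : s.words vHalf 0 = 2 ^ l)
    (hT₂ : 1000 ≤ T₂) (hT₃ : 1000 ≤ T₃)
    (htab₂ : Tab s T₂ (l + 1) 3 g₂ RS) (htab₃ : Tab s T₃ (l + 1) 2 g₃ (pairLists F))
    (hmark₂ : s.words vMarkC 0 = g₂) (hmark₃ : s.words vMarkP 0 = g₃)
    (hnQ : s.words vNQ 0 = nQ) (hsize : nQ + 2 ≤ 2 ^ (l + 1))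
    (hx₀ : s.words vWx 0 = x₀) (hy₀ : s.words vYt 0 = y₀) (hz₀ : s.words vZt 0 = z₀)
    (hx₀' : x₀ ≤ nQ) (hy₀' : y₀ ≤ nQ) (hz₀' : z₀ < 2 ^ (l + 1))
    (hRS : ∀ r₁ r₂ r₃, [r₁, r₂, r₃] ∈ RS → r₁ ≤ nQ ∧ r₂ ≤ nQ) :
    Run w (walk T₂ T₃) s (fun t s' =>
      t ≤ stepTime l * ((minimalsAbove F x₀ y₀).card + 2) + 10 ∧
      (s'.words vAns 0 = 0 ∨ s'.words vAns 0 = s.words vAns 0) ∧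
      (s'.words vAns 0 = 0 → s.words vAns 0 = 0 ∨
        ∃ r₁ r₂ r₃, [r₁, r₂, r₃] ∈ RS ∧ ¬ Covers F r₁ r₂ ∧ r₃ < z₀) ∧
      (∀ r₁ r₂ r₃, [r₁, r₂, r₃] ∈ RS → ¬ Covers F r₁ r₂ → r₃ < z₀ → x₀ ≤ r₁ → y₀ ≤ r₂ →
        s'.words vAns 0 = 0)) := by
  classical
  have hone := hroom.lit (n := 1) (by omega)
  have hzero := hroom.lit (n := 0) (by omega)
  have h1024 := hroom.const
  have hpw : 2 * 2 ^ l = 2 ^ (l + 1) := by ring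
  have hleafw := hroom.leaf
  have hsize' := hsize
  refine Run.seq (Run.assign ?_)
  simp only [WExp.eval, hone]
  have hgc : (BExp.wordLe (.lit 1) (var vGo)).cost = 4 := rfl
  refine (Run.loop (s := s.setWord vGo 0 1)
    (WalkInv l nQ x₀ y₀ z₀ F RS s)
    ?_ (φ := stepTime l * ((minimalsAbove F x₀ y₀).card + 2)) ?_).mono ?_
  · rintro φ s₁ ⟨fr, hans, hsound, hgo⟩ hb
    simp only [BExp.Holds, WExp.eval, eval_var, hone] at hb
    obtain ⟨hgo1, wx, hwx, hx₀wx, hwxn, hcomp, hφ⟩ :=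
      hgo.resolve_left (fun h => by omega)
    -- The ordinate of the corner above `wx`.
    refine Run.seq ((run_bsearch (w := w) (s := s₁) (l := l) (T := tabTime (l + 1) 2 10 + 20)
      (fun c => c ≤ nQ ∧ ¬ Covers F wx c) (by omega) (by omega)
      (by rw [fr _ (by omega), hhalf]) (realFree_freeTest _ _ _)
      ⟨fun h => by have := writes_freeTest h; omega, fun h => by have := writes_freeTest h; omega,
        fun h => by have := writes_freeTest h; omega⟩
      ⟨by omega, by rintro ⟨e, _, _, h⟩; omega⟩ (by omega) ?_).frame.mono ?_)
    · intro s₂ c _ hfr₂ hc h1c hc2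
      have fr2 : ∀ a, ¬ ((60 ≤ a ∧ a ≤ 64) ∨ (70 ≤ a ∧ a ≤ 73)) → s₂.words a = s₁.words a :=
        fun a ha => hfr₂ a (fun h => by have := writes_freeTest h; omega) (by omega) (by omega)
          (by omega)
      exact run_freeTest (g := g₃) hroom (by rw [fr2 _ (by omega), fr _ (by omega), hleaf])
        (by rw [fr2 _ (by omega), fr _ (by omega), hmul]) hT₃
        (htab₃.congr (by rw [fr2 _ (by omega), fr _ (by omega)]))
        (by rw [fr2 _ (by omega), fr _ (by omega), hmark₃])
        (by rw [fr2 _ (by omega), fr _ (by omega), hnQ]) hc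
        (fun s' h => by rw [eval_var, h _ (by omega), fr2 _ (by omega), hwx])
        (fun s' h => by rw [eval_var, h _ (by omega), hc]) (by omega) (by omega) le_rfl le_rfl
    rintro t₁ s₂ ⟨⟨ht₁, hp, hnp, -⟩, hfr₂⟩
    have fr2 : ∀ a, ¬ ((60 ≤ a ∧ a ≤ 64) ∨ (70 ≤ a ∧ a ≤ 73)) → s₂.words a = s₁.words a :=
      fun a ha => hfr₂ a (fun h => ha (writes_bsearch_freeTest h))
    set Y := s₂.words vBv 0 with hY
    refine Run.seq (Run.assign ?_)
    simp only [eval_var, ← hY]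
    have hbc : (BExp.wordLe (var vYt) (var vWy)).cost = 5 := rfl
    -- `Y` is the last free ordinate above `wx`; the walk goes on as long as this is at least `y₀`.
    have hYy : y₀ ≤ Y ↔ ¬ Covers F wx y₀ := by
      constructor
      · exact fun h hc => hp.2 (hc.mono le_rfl h)
      · intro h
        by_contra hlt
        refine hnp ⟨by omega, fun hc => h (hc.mono le_rfl (by omega))⟩
    refine Run.cond (fun hb2 => ?_) (fun hb2 => Run.assign ?_)
    · simp only [BExp.Holds, eval_var] at hb2
      rw [words_setWord_of_ne _ _ _ (by decide), fr2 _ (by omega), fr _ (by omega), hy₀] at hb2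
      simp only [words_setWord, and_self, if_true] at hb2
      have hfree := hYy.1 hb2
      rw [if_neg hfree] at hφ
      set s₃ := s₂.setWord vWy 0 Y with hs₃
      have fr3 : ∀ a, ¬ ((60 ≤ a ∧ a ≤ 64) ∨ (70 ≤ a ∧ a ≤ 73) ∨ a = vWy) →
          s₃.words a = s₁.words a := fun a ha => by
        rw [hs₃, words_setWord_of_ne _ _ _ (by omega), fr2 a (by omega)]
      have hwy3 : s₃.words vWy 0 = Y := by simp [hs₃, words_setWord]
      -- The abscissa of this corner.
      refine Run.seq ((run_bsearch (w := w) (s := s₃) (l := l) (T := tabTime (l + 1) 2 10 + 20)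
        (fun c => c ≤ nQ ∧ ¬ Covers F c Y) (by omega) (by omega)
        (by rw [fr3 _ (by omega), fr _ (by omega), hhalf]) (realFree_freeTest _ _ _)
        ⟨fun h => by have := writes_freeTest h; omega, fun h => by have := writes_freeTest h; omega,
          fun h => by have := writes_freeTest h; omega⟩
        ⟨by omega, by rintro ⟨e, _, h, _⟩; omega⟩ (by omega) ?_).frame.mono ?_)
      · intro s₄ c _ hfr₄ hc h1c hc2
        have fr4 : ∀ a, ¬ ((60 ≤ a ∧ a ≤ 64) ∨ (70 ≤ a ∧ a ≤ 73)) → s₄.words a = s₃.words a :=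
          fun a ha => hfr₄ a (fun h => by have := writes_freeTest h; omega) (by omega) (by omega)
            (by omega)
        exact run_freeTest (g := g₃) hroom
          (by rw [fr4 _ (by omega), fr3 _ (by omega), fr _ (by omega), hleaf])
          (by rw [fr4 _ (by omega), fr3 _ (by omega), fr _ (by omega), hmul]) hT₃
          (htab₃.congr (by rw [fr4 _ (by omega), fr3 _ (by omega), fr _ (by omega)]))
          (by rw [fr4 _ (by omega), fr3 _ (by omega), fr _ (by omega), hmark₃])
          (by rw [fr4 _ (by omega), fr3 _ (by omega), fr _ (by omega), hnQ]) hc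
          (fun s' h => by rw [eval_var, h _ (by omega), hc])
          (fun s' h => by rw [eval_var, h _ (by omega), fr4 _ (by omega), hwy3])
          (by omega) (by omega) le_rfl le_rfl
      rintro t₂ s₄ ⟨⟨ht₂, hpX, hnpX, -⟩, hfr₄⟩
      have fr4 : ∀ a, ¬ ((60 ≤ a ∧ a ≤ 64) ∨ (70 ≤ a ∧ a ≤ 73)) → s₄.words a = s₃.words a :=
        fun a ha => hfr₄ a (fun h => ha (writes_bsearch_freeTest h))
      set X := s₄.words vBv 0 with hX
      have hwX : wx ≤ X := by
        by_contra hlt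
        exact hnpX ⟨by omega, fun hc => hp.2 (hc.mono (by omega) le_rfl)⟩
      refine Run.seq (Run.assign (Run.seq ?_))
      simp only [eval_var, ← hX]
      set s₅ := s₄.setWord vWg 0 X with hs₅
      have fr5 : ∀ a, ¬ ((60 ≤ a ∧ a ≤ 64) ∨ (70 ≤ a ∧ a ≤ 73) ∨ a = vWy ∨ a = vWg) →
          s₅.words a = s₁.words a := fun a ha => by
        rw [hs₅, words_setWord_of_ne _ _ _ (by omega), fr4 a (by omega), fr3 a (by omega)]
      have hwg5 : s₅.words vWg 0 = X := by simp [hs₅, words_setWord]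
      have hwy5 : s₅.words vWy 0 = Y := by
        rw [hs₅, words_setWord_of_ne _ _ _ (by decide), fr4 _ (by omega), hwy3]
      have hX1 : (X + 1) % 2 ^ w = X + 1 := Nat.mod_eq_of_lt (by omega)
      have hY1 : (Y + 1) % 2 ^ w = Y + 1 := Nat.mod_eq_of_lt (by omega)
      refine (run_qryTab (g := g₂) (vs := [X + 1, Y + 1, z₀]) hroom
        (by rw [fr5 _ (by omega), fr _ (by omega), hleaf])
        (by rw [fr5 _ (by omega), fr _ (by omega), hmul])
        (htab₂.congr (by rw [fr5 _ (by omega), fr _ (by omega)]))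
        (.cons (fun s' h => by simp [WExp.eval, h vWg (by omega), hwg5, hone, hX1])
          (.cons (fun s' h => by simp [WExp.eval, h vWy (by omega), hwy5, hone, hY1])
            (.cons (fun s' h => by
              rw [eval_var, h _ (by omega), fr5 _ (by omega), fr _ (by omega), hz₀]) .nil)))
        (fun s' h => by rw [eval_var, h _ (by omega), fr5 _ (by omega), fr _ (by omega), hmark₂])
        rfl (by omega) (by simp; omega) hT₂).frame.mono ?_
      rintro t₃ s₆ ⟨⟨ht₃, hfd, hfd1⟩, hfr₆⟩
      have fr6 : ∀ a, ¬ (60 ≤ a ∧ a ≤ 64) → s₆.words a = s₅.words a :=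
        fun a ha => hfr₆ a (fun h => ha (writes_qryTab h))
      have hcost3 : (List.map (fun e : WExp => e.cost + 2)
        [.add (var vWg) (.lit 1), .add (var vWy) (.lit 1), var vZt]).sum +
          (var vMarkC).cost = 18 := rfl
      rw [hcost3] at ht₃
      -- The outcome of the query for this corner.
      have hhit : s₆.words vFd 0 = 1 ↔
          ∃ r₁ r₂ r₃, [r₁, r₂, r₃] ∈ RS ∧ r₁ < X + 1 ∧ r₂ < Y + 1 ∧ r₃ < z₀ := by
        rw [hfd]
        constructor
        · rintro ⟨e, he, hb⟩
          have hlen := (htab₂.dim e he).1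
          match e, hlen with
          | [a, b, c], _ =>
            simp only [Below, List.forall₂_cons, List.Forall₂.nil, and_true] at hb
            exact ⟨a, b, c, he, hb⟩
        · rintro ⟨a, b, c, he, hb⟩
          exact ⟨_, he, by simpa [Below] using hb⟩
      have hsnd : s₆.words vFd 0 = 1 →
          ∃ r₁ r₂ r₃, [r₁, r₂, r₃] ∈ RS ∧ ¬ Covers F r₁ r₂ ∧ r₃ < z₀ := by
        rw [hhit]
        rintro ⟨a, b, c, he, h1, h2, h3⟩
        exact ⟨a, b, c, he, fun hc => hpX.2 (hc.mono (by omega) (by omega)), h3⟩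
      have hans6 : s₆.words vAns = s₁.words vAns := by rw [fr6 _ (by omega), fr5 _ (by omega)]
      -- The end of the step is the same whether or not the query has succeeded; `u` is the time
      -- that is spent on clearing the answer.
      have key : ∀ s₇ : Store, (∀ a, a ≠ vAns → s₇.words a = s₆.words a) →
          (s₇.words vAns 0 = if s₆.words vFd 0 = 1 then 0 else s₁.words vAns 0) → ∀ u : ℕ, u ≤ 10 →
          Run w (.cond (.wordLe (var vNQ) (var vWg)) (assign vGo (.lit 0))
                (assign vWx (.add (var vWg) (.lit 1)))) s₇ (fun t₅ s' => ∃ φ',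
            (BExp.wordLe (.lit 1) (var vGo)).cost + (t₁ + ((var vBv).cost + 2 +
              ((BExp.wordLe (var vYt) (var vWy)).cost + (t₂ + ((var vBv).cost + 2 + (t₃ +
                (u + t₅)))) + 1))) + 1 + φ' ≤ φ ∧
            WalkInv l nQ x₀ y₀ z₀ F RS s φ' s') := by
        intro s₇ hfr7 hans7 u hu
        have hans7' : s₇.words vAns 0 = 0 ∨ s₇.words vAns 0 = s.words vAns 0 := by
          rw [hans7]
          split_ifs
          · exact Or.inl rfl
          · exact hans
        have hsound7 : s₇.words vAns 0 = 0 → s.words vAns 0 = 0 ∨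
              ∃ r₁ r₂ r₃, [r₁, r₂, r₃] ∈ RS ∧ ¬ Covers F r₁ r₂ ∧ r₃ < z₀ := by
          rw [hans7]
          split_ifs with h
          · exact fun _ => Or.inr (hsnd h)
          · exact hsound
        have hcomp7 : ∀ r₁ r₂ r₃, [r₁, r₂, r₃] ∈ RS → ¬ Covers F r₁ r₂ → r₃ < z₀ → x₀ ≤ r₁ →
            y₀ ≤ r₂ → r₁ < X + 1 → s₇.words vAns 0 = 0 := by
          intro r₁ r₂ r₃ hr hfr hz hx hy hlt
          rw [hans7]
          split_ifs with h
          · rfl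
          · by_cases hr1 : r₁ < wx
            · exact hcomp r₁ r₂ r₃ hr hfr hz hx hy hr1
            · refine absurd (hhit.2 ⟨r₁, r₂, r₃, hr, hlt, ?_, hz⟩) h
              by_contra hr2
              have hrs := hRS _ _ _ hr
              exact hnp ⟨by omega, fun hc => hfr (hc.mono (by omega) (by omega))⟩
        have fr7 : ∀ a, ¬ ((60 ≤ a ∧ a ≤ 64) ∨ (70 ≤ a ∧ a ≤ 73) ∨ (80 ≤ a ∧ a ≤ 83) ∨ a = vAns) →
            s₇.words a = s.words a := by
          intro a ha
          rw [hfr7 a (by omega), fr6 a (by omega), fr5 a (by omega), fr a ha]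
        have hwg7 : s₇.words vWg 0 = X := by
          rw [hfr7 _ (by decide), fr6 _ (by omega), hwg5]
        have hgo7 : s₇.words vGo 0 = 1 := by
          rw [hfr7 _ (by decide), fr6 _ (by omega), fr5 _ (by omega), hgo1]
        have hbc2 : (BExp.wordLe (var vNQ) (var vWg)).cost = 5 := rfl
        have hstep : stepTime l = 2 * ((l + 1) * (tabTime (l + 1) 2 10 + 20 + 30) + 20) +
          tabTime (l + 1) 3 18 + 80 := rfl
        refine Run.cond (fun hb3 => Run.assign ?_) (fun hb3 => Run.assign ?_)
        -- The corner is at the end of the range, so that everything has been seen.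
        · refine ⟨φ - stepTime l, ?_, ?_, ?_, ?_, Or.inl ⟨?_, ?_⟩⟩
          · have : stepTime l ≤ φ := le_trans (Nat.le_mul_of_pos_right _ (by omega)) hφ
            simp only [hgc, hbc, hbc2, WExp.cost, cost_var]
            omega
          · intro a ha
            rw [words_setWord_of_ne _ _ _ (by omega), fr7 a ha]
          · rwa [words_setWord_of_ne _ _ _ (by decide)]
          · rwa [words_setWord_of_ne _ _ _ (by decide)]
          · simp [words_setWord, WExp.eval]
          · intro r₁ r₂ r₃ hr hfr hz hx hy
            rw [words_setWord_of_ne _ _ _ (by decide)]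
            simp only [BExp.Holds, eval_var, hwg7, fr7 vNQ (by omega), hnQ] at hb3
            have hrs := hRS _ _ _ hr
            exact hcomp7 r₁ r₂ r₃ hr hfr hz hx hy (by omega)
        · simp only [BExp.Holds, eval_var, hwg7, fr7 vNQ (by omega), hnQ] at hb3
          -- The walk continues to the right of the corner. It has used up a minimal point, unless
          -- the next step is the last one.
          have hX1c : Covers F (X + 1) Y := by
            by_contra h
            exact hnpX ⟨by omega, h⟩
          refine ⟨φ - stepTime l, ?_, ?_, ?_, ?_,
            Or.inr ⟨?_, X + 1, ?_, by omega, by omega, ?_, ?_⟩⟩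
          · have : stepTime l ≤ φ := le_trans (Nat.le_mul_of_pos_right _ (by omega)) hφ
            simp only [hgc, hbc, hbc2, WExp.cost, cost_var]
            omega
          · intro a ha
            rw [words_setWord_of_ne _ _ _ (by omega), fr7 a ha]
          · rwa [words_setWord_of_ne _ _ _ (by decide)]
          · rwa [words_setWord_of_ne _ _ _ (by decide)]
          · rwa [words_setWord_of_ne _ _ _ (by decide)]
          · simp [words_setWord, WExp.eval, hwg7, hone, hX1]
          · intro r₁ r₂ r₃ hr hfr hz hx hy hlt
            rw [words_setWord_of_ne _ _ _ (by decide)]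
            exact hcomp7 r₁ r₂ r₃ hr hfr hz hx hy hlt
          · refine Nat.le_sub_of_add_le (le_trans ?_ hφ)
            have hcard : (minimalsAbove F (X + 1) y₀).card +
                (if Covers F (X + 1) y₀ then 1 else 2) + 1 ≤
                (minimalsAbove F wx y₀).card + 2 := by
              split_ifs with h
              · have : minimalsAbove F (X + 1) y₀ ⊆ minimalsAbove F wx y₀ := by
                  intro e he
                  simp only [minimalsAbove, Finset.mem_filter] at he ⊢
                  exact ⟨he.1, by omega, he.2.2⟩
                have := Finset.card_le_card this
                omega
              · have := card_minimalsAbove_lt hpX.2 hX1c h hwX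
                omega
            have := Nat.mul_le_mul_left (stepTime l) hcard
            rw [Nat.mul_add _ _ 1, mul_one] at this
            exact this
      have hbc3 : (BExp.wordLe (.lit 1) (var vFd)).cost = 4 := rfl
      refine Run.seq (Run.cond (fun hb3 => Run.assign ?_) (fun hb3 => Run.nop ?_))
      · simp only [BExp.Holds, WExp.eval, eval_var, hone] at hb3
        exact key _ (fun a ha => words_setWord_of_ne _ _ _ ha)
          (by rw [if_pos (by omega)]; simp [words_setWord, WExp.eval]) _
          (by rw [hbc3]; simp only [WExp.cost]; omega)
      · simp only [BExp.Holds, WExp.eval, eval_var, hone] at hb3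
        exact key _ (fun a ha => rfl) (by rw [if_neg (by omega), hans6]) _ (by rw [hbc3]; omega)
    · simp only [BExp.Holds, eval_var] at hb2
      rw [words_setWord_of_ne _ _ _ (by decide), fr2 _ (by omega), fr _ (by omega), hy₀] at hb2
      simp only [words_setWord, and_self, if_true] at hb2
      have hfr3 : ∀ a, ¬ ((60 ≤ a ∧ a ≤ 64) ∨ (70 ≤ a ∧ a ≤ 73) ∨ (80 ≤ a ∧ a ≤ 83) ∨ a = vAns) →
          ((s₂.setWord vWy 0 Y).setWord vGo 0 (WExp.eval w (s₂.setWord vWy 0 Y) (.lit 0))).words a =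
            s.words a := fun a ha => by
        rw [words_setWord_of_ne _ _ _ (by omega), words_setWord_of_ne _ _ _ (by omega),
          fr2 a (by omega), fr a ha]
      have hans3 : ((s₂.setWord vWy 0 Y).setWord vGo 0
          (WExp.eval w (s₂.setWord vWy 0 Y) (.lit 0))).words vAns = s₁.words vAns := by
        rw [words_setWord_of_ne _ _ _ (by decide), words_setWord_of_ne _ _ _ (by decide),
          fr2 _ (by omega)]
      have hstep : stepTime l = 2 * ((l + 1) * (tabTime (l + 1) 2 10 + 20 + 30) + 20) +
        tabTime (l + 1) 3 18 + 80 := rfl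
      -- Everything from `wx` on and from `y₀` on is covered, so that the walk ends.
      refine ⟨φ - stepTime l, ?_, hfr3, ?_, ?_, Or.inl ⟨?_, ?_⟩⟩
      · have h1 : 1 ≤ (minimalsAbove F wx y₀).card + (if Covers F wx y₀ then 1 else 2) := by
          split_ifs <;> omega
        have : stepTime l ≤ φ := le_trans (Nat.le_mul_of_pos_right _ h1) hφ
        simp only [hgc, hbc, WExp.cost, cost_var]
        omega
      · rwa [hans3]
      · rwa [hans3]
      · simp [words_setWord, WExp.eval]
      · intro r₁ r₂ r₃ hr hfr hz hx hy
        rw [hans3]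
        by_cases hr1 : r₁ < wx
        · exact hcomp r₁ r₂ r₃ hr hfr hz hx hy hr1
        · have hrs := hRS _ _ _ hr
          by_contra
          exact hb2 (hYy.2 fun hc => hfr (hc.mono (by omega) hy))
  · refine ⟨fun a ha => words_setWord_of_ne _ _ _ (by omega), ?_, ?_, Or.inr ⟨?_, x₀, ?_, le_rfl,
      hx₀', ?_, ?_⟩⟩
    · right; rw [words_setWord_of_ne _ _ _ (by decide)]
    · rw [words_setWord_of_ne _ _ _ (by decide)]; exact Or.inl
    · simp [words_setWord]
    · rw [words_setWord_of_ne _ _ _ (by decide), hx₀]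
    · intro r₁ r₂ r₃ _ _ _ h _ h'; omega
    · refine Nat.mul_le_mul_left _ ?_
      split_ifs <;> omega
  · rintro t s' ⟨φ', ht, ⟨-, hans, hsound, hgo⟩, hb⟩
    simp only [BExp.Holds, WExp.eval, eval_var, hone] at hb
    obtain ⟨-, hcomp⟩ := hgo.resolve_right (fun h => by omega)
    refine ⟨?_, hans, hsound, hcomp⟩
    rw [hgc] at ht
    simp only [WExp.cost]
    omega

/-! ### Processing one element of the first set -/

notation "vBase" => 5
notation "vWid" => 6
notation "aPos" => 20
notation "aOrd" => 30
notation "vP" => 90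
notation "vIx" => 91
notation "vQ" => 92
notation "aLst" => 102
notation "vLen" => 103

/-- An instance after ranking. In each of the six coordinates `j`, `pos j q` is the position of
`q` among the elements of `Q`, `ord j` is the inverse of `pos j`, and `p` dominates `q` if
`pos j q < cP j p`; similarly for `r` and `cR`. The numbers `b` and `B` are the number of slabs and
their width. -/
structure Inst where
  nP : ℕ
  nQ : ℕ
  nR : ℕ
  b : ℕ
  B : ℕ
  pos : ℕ → ℕ → ℕ
  ord : ℕ → ℕ → ℕ
  cP : ℕ → ℕ → ℕ
  cR : ℕ → ℕ → ℕ

/-- The properties of an instance that the search relies on. -/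
structure Inst.Valid (D : Inst) (l : ℕ) : Prop where
  size : D.nQ + 2 ≤ 2 ^ (l + 1)
  pos_lt : ∀ j < 6, ∀ q < D.nQ, D.pos j q < D.nQ
  ord_lt : ∀ j < 6, ∀ k < D.nQ, D.ord j k < D.nQ
  pos_ord : ∀ j < 6, ∀ k < D.nQ, D.pos j (D.ord j k) = k
  ord_pos : ∀ j < 6, ∀ q < D.nQ, D.ord j (D.pos j q) = q
  cP_le : ∀ j < 6, ∀ p < D.nP, D.cP j p ≤ D.nQ
  cR_le : ∀ j < 6, ∀ r < D.nR, D.cR j r ≤ D.nQ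
  width : 1 ≤ D.B
  slab : D.nQ < D.b * D.B

/-- The instance `D` is in the memory; the two outer sets are described by the variables `vp`,
`vr` and the arrays from `α` and from `β` on. -/
structure Env (w l : ℕ) (D : Inst) (vp vr α β : ℕ) (s : Store) : Prop where
  nP : s.words vp 0 = D.nP
  nQ : s.words vNQ 0 = D.nQ
  nR : s.words vr 0 = D.nR
  b : s.words vBase 0 = D.b
  B : s.words vWid 0 = D.B
  leaf : s.words vLeaf 0 = 2 ^ (l + 1)
  mul : s.words vMul 0 = 2 * 2 ^ (l + 1)
  half : s.words vHalf 0 = 2 ^ l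
  pos : ∀ j < 6, ∀ q < D.nQ, s.words (aPos + j) q = D.pos j q
  ord : ∀ j < 6, ∀ k < D.nQ, s.words (aOrd + j) k = D.ord j k
  cP : ∀ j < 6, ∀ p < D.nP, s.words (α + j) p = D.cP j p
  cR : ∀ j < 6, ∀ r < D.nR, s.words (β + j) r = D.cR j r

/-- The variables and arrays for the two outer sets lie in the range reserved for input data. -/
structure Slots (vp vr α β : ℕ) : Prop where
  vp : vp < 10
  vr : vr < 10
  α : 40 ≤ α ∧ α ≤ 50
  β : 40 ≤ β ∧ β ≤ 50

theorem Env.congr {w l : ℕ} {D : Inst} {vp vr α β : ℕ} {s s' : Store} (h : Env w l D vp vr α β s)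
    (hsl : Slots vp vr α β) (he : ∀ a, a < 60 → a ≠ vAns → s'.words a = s.words a) :
    Env w l D vp vr α β s' := by
  obtain ⟨h1, h2, h3, h4⟩ := hsl
  refine ⟨?_, ?_, ?_, ?_, ?_, ?_, ?_, ?_, ?_, ?_, ?_, ?_⟩
  · rw [he _ (by omega) (by omega)]; exact h.nP
  · rw [he _ (by omega) (by omega)]; exact h.nQ
  · rw [he _ (by omega) (by omega)]; exact h.nR
  · rw [he _ (by omega) (by omega)]; exact h.b
  · rw [he _ (by omega) (by omega)]; exact h.B
  · rw [he _ (by omega) (by omega)]; exact h.leaf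
  · rw [he _ (by omega) (by omega)]; exact h.mul
  · rw [he _ (by omega) (by omega)]; exact h.half
  · intro j hj q hq; rw [he _ (by omega) (by omega)]; exact h.pos j hj q hq
  · intro j hj q hq; rw [he _ (by omega) (by omega)]; exact h.ord j hj q hq
  · intro j hj q hq; rw [he _ (by omega) (by omega)]; exact h.cP j hj q hq
  · intro j hj q hq; rw [he _ (by omega) (by omega)]; exact h.cR j hj q hq

/-- The conjunction of a list of tests. -/
def allTests : List BExp → BExp
  | [] => .wordLe (.lit 0) (.lit 0)
  | t :: ts => .and t (allTests ts)

theorem holds_allTests {w : ℕ} {s : Store} : ∀ {ts : List BExp},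
    (allTests ts).Holds w s ↔ ∀ t ∈ ts, t.Holds w s
  | [] => by simp [allTests, BExp.Holds]
  | t :: ts => by simp [allTests, BExp.Holds, holds_allTests]

theorem cost_allTests : ∀ ts : List BExp,
    (allTests ts).cost = (ts.map fun t => t.cost + 1).sum + 3
  | [] => rfl
  | t :: ts => by simp [allTests, BExp.cost, cost_allTests ts]; omega

/-- The test that the current `p` dominates the current `q` in the coordinates `as`. -/
def domTest (α : ℕ) (as : List ℕ) : BExp :=
  allTests (as.map fun j => .not (.wordLe (.get (α + j) (var vP)) (.get (aPos + j) (var vQ))))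

theorem cost_domTest (α : ℕ) (as : List ℕ) : (domTest α as).cost = 9 * as.length + 3 := by
  simp [domTest, cost_allTests, BExp.cost, WExp.cost, Function.comp_def, mul_comm]

/-- The coordinate `j` of the current `q`. -/
def posQ (j : ℕ) : WExp := .get (aPos + j) (var vQ)

/-- Search for a point of table `T₂` that is not dominated in a way that excludes it by a listed
`q` below the current `p`: the listed elements come in the order of the coordinate `b₃`, and the
table `T₃` holds the coordinates `b₁`, `b₂` of those that have been seen. -/
def sweep (α : ℕ) (as : List ℕ) (b₁ b₂ b₃ T₂ T₃ : ℕ) : Cmd :=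
  .seq (forUp vIx (var vLen) (.seq (assign vQ (.get aLst (var vIx)))
    (.cond (domTest α as)
      (.seq (assign vWx (.add (posQ b₁) (.lit 1))) (.seq (assign vYt (.add (posQ b₂) (.lit 1)))
        (.seq (assign vZt (.add (posQ b₃) (.lit 1))) (.seq (walk T₂ T₃)
          (insTab T₃ (var vMarkP) [posQ b₁, posQ b₂])))))
      .nop)))
    (.seq (assign vWx (.lit 0)) (.seq (assign vYt (.lit 0))
      (.seq (assign vZt (.add (var vNQ) (.lit 1))) (walk T₂ T₃))))

theorem writes_sweepStep {α : ℕ} {as : List ℕ} {b₁ b₂ b₃ T₂ T₃ a : ℕ}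
    (h : (Cmd.seq (assign vQ (.get aLst (var vIx)))
    (.cond (domTest α as)
      (.seq (assign vWx (.add (posQ b₁) (.lit 1))) (.seq (assign vYt (.add (posQ b₂) (.lit 1)))
        (.seq (assign vZt (.add (posQ b₃) (.lit 1))) (.seq (walk T₂ T₃)
          (insTab T₃ (var vMarkP) [posQ b₁, posQ b₂])))))
      .nop)).Writes a) :
    (60 ≤ a ∧ a ≤ 64) ∨ (70 ≤ a ∧ a ≤ 73) ∨ (80 ≤ a ∧ a ≤ 85) ∨ a = vAns ∨ a = vQ ∨ a = T₃ := by
  simp only [Cmd.Writes, writes_assign] at h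
  rcases h with h | (h | h | h | h | h) | h
  · omega
  · omega
  · omega
  · omega
  · have := writes_walk h; omega
  · have := writes_insTab h; omega
  · exact h.elim

theorem writes_sweep {α : ℕ} {as : List ℕ} {b₁ b₂ b₃ T₂ T₃ a : ℕ}
    (h : (sweep α as b₁ b₂ b₃ T₂ T₃).Writes a) :
    (60 ≤ a ∧ a ≤ 64) ∨ (70 ≤ a ∧ a ≤ 73) ∨ (80 ≤ a ∧ a ≤ 85) ∨ a = vAns ∨ a = vIx ∨ a = vQ ∨
      a = T₃ := by
  rw [sweep] at h
  rcases h with h | h | h | h | h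
  · rw [writes_forUp] at h
    rcases h with h | h
    · omega
    · have := writes_sweepStep h; omega
  · rw [writes_assign] at h; omega
  · rw [writes_assign] at h; omega
  · rw [writes_assign] at h; omega
  · have := writes_walk h; omega

/-- The first `k` listed elements that are below `p` in the coordinates `as`, as points in the
coordinates `b₁` and `b₂`. -/
noncomputable def Inst.seen (D : Inst) (as : List ℕ) (b₁ b₂ p : ℕ) (lst : ℕ → ℕ) (k : ℕ) :
    Finset (ℕ × ℕ) :=
  open Classical in
  ((Finset.range k).filter fun i => ∀ j ∈ as, D.pos j (lst i) < D.cP j p).image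
    fun i => (D.pos b₁ (lst i), D.pos b₂ (lst i))

theorem Inst.mem_seen {D : Inst} {as : List ℕ} {b₁ b₂ p : ℕ} {lst : ℕ → ℕ} {k : ℕ} {e : ℕ × ℕ} :
    e ∈ D.seen as b₁ b₂ p lst k ↔ ∃ i < k, (∀ j ∈ as, D.pos j (lst i) < D.cP j p) ∧
      (D.pos b₁ (lst i), D.pos b₂ (lst i)) = e := by
  simp [Inst.seen, and_assoc]

theorem Inst.seen_succ_of_pos {D : Inst} {as : List ℕ} {b₁ b₂ p : ℕ} {lst : ℕ → ℕ} {k : ℕ}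
    (h : ∀ j ∈ as, D.pos j (lst k) < D.cP j p) :
    D.seen as b₁ b₂ p lst (k + 1) =
      insert (D.pos b₁ (lst k), D.pos b₂ (lst k)) (D.seen as b₁ b₂ p lst k) := by
  classical
  simp only [Inst.seen, Finset.range_add_one, Finset.filter_insert]
  rw [if_pos h, Finset.image_insert]

theorem Inst.seen_succ_of_neg {D : Inst} {as : List ℕ} {b₁ b₂ p : ℕ} {lst : ℕ → ℕ} {k : ℕ}
    (h : ¬ ∀ j ∈ as, D.pos j (lst k) < D.cP j p) :
    D.seen as b₁ b₂ p lst (k + 1) = D.seen as b₁ b₂ p lst k := by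
  classical
  simp only [Inst.seen, Finset.range_add_one, Finset.filter_insert]
  rw [if_neg h]

/-- No listed element that is below `p` is below the point `(r₁, r₂, r₃)`. -/
def Inst.Missed (D : Inst) (as : List ℕ) (b₁ b₂ b₃ p : ℕ) (lst : ℕ → ℕ) (m r₁ r₂ r₃ : ℕ) : Prop :=
  ∀ i < m, (∀ j ∈ as, D.pos j (lst i) < D.cP j p) →
    ¬ (D.pos b₁ (lst i) < r₁ ∧ D.pos b₂ (lst i) < r₂ ∧ D.pos b₃ (lst i) < r₃)

/-- A bound for the time of a sweep through a list of length `m`. -/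
def sweepTime (l m : ℕ) : ℕ :=
  m * (3 * stepTime l + tabTime (l + 1) 2 12 + 150) + 2 * stepTime l + 100

set_option maxHeartbeats 800000 in
/-- A sweep finds out whether some point of `T₂` is missed by all listed elements below `p`. It
takes `O(m)` steps of walks, since each step uses up a minimal point, and each listed element
creates at most one. -/
theorem run_sweep {w l vp vr α β g₂ g₃ T₂ T₃ b₁ b₂ b₃ p m : ℕ} {D : Inst} {as : List ℕ}
    {lst : ℕ → ℕ} {s : Store} {RS : Set (List ℕ)} (hroom : Roomy w (l + 1)) (hsl : Slots vp vr α β)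
    (hD : D.Valid l) (henv : Env w l D vp vr α β s) (has : ∀ j ∈ as, j < 6) (has4 : as.length = 4)
    (hb : b₁ < 6 ∧ b₂ < 6 ∧ b₃ < 6) (hT₂ : 1000 ≤ T₂) (hT₃ : 1000 ≤ T₃) (hT : T₂ ≠ T₃)
    (hp : p < D.nP) (hvp : s.words vP 0 = p) (hm : s.words vLen 0 = m) (hmw : m < 2 ^ w)
    (hlst : ∀ i < m, s.words aLst i = lst i) (hlstq : ∀ i < m, lst i < D.nQ)
    (hsort : ∀ i i', i ≤ i' → i' < m → D.pos b₃ (lst i) ≤ D.pos b₃ (lst i'))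
    (htab₂ : Tab s T₂ (l + 1) 3 g₂ RS) (hmark₂ : s.words vMarkC 0 = g₂)
    (hmark₃ : s.words vMarkP 0 = g₃) (hfresh : ∀ k, s.words T₃ k < g₃)
    (hRS : ∀ r₁ r₂ r₃, [r₁, r₂, r₃] ∈ RS → r₁ ≤ D.nQ ∧ r₂ ≤ D.nQ ∧ r₃ ≤ D.nQ) :
    Run w (sweep α as b₁ b₂ b₃ T₂ T₃) s (fun t s' => t ≤ sweepTime l m ∧
      (s'.words vAns 0 = 0 ∨ s'.words vAns 0 = s.words vAns 0) ∧
      (s'.words vAns 0 = 0 ↔ s.words vAns 0 = 0 ∨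
        ∃ r₁ r₂ r₃, [r₁, r₂, r₃] ∈ RS ∧ D.Missed as b₁ b₂ b₃ p lst m r₁ r₂ r₃) ∧
      ∀ k, s'.words T₃ k ≤ g₃) := by
  classical
  obtain ⟨hb₁, hb₂, hb₃⟩ := hb
  have hsize := hD.size
  have hleafw := hroom.leaf
  have hone := hroom.lit (n := 1) (by omega)
  have h1024 := hroom.const
  set F := D.seen as b₁ b₂ p lst with hF
  let W : ℕ → Prop := fun a => (60 ≤ a ∧ a ≤ 64) ∨ (70 ≤ a ∧ a ≤ 73) ∨ (80 ≤ a ∧ a ≤ 85) ∨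
    a = vAns ∨ a = vIx ∨ a = vQ ∨ a = T₃
  -- After `k` elements, a missed point is found already or is still free. The potential has one
  -- step of a walk in store for each minimal point.
  let Inv : ℕ → ℕ → Store → Prop := fun k φ s₁ => (∀ a, ¬ W a → s₁.words a = s.words a) ∧
    Tab s₁ T₃ (l + 1) 2 g₃ (pairLists (F k)) ∧
    (s₁.words vAns 0 = 0 ∨ s₁.words vAns 0 = s.words vAns 0) ∧
    (s₁.words vAns 0 = 0 → s.words vAns 0 = 0 ∨
        ∃ r₁ r₂ r₃, [r₁, r₂, r₃] ∈ RS ∧ D.Missed as b₁ b₂ b₃ p lst m r₁ r₂ r₃) ∧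
    (∀ r₁ r₂ r₃, [r₁, r₂, r₃] ∈ RS → D.Missed as b₁ b₂ b₃ p lst m r₁ r₂ r₃ →
      s₁.words vAns 0 = 0 ∨ ¬ Covers (F k) r₁ r₂) ∧
    φ = stepTime l * (minimals (F k)).card
  have hbc : (domTest α as).cost = 39 := by rw [cost_domTest, has4]
  have hα := hsl.α
  refine Run.seq ((Run.forUp (N := m) Inv
    (fun _ => 3 * stepTime l + tabTime (l + 1) 2 12 + 100) (φ₀ := 0) hmw ?_ ?_ ?_ ?_ ?_).mono ?_)
  · intro h
    have := writes_sweepStep h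
    omega
  · rintro k φ s₁ ⟨hfr, -⟩
    rw [eval_var, hfr _ (by simp only [W]; omega), hm]
  · rintro k φ s₁ v ⟨hfr, htab, hans, hsnd, hcmp, hφ⟩
    refine ⟨fun a ha => ?_, htab.congr (words_setWord_of_ne _ _ _ (by omega)), ?_, ?_, ?_, hφ⟩
    · rw [words_setWord_of_ne _ _ _ (by simp only [W] at ha; omega), hfr a ha]
    · rwa [words_setWord_of_ne _ _ _ (by decide)]
    · rwa [words_setWord_of_ne _ _ _ (by decide)]
    · rwa [words_setWord_of_ne _ _ _ (by decide)]
  · have hF0 : F 0 = ∅ := by simp [hF, Inst.seen]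
    refine ⟨fun _ _ => rfl, ?_, Or.inr rfl, Or.inl, fun _ _ _ _ _ => Or.inr ?_, ?_⟩
    · have : pairLists (F 0) = ∅ := by simp [hF0, pairLists]
      rw [this]
      exact Tab.empty hfresh
    · rintro ⟨e, he, -⟩
      simp [hF0] at he
    · simp [hF0, minimals]
  · rintro k φ s₁ hk ⟨hfr, htab, hans, hsnd, hcmp, hφ⟩ hik
    have hq := hlstq k hk
    set q := lst k with hqdef
    have fr : ∀ a, a < 60 → a ≠ vAns → s₁.words a = s.words a := fun a h1 h2 =>
      hfr a (by simp only [W]; omega)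
    have hlk : s₁.words aLst k = q := by rw [hfr _ (by simp only [W]; omega), hlst k hk]
    refine Run.seq (Run.assign ?_)
    simp only [WExp.eval, eval_var, hik, hlk]
    set s₂ := s₁.setWord vQ 0 q with hs₂
    have fr2 : ∀ a, ¬ W a → s₂.words a = s.words a := fun a ha => by
      rw [hs₂, words_setWord_of_ne _ _ _ (by simp only [W] at ha; omega), hfr a ha]
    have hq2 : s₂.words vQ 0 = q := by simp [hs₂, words_setWord]
    have henv2 : Env w l D vp vr α β s₂ := henv.congr hsl (fun a h1 h2 => fr2 a (by
      simp only [W]; omega))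
    have hans2 : s₂.words vAns = s₁.words vAns := words_setWord_of_ne _ _ _ (by decide)
    have hdom : (domTest α as).Holds w s₂ ↔ ∀ j ∈ as, D.pos j q < D.cP j p := by
      simp only [domTest, holds_allTests, List.mem_map, forall_exists_index, and_imp,
        forall_apply_eq_imp_iff₂, BExp.Holds, WExp.eval, eval_var, hq2, not_le]
      rw [fr2 vP (by simp only [W]; omega), hvp]
      refine forall₂_congr fun j hj => ?_
      rw [henv2.pos j (has j hj) q hq, henv2.cP j (has j hj) p hp]
    have hx := hD.pos_lt b₁ hb₁ q hq
    have hy := hD.pos_lt b₂ hb₂ q hq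
    have hz := hD.pos_lt b₃ hb₃ q hq
    refine Run.cond (fun hb => ?_) (fun hb => Run.nop ?_)
    · rw [hdom] at hb
      have hFs : F (k + 1) = insert (D.pos b₁ q, D.pos b₂ q) (F k) := Inst.seen_succ_of_pos hb
      have hposq : ∀ s₃ : Store, (∀ a, a < 60 → a ≠ vAns → s₃.words a = s₂.words a) →
          s₃.words vQ 0 = q → ∀ j < 6, (posQ j).eval w s₃ = D.pos j q := by
        intro s₃ h1 h2 j hj
        simp only [posQ, WExp.eval, eval_var, h2]
        rw [h1 _ (by omega) (by omega), henv2.pos j hj q hq]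
      have hcp : ∀ j, (posQ j).cost = 3 := fun _ => rfl
      refine Run.seq (Run.assign (Run.seq (Run.assign (Run.seq (Run.assign ?_)))))
      have e1 : (WExp.add (posQ b₁) (.lit 1)).eval w s₂ = D.pos b₁ q + 1 := by
        simp only [WExp.eval, hone, hposq s₂ (fun _ _ _ => rfl) hq2 b₁ hb₁]
        exact Nat.mod_eq_of_lt (by omega)
      rw [e1]
      set s₃ := s₂.setWord vWx 0 (D.pos b₁ q + 1) with hs₃
      have e2 : (WExp.add (posQ b₂) (.lit 1)).eval w s₃ = D.pos b₂ q + 1 := by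
        simp only [WExp.eval, hone, hposq s₃ (fun a h _ => words_setWord_of_ne _ _ _ (by omega))
          (by rw [hs₃, words_setWord_of_ne _ _ _ (by decide), hq2]) b₂ hb₂]
        exact Nat.mod_eq_of_lt (by omega)
      rw [e2]
      set s₄ := s₃.setWord vYt 0 (D.pos b₂ q + 1) with hs₄
      have e3 : (WExp.add (posQ b₃) (.lit 1)).eval w s₄ = D.pos b₃ q + 1 := by
        simp only [WExp.eval, hone, hposq s₄ (fun a h _ => by
            rw [hs₄, words_setWord_of_ne _ _ _ (by omega), hs₃,
            words_setWord_of_ne _ _ _ (by omega)])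
          (by rw [hs₄, words_setWord_of_ne _ _ _ (by decide), hs₃,
            words_setWord_of_ne _ _ _ (by decide), hq2]) b₃ hb₃]
        exact Nat.mod_eq_of_lt (by omega)
      rw [e3]
      set s₅ := s₄.setWord vZt 0 (D.pos b₃ q + 1) with hs₅
      have fr5 : ∀ a, a ≠ vWx → a ≠ vYt → a ≠ vZt → s₅.words a = s₂.words a := by
        intro a h1 h2 h3
        rw [hs₅, words_setWord_of_ne _ _ _ h3, hs₄, words_setWord_of_ne _ _ _ h2, hs₃,
          words_setWord_of_ne _ _ _ h1]
      have henv5 : Env w l D vp vr α β s₅ := henv2.congr hsl (fun a h1 h2 =>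
        fr5 a (by omega) (by omega) (by omega))
      have hT3_5 : s₅.words T₃ = s₁.words T₃ := by
        rw [fr5 _ (by omega) (by omega) (by omega), hs₂, words_setWord_of_ne _ _ _ (by omega)]
      refine Run.seq ((run_walk (g₂ := g₂) (g₃ := g₃) (nQ := D.nQ) (x₀ := D.pos b₁ q + 1)
        (y₀ := D.pos b₂ q + 1) (z₀ := D.pos b₃ q + 1) hroom henv5.leaf henv5.mul henv5.half hT₂ hT₃
        (htab₂.congr (by rw [fr5 _ (by omega) (by omega) (by omega),
          fr2 _ (by simp only [W]; omega)])) (htab.congr hT3_5)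
        (by rw [fr5 _ (by omega) (by omega) (by omega), fr2 _ (by simp only [W]; omega), hmark₂])
        (by rw [fr5 _ (by omega) (by omega) (by omega), fr2 _ (by simp only [W]; omega), hmark₃])
        henv5.nQ hsize (by simp [hs₅, hs₄, hs₃, words_setWord]) (by simp [hs₅, hs₄, words_setWord])
        (by simp [hs₅, words_setWord]) (by omega) (by omega) (by omega)
        (fun r₁ r₂ r₃ h => ⟨(hRS _ _ _ h).1, (hRS _ _ _ h).2.1⟩)).frame.mono ?_)
      rintro t₁ s₆ ⟨⟨ht₁, hans6, hsnd6, hcmp6⟩, hfr6⟩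
      have fr6 : ∀ a, ¬ ((60 ≤ a ∧ a ≤ 64) ∨ (70 ≤ a ∧ a ≤ 73) ∨ (80 ≤ a ∧ a ≤ 83) ∨ a = vAns) →
        s₆.words a = s₅.words a := fun a ha => hfr6 a (fun h => ha (writes_walk h))
      have hans5 : s₅.words vAns = s₁.words vAns := by
        rw [fr5 _ (by omega) (by omega) (by omega), hans2]
      rw [hans5] at hans6 hsnd6
      have henv6 : Env w l D vp vr α β s₆ := henv5.congr hsl (fun a h1 h2 =>
        fr6 a (by omega))
      have hq6 : s₆.words vQ 0 = q := by
        rw [fr6 _ (by omega), fr5 _ (by omega) (by omega) (by omega), hq2]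
      have hev : ∀ j < 6, EvalsTo w s₆ (posQ j) (D.pos j q) := by
        intro j hj s' h
        simp only [posQ, WExp.eval, eval_var, h vQ (by omega), hq6]
        rw [h _ (by omega), henv6.pos j hj q hq]
      refine (run_insTab (g := g₃) (vs := [D.pos b₁ q, D.pos b₂ q]) (S := pairLists (F k)) (d := 2)
        hroom henv6.leaf henv6.mul (htab.congr (by rw [fr6 _ (by omega), hT3_5]))
        (.cons (hev b₁ hb₁) (.cons (hev b₂ hb₂) .nil))
        (fun s' h => by
          rw [eval_var, h _ (by omega), fr6 _ (by omega), fr5 _ (by omega) (by omega) (by omega),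
            fr2 _ (by simp only [W]; omega), hmark₃]) rfl (by omega) (by simp; omega)
        hT₃).frame.mono ?_
      rintro t₂ s₇ ⟨⟨ht₂, htab7⟩, hfr7⟩
      have fr7 : ∀ a, a ≠ T₃ → ¬ (60 ≤ a ∧ a ≤ 64) → s₇.words a = s₆.words a := fun a h1 h2 =>
        hfr7 a (fun h => by have := writes_insTab h; omega)
      have hcost : (List.map (fun e : WExp => e.cost + 2) [posQ b₁, posQ b₂]).sum +
        (var vMarkP).cost = 12 := rfl
      rw [hcost] at ht₂
      have hans7 : s₇.words vAns = s₆.words vAns := fr7 _ (by omega) (by omega)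
      have hpl : insert [D.pos b₁ q, D.pos b₂ q] (pairLists (F k)) = pairLists (F (k + 1)) := by
        ext e
        simp only [hFs, pairLists, Set.mem_insert_iff, Set.mem_ofPred_eq, Finset.mem_insert,
          exists_eq_or_imp]
      have hcov : ∀ r₁ r₂, Covers (F (k + 1)) r₁ r₂ ↔
          (D.pos b₁ q < r₁ ∧ D.pos b₂ q < r₂) ∨ Covers (F k) r₁ r₂ := by
        intro r₁ r₂
        simp only [hFs, Covers, Finset.mem_insert, exists_eq_or_imp]
      refine ⟨stepTime l * (minimals (F (k + 1))).card, ?_, ?_, ?_, ?_, ?_, ?_, rfl⟩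
      -- The walk is paid for by the minimal points beyond the new one, which disappear; the new
      -- point puts one step in store.
      · have hcard := card_minimals_insert (F k) (D.pos b₁ q) (D.pos b₂ q)
        rw [← hFs] at hcard
        have hmulc := Nat.mul_le_mul_left (stepTime l) hcard
        simp only [Nat.mul_add, mul_one] at hmulc ht₁
        simp only [hbc, WExp.cost, cost_var, hcp, hφ]
        omega
      · intro a ha
        have ha' := ha
        simp only [W] at ha'
        rw [fr7 a (by omega) (by omega), fr6 a (by omega), fr5 a (by omega) (by omega) (by omega),
          fr2 a ha]
      · rw [← hpl]; exact htab7
      · rw [hans7]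
        rcases hans6 with h | h
        · exact Or.inl h
        · rw [h]; exact hans
      · rw [hans7]
        intro h0
        rcases hsnd6 h0 with h | ⟨r₁, r₂, r₃, hr, hnc, hz⟩
        · exact hsnd h
        · refine Or.inr ⟨r₁, r₂, r₃, hr, ?_⟩
          rintro i hi hdi ⟨h1, h2, h3⟩
          -- A point that is free and not later than the new element is not above any later element,
          -- as the list is sorted.
          rcases lt_or_ge i k with hik | hik
          · exact hnc ⟨_, Inst.mem_seen.2 ⟨i, hik, hdi, rfl⟩, h1, h2⟩
          · have := hsort k i hik hi
            rw [← hqdef] at this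
            omega
      · intro r₁ r₂ r₃ hr hmiss
        rw [hans7, hcov]
        rcases hcmp r₁ r₂ r₃ hr hmiss with h | h
        · left
          rcases hans6 with h' | h'
          · exact h'
          · rw [h', h]
        -- If the new element covers a missed point, then this point is not beyond it in the
        -- coordinate `b₃`, and it is found at the last moment.
        · by_cases hc : D.pos b₁ q < r₁ ∧ D.pos b₂ q < r₂
          · left
            have := hmiss k hk hb
            rw [← hqdef] at this
            exact hcmp6 r₁ r₂ r₃ hr h (by omega) (by omega) (by omega)
          · right
            rintro (h' | h')
            · exact hc h'
            · exact h h'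
    · rw [hdom] at hb
      have hFs : F (k + 1) = F k := Inst.seen_succ_of_neg hb
      refine ⟨φ, ?_, ?_, ?_, ?_, ?_, ?_, ?_⟩
      · simp only [hbc, WExp.cost, cost_var]; omega
      · exact fr2
      · rw [hFs]; exact htab.congr (words_setWord_of_ne _ _ _ (by omega))
      · rw [hans2]; exact hans
      · rw [hans2]; exact hsnd
      · rw [hans2, hFs]; exact hcmp
      · rw [hFs]; exact hφ
  · rintro t₁ s₁ ⟨φ, ht₁, hfr, htab, hans, hsnd, hcmp, hφ⟩
    have henv1 : Env w l D vp vr α β s₁ := henv.congr hsl (fun a h1 h2 => hfr a (by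
      simp only [W]; omega))
    -- The final walk visits everything that is still free.
    refine Run.seq (Run.assign (Run.seq (Run.assign (Run.seq (Run.assign ?_)))))
    simp only [WExp.eval, Nat.zero_mod, eval_var, hone]
    rw [words_setWord_of_ne _ _ _ (show vNQ ≠ vYt by decide),
      words_setWord_of_ne _ _ _ (show vNQ ≠ vWx by decide), henv1.nQ,
      Nat.mod_eq_of_lt (show D.nQ + 1 < 2 ^ w by omega)]
    set s₂ := ((s₁.setWord vWx 0 0).setWord vYt 0 0).setWord vZt 0 (D.nQ + 1) with hs₂
    have fr2 : ∀ a, a ≠ vWx → a ≠ vYt → a ≠ vZt → s₂.words a = s₁.words a := by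
      intro a h1 h2 h3
      rw [hs₂, words_setWord_of_ne _ _ _ h3, words_setWord_of_ne _ _ _ h2,
        words_setWord_of_ne _ _ _ h1]
    have henv2 : Env w l D vp vr α β s₂ := henv1.congr hsl (fun a h1 h2 =>
      fr2 a (by omega) (by omega) (by omega))
    refine ((run_walk (g₂ := g₂) (g₃ := g₃) (nQ := D.nQ) (x₀ := 0)
        (y₀ := 0) (z₀ := D.nQ + 1) hroom henv2.leaf henv2.mul henv2.half hT₂ hT₃
        (htab₂.congr (by
          rw [fr2 _ (by omega) (by omega) (by omega), hfr _ (by simp only [W]; omega)]))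
        (htab.congr (by rw [fr2 _ (by omega) (by omega) (by omega)]))
        (by rw [fr2 _ (by omega) (by omega) (by omega), hfr _ (by simp only [W]; omega), hmark₂])
        (by rw [fr2 _ (by omega) (by omega) (by omega), hfr _ (by simp only [W]; omega), hmark₃])
        henv2.nQ hsize (by simp [hs₂, words_setWord]) (by simp [hs₂, words_setWord])
        (by simp [hs₂, words_setWord]) (by omega) (by omega) (by omega)
        (fun r₁ r₂ r₃ h => ⟨(hRS _ _ _ h).1, (hRS _ _ _ h).2.1⟩)).frame.mono ?_)
    rintro t₂ s₃ ⟨⟨ht₂, hans3, hsnd3, hcmp3⟩, hfr3⟩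
    have hans2 : s₂.words vAns = s₁.words vAns := fr2 _ (by omega) (by omega) (by omega)
    rw [hans2] at hans3 hsnd3
    refine ⟨?_, ?_, ⟨?_, ?_⟩, ?_⟩
    · have h1 : (minimalsAbove (F m) 0 0).card ≤ (minimals (F m)).card :=
        Finset.card_le_card (Finset.filter_subset _ _)
      have h2 := Nat.mul_le_mul_left (stepTime l) h1
      simp only [Finset.sum_const, Finset.card_range, smul_eq_mul, hφ, cost_var] at ht₁
      have h3 : m * (3 * stepTime l + tabTime (l + 1) 2 12 + 100 + (2 + 11)) ≤
          m * (3 * stepTime l + tabTime (l + 1) 2 12 + 150) := Nat.mul_le_mul_left _ (by omega)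
      simp only [Nat.mul_add (stepTime l)] at ht₂
      simp only [sweepTime, WExp.cost, cost_var]
      omega
    · rcases hans3 with h | h
      · exact Or.inl h
      · rw [h]; exact hans
    · intro h0
      rcases hsnd3 h0 with h | ⟨r₁, r₂, r₃, hr, hnc, -⟩
      · exact hsnd h
      · refine Or.inr ⟨r₁, r₂, r₃, hr, ?_⟩
        rintro i hi hdi ⟨h1, h2, -⟩
        exact hnc ⟨_, Inst.mem_seen.2 ⟨i, hi, hdi, rfl⟩, h1, h2⟩
    · rintro (h | ⟨r₁, r₂, r₃, hr, hmiss⟩)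
      · have : s₁.words vAns 0 = 0 := by rcases hans with h' | h' <;> omega
        rcases hans3 with h' | h' <;> omega
      · rcases hcmp r₁ r₂ r₃ hr hmiss with h | h
        · rcases hans3 with h' | h' <;> omega
        · have := hRS _ _ _ hr
          exact hcmp3 r₁ r₂ r₃ hr h (by omega) (by omega) (by omega)
    · intro k
      rw [hfr3 T₃ (fun h => by have := writes_walk h; omega),
        fr2 _ (by omega) (by omega) (by omega)]
      exact htab.le k

/-! ### Processing one cell of the partition -/

notation "vR" => 93
notation "vK" => 94
notation "vCell" => 100

/-- Digit number `i` of `c` in base `b`. -/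
def digit (b : ℕ) : ℕ → ℕ → ℕ
  | 0, c => c % b
  | i + 1, c => digit b i (c / b)

/-- The expression for digit number `i` of `e` in the base stored in `vBase`. -/
def digitExp : ℕ → WExp → WExp
  | 0, e => .mod e (var vBase)
  | i + 1, e => digitExp i (.div e (var vBase))

theorem eval_digitExp {w : ℕ} {s : Store} : ∀ (i : ℕ) (e : WExp),
    (digitExp i e).eval w s = digit (s.words vBase 0) i (e.eval w s)
  | 0, e => by simp [digitExp, digit, WExp.eval]
  | i + 1, e => by simp [digitExp, digit, WExp.eval, eval_digitExp i]

/-- The slabs of `p` in the coordinates `as` are the digits of `c`. -/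
def Inst.InCell (D : Inst) (as : List ℕ) (c p : ℕ) : Prop :=
  ∀ x ∈ as.zipIdx, D.cP x.1 p / D.B = digit D.b x.2 c

/-- In all coordinates `as`, the slab of `q` comes before that of the cell `c`, so that each element
of the cell dominates `q`. -/
def Inst.Under (D : Inst) (as : List ℕ) (c q : ℕ) : Prop :=
  ∀ x ∈ as.zipIdx, D.pos x.1 q / D.B < digit D.b x.2 c

/-- In some of the coordinates `as`, the slab of `q` is that of the cell `c`. -/
def Inst.Crosses (D : Inst) (as : List ℕ) (c q : ℕ) : Prop :=
  ∃ x ∈ as.zipIdx, D.pos x.1 q / D.B = digit D.b x.2 c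

theorem forall_zipIdx {as : List ℕ} {P : ℕ → Prop} :
    (∀ x ∈ as.zipIdx, P x.1) ↔ ∀ j ∈ as, P j := by
  constructor
  · intro h j hj
    obtain ⟨i, hi⟩ := List.getElem?_of_mem hj
    exact h (j, i) (List.mem_zipIdx_iff_getElem?.2 hi)
  · intro h x hx
    exact h _ (List.mem_of_getElem? (List.mem_zipIdx_iff_getElem?.1 hx))

/-- For an element `p` of a cell, all of the `q` below `p` are under the cell or cross it. -/
theorem Inst.InCell.dominates_iff {D : Inst} {as : List ℕ} {c p q : ℕ} (h : D.InCell as c p) :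
    (∀ j ∈ as, D.pos j q < D.cP j p) ↔
      D.Under as c q ∨ (D.Crosses as c q ∧ ∀ j ∈ as, D.pos j q < D.cP j p) := by
  constructor
  · intro hd
    by_cases hc : D.Crosses as c q
    · exact Or.inr ⟨hc, hd⟩
    · left
      intro x hx
      have h1 := forall_zipIdx.2 hd x hx
      have h2 : D.pos x.1 q / D.B ≤ D.cP x.1 p / D.B := Nat.div_le_div_right h1.le
      rw [h x hx] at h2
      exact lt_of_le_of_ne h2 fun he => hc ⟨x, hx, he⟩
  · rintro (hu | ⟨-, hd⟩)
    · refine forall_zipIdx.1 fun x hx => ?_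
      have := hu x hx
      rw [← h x hx] at this
      by_contra hle
      exact absurd (Nat.div_le_div_right (c := D.B) (not_lt.1 hle)) (not_le.2 this)
    · exact hd

/-- The list of the elements of `Q` that cross the cell, in the order of the coordinate `b₃`, as far
as they are among the first `k`. -/
noncomputable def Inst.crossing (D : Inst) (as : List ℕ) (b₃ c k : ℕ) : List ℕ :=
  open Classical in ((List.range k).map (D.ord b₃)).filter fun q => D.Crosses as c q

theorem Inst.crossing_succ_of_pos {D : Inst} {as : List ℕ} {b₃ c k : ℕ}
    (h : D.Crosses as c (D.ord b₃ k)) :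
    D.crossing as b₃ c (k + 1) = D.crossing as b₃ c k ++ [D.ord b₃ k] := by
  classical simp [Inst.crossing, List.range_succ, h]

theorem Inst.crossing_succ_of_neg {D : Inst} {as : List ℕ} {b₃ c k : ℕ}
    (h : ¬ D.Crosses as c (D.ord b₃ k)) :
    D.crossing as b₃ c (k + 1) = D.crossing as b₃ c k := by
  classical simp [Inst.crossing, List.range_succ, h]

theorem Inst.mem_crossing {D : Inst} {l : ℕ} (hD : D.Valid l) {as : List ℕ} {b₃ c q : ℕ}
    (hb : b₃ < 6) : q ∈ D.crossing as b₃ c D.nQ ↔ q < D.nQ ∧ D.Crosses as c q := by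
  classical
  simp only [Inst.crossing, List.mem_filter, List.mem_map, List.mem_range, decide_eq_true_eq]
  constructor
  · rintro ⟨⟨k, hk, rfl⟩, h⟩
    exact ⟨hD.ord_lt b₃ hb k hk, h⟩
  · rintro ⟨hq, h⟩
    exact ⟨⟨D.pos b₃ q, hD.pos_lt b₃ hb q hq, hD.ord_pos b₃ hb q hq⟩, h⟩

theorem Inst.pairwise_crossing {D : Inst} {l : ℕ} (hD : D.Valid l) {as : List ℕ} {b₃ c : ℕ}
    (hb : b₃ < 6) : (D.crossing as b₃ c D.nQ).Pairwise fun q q' => D.pos b₃ q < D.pos b₃ q' := by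
  classical
  refine List.Pairwise.filter _ (List.pairwise_map.2 ?_)
  refine (List.pairwise_lt_range (n := D.nQ)).imp_of_mem ?_
  intro a a' ha ha' h
  rw [List.mem_range] at ha ha'
  rwa [hD.pos_ord b₃ hb a ha, hD.pos_ord b₃ hb a' ha']

/-- In each of the coordinates, at most `D.B` elements of `Q` are in the slab of the cell. -/
theorem Inst.length_crossing_le {D : Inst} {l : ℕ} (hD : D.Valid l) {as : List ℕ} {b₃ c : ℕ}
    (hb : b₃ < 6) (has : ∀ j ∈ as, j < 6) :
    (D.crossing as b₃ c D.nQ).length ≤ as.length * D.B := by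
  classical
  have hnd : (D.crossing as b₃ c D.nQ).Nodup :=
    (Inst.pairwise_crossing hD hb).imp fun h he => by rw [he] at h; exact lt_irrefl _ h
  rw [← List.toFinset_card_of_nodup hnd]
  have hsub : (D.crossing as b₃ c D.nQ).toFinset ⊆ as.zipIdx.toFinset.biUnion fun x =>
      (Finset.range D.nQ).filter fun q => D.pos x.1 q / D.B = digit D.b x.2 c := by
    intro q hq
    rw [List.mem_toFinset, Inst.mem_crossing hD hb] at hq
    obtain ⟨hq, x, hx, he⟩ := hq
    simp only [Finset.mem_biUnion, List.mem_toFinset, Finset.mem_filter, Finset.mem_range]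
    exact ⟨x, hx, hq, he⟩
  refine (Finset.card_le_card hsub).trans ((Finset.card_biUnion_le_card_mul _ _ D.B ?_).trans ?_)
  · intro x hx
    have hx6 : x.1 < 6 := by
      rw [List.mem_toFinset] at hx
      exact has _ (List.mem_of_getElem? (List.mem_zipIdx_iff_getElem?.1 hx))
    have : ((Finset.range D.nQ).filter fun q => D.pos x.1 q / D.B = digit D.b x.2 c).card ≤
        (Finset.Ico (digit D.b x.2 c * D.B) (digit D.b x.2 c * D.B + D.B)).card := by
      refine Finset.card_le_card_of_injOn (D.pos x.1) ?_ ?_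
      · intro q hq
        simp only [Finset.coe_filter, Finset.mem_range, Set.mem_ofPred_eq] at hq
        have hw := hD.width
        rw [Finset.coe_Ico, Set.mem_Ico, ← hq.2]
        have h1 := Nat.div_add_mod (D.pos x.1 q) D.B
        have h2 := Nat.mod_lt (D.pos x.1 q) hw
        rw [mul_comm] at h1
        omega
      · intro q hq q' hq' he
        simp only [Finset.coe_filter, Finset.mem_range, Set.mem_ofPred_eq] at hq hq'
        rw [← hD.ord_pos _ hx6 q hq.1, he, hD.ord_pos _ hx6 q' hq'.1]
    simpa using this
  · exact Nat.mul_le_mul_right _ ((List.toFinset_card_le _).trans (by simp))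

/-- The test that the current `q` is under the current cell. -/
def underTest (as : List ℕ) : BExp :=
  allTests (as.zipIdx.map fun x =>
    .not (.wordLe (digitExp x.2 (var vCell)) (.div (posQ x.1) (var vWid))))

/-- The test that two words are equal. -/
def eqTest (e f : WExp) : BExp := .and (.wordLe e f) (.wordLe f e)

theorem holds_eqTest {w : ℕ} {s : Store} {e f : WExp} :
    (eqTest e f).Holds w s ↔ e.eval w s = f.eval w s := by
  simp only [eqTest, BExp.Holds]; omega

/-- The test that the current `q` crosses the current cell. -/
def crossTest (as : List ℕ) : BExp :=
  .not (allTests (as.zipIdx.map fun x =>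
    .not (eqTest (digitExp x.2 (var vCell)) (.div (posQ x.1) (var vWid)))))

/-- The test that the current `p` is in the current cell. -/
def cellTest (α : ℕ) (as : List ℕ) : BExp :=
  allTests (as.zipIdx.map fun x =>
    eqTest (digitExp x.2 (var vCell)) (.div (.get (α + x.1) (var vP)) (var vWid)))

theorem cost_tests {α : ℕ} {as : List ℕ} (h : as.length = 4) :
    (underTest as).cost ≤ 100 ∧ (crossTest as).cost ≤ 200 ∧ (cellTest α as).cost ≤ 200 := by
  match as, h with
  | [_, _, _, _], _ =>
    exact ⟨Nat.le_of_ble_eq_true rfl, Nat.le_of_ble_eq_true rfl, Nat.le_of_ble_eq_true rfl⟩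

section Tests

variable {w l vp vr α β c : ℕ} {D : Inst} {as : List ℕ} {s : Store}

theorem holds_underTest (henv : Env w l D vp vr α β s) (has : ∀ j ∈ as, j < 6) {q : ℕ}
    (hq : q < D.nQ) (hvq : s.words vQ 0 = q) (hc : s.words vCell 0 = c) :
    (underTest as).Holds w s ↔ D.Under as c q := by
  simp only [underTest, holds_allTests, List.mem_map, forall_exists_index, and_imp,
    forall_apply_eq_imp_iff₂, BExp.Holds, eval_digitExp, WExp.eval, eval_var, posQ, hvq, hc, not_le,
    henv.b, henv.B, Inst.Under]
  refine forall₂_congr fun x hx => ?_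
  rw [henv.pos x.1 (has _ (List.mem_of_getElem? (List.mem_zipIdx_iff_getElem?.1 hx))) q hq]

theorem holds_crossTest (henv : Env w l D vp vr α β s) (has : ∀ j ∈ as, j < 6) {q : ℕ}
    (hq : q < D.nQ) (hvq : s.words vQ 0 = q) (hc : s.words vCell 0 = c) :
    (crossTest as).Holds w s ↔ D.Crosses as c q := by
  simp only [crossTest, BExp.Holds, holds_allTests, List.mem_map, forall_exists_index, and_imp,
    forall_apply_eq_imp_iff₂, holds_eqTest, eval_digitExp, WExp.eval, eval_var, posQ, hvq, hc,
    henv.b, henv.B, Inst.Crosses, not_forall, not_not, exists_prop]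
  refine exists_congr fun x => and_congr_right fun hx => ?_
  rw [henv.pos x.1 (has _ (List.mem_of_getElem? (List.mem_zipIdx_iff_getElem?.1 hx))) q hq, eq_comm]

theorem holds_cellTest (henv : Env w l D vp vr α β s) (has : ∀ j ∈ as, j < 6) {p : ℕ}
    (hp : p < D.nP) (hvp : s.words vP 0 = p) (hc : s.words vCell 0 = c) :
    (cellTest α as).Holds w s ↔ D.InCell as c p := by
  simp only [cellTest, holds_allTests, List.mem_map, forall_exists_index, and_imp,
    forall_apply_eq_imp_iff₂, holds_eqTest, eval_digitExp, WExp.eval, eval_var, hvp, hc,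
    henv.b, henv.B, Inst.InCell]
  refine forall₂_congr fun x hx => ?_
  rw [henv.cP x.1 (has _ (List.mem_of_getElem? (List.mem_zipIdx_iff_getElem?.1 hx))) p hp, eq_comm]

end Tests

/-- Enter the elements of `Q` that are under the current cell into the table `T₁`. -/
def loadUnder (as : List ℕ) (b₁ b₂ b₃ T₁ : ℕ) : Cmd :=
  forUp vQ (var vNQ) (.cond (underTest as)
    (insTab T₁ (var vMarkC) [posQ b₁, posQ b₂, posQ b₃]) .nop)

/-- The coordinate `j` of the current `r`. -/
def cntR (β j : ℕ) : WExp := .get (β + j) (var vR)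

/-- Enter the elements of `R` that dominate no element of the table `T₁` into the table `T₂`. -/
def loadFree (vr β b₁ b₂ b₃ T₁ T₂ : ℕ) : Cmd :=
  forUp vR (var vr) (.seq (qryTab T₁ (var vMarkC) [cntR β b₁, cntR β b₂, cntR β b₃])
    (.cond (.wordLe (.lit 1) (var vFd)) .nop
      (insTab T₂ (var vMarkC) [cntR β b₁, cntR β b₂, cntR β b₃])))

/-- List the elements of `Q` that cross the current cell, in the order of the coordinate `b₃`. -/
def listCrossing (as : List ℕ) (b₃ : ℕ) : Cmd :=
  .seq (assign vLen (.lit 0)) (forUp vK (var vNQ)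
    (.seq (assign vQ (.get (aOrd + b₃) (var vK))) (.cond (crossTest as)
      (.seq (.setWord aLst (var vLen) (var vQ)) (assign vLen (.add (var vLen) (.lit 1)))) .nop)))

/-- Sweep through the list for all `p` in the current cell. -/
def sweepAll (vp α : ℕ) (as : List ℕ) (b₁ b₂ b₃ T₂ T₃ : ℕ) : Cmd :=
  forUp vP (var vp) (.cond (cellTest α as)
    (.seq (assign vMarkP (.add (.add (.mul (var vCell) (var vp)) (var vP)) (.lit 1)))
      (sweep α as b₁ b₂ b₃ T₂ T₃)) .nop)

/-- The search for an uncovered pair with its first element in the cell `vCell`. -/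
def searchCell (vp vr α β : ℕ) (as : List ℕ) (b₁ b₂ b₃ T₁ T₂ T₃ : ℕ) : Cmd :=
  .seq (assign vMarkC (.add (var vCell) (.lit 1))) (.seq (loadUnder as b₁ b₂ b₃ T₁)
    (.seq (loadFree vr β b₁ b₂ b₃ T₁ T₂) (.seq (listCrossing as b₃)
      (sweepAll vp α as b₁ b₂ b₃ T₂ T₃))))

theorem writes_loadUnder {as : List ℕ} {b₁ b₂ b₃ T₁ a : ℕ}
    (h : (loadUnder as b₁ b₂ b₃ T₁).Writes a) : (60 ≤ a ∧ a ≤ 64) ∨ a = vQ ∨ a = T₁ := by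
  rw [loadUnder, writes_forUp] at h
  rcases h with h | h | h
  · omega
  · have := writes_insTab h; omega
  · exact h.elim

theorem writes_loadFree {vr β b₁ b₂ b₃ T₁ T₂ a : ℕ}
    (h : (loadFree vr β b₁ b₂ b₃ T₁ T₂).Writes a) : (60 ≤ a ∧ a ≤ 64) ∨ a = vR ∨ a = T₂ := by
  rw [loadFree, writes_forUp] at h
  rcases h with h | h | h | h
  · omega
  · have := writes_qryTab h; omega
  · exact h.elim
  · have := writes_insTab h; omega

theorem writes_listCrossing {as : List ℕ} {b₃ a : ℕ} (h : (listCrossing as b₃).Writes a) :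
    a = vQ ∨ a = vK ∨ a = aLst ∨ a = vLen := by
  simp only [listCrossing, Cmd.Writes, writes_assign, writes_forUp] at h
  tauto

theorem writes_sweepAll {vp α : ℕ} {as : List ℕ} {b₁ b₂ b₃ T₂ T₃ a : ℕ}
    (h : (sweepAll vp α as b₁ b₂ b₃ T₂ T₃).Writes a) :
    (60 ≤ a ∧ a ≤ 64) ∨ (70 ≤ a ∧ a ≤ 73) ∨ (80 ≤ a ∧ a ≤ 92) ∨ a = vAns ∨ a = T₃ := by
  rw [sweepAll, writes_forUp] at h
  rcases h with h | (h | h) | h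
  · omega
  · rw [writes_assign] at h; omega
  · have := writes_sweep h; omega
  · exact h.elim

theorem writes_searchCell {vp vr α β : ℕ} {as : List ℕ} {b₁ b₂ b₃ T₁ T₂ T₃ a : ℕ}
    (h : (searchCell vp vr α β as b₁ b₂ b₃ T₁ T₂ T₃).Writes a) :
    (60 ≤ a ∧ a ≤ 94) ∨ a = aLst ∨ a = vLen ∨ a = vAns ∨ a = T₁ ∨ a = T₂ ∨ a = T₃ := by
  rw [searchCell] at h
  rcases h with h | h | h | h | h
  · rw [writes_assign] at h; omega
  · have := writes_loadUnder h; omega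
  · have := writes_loadFree h; omega
  · have := writes_listCrossing h; omega
  · have := writes_sweepAll h; omega

/-- The coordinates `b₁`, `b₂`, `b₃` of the first `k` elements of `Q`, as far as these are under the
cell `c`. -/
def Inst.underSet (D : Inst) (as : List ℕ) (b₁ b₂ b₃ c k : ℕ) : Set (List ℕ) :=
  {e | ∃ q < k, D.Under as c q ∧ e = [D.pos b₁ q, D.pos b₂ q, D.pos b₃ q]}

/-- The coordinates of the first `k` elements of `R`, as far as these dominate nothing under the
cell `c`. -/
def Inst.freeSet (D : Inst) (as : List ℕ) (b₁ b₂ b₃ c k : ℕ) : Set (List ℕ) :=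
  {e | ∃ r < k, (∀ q < D.nQ, D.Under as c q →
    ¬ (D.pos b₁ q < D.cR b₁ r ∧ D.pos b₂ q < D.cR b₂ r ∧ D.pos b₃ q < D.cR b₃ r)) ∧
      e = [D.cR b₁ r, D.cR b₂ r, D.cR b₃ r]}

section Cell

variable {w l vp vr α β c b₁ b₂ b₃ T₁ T₂ T₃ : ℕ} {D : Inst} {as : List ℕ} {s : Store}

theorem run_loadUnder (hroom : Roomy w (l + 1)) (hsl : Slots vp vr α β) (hD : D.Valid l)
    (henv : Env w l D vp vr α β s) (has : ∀ j ∈ as, j < 6) (has4 : as.length = 4)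
    (hb : b₁ < 6 ∧ b₂ < 6 ∧ b₃ < 6) (hT₁ : 1000 ≤ T₁) (hc : s.words vCell 0 = c)
    (hmark : s.words vMarkC 0 = c + 1) (hfresh : ∀ k, s.words T₁ k ≤ c) :
    Run w (loadUnder as b₁ b₂ b₃ T₁) s (fun t s' =>
      t ≤ D.nQ * (tabTime (l + 1) 3 17 + 120) + 20 ∧
        Tab s' T₁ (l + 1) 3 (c + 1) (D.underSet as b₁ b₂ b₃ c D.nQ)) := by
  obtain ⟨hb₁, hb₂, hb₃⟩ := hb
  have hsize := hD.size
  have hleafw := hroom.leaf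
  refine (Run.forUp_const (N := D.nQ)
    (fun k s₁ => (∀ a, ¬ ((60 ≤ a ∧ a ≤ 64) ∨ a = vQ ∨ a = T₁) → s₁.words a = s.words a) ∧
      Tab s₁ T₁ (l + 1) 3 (c + 1) (D.underSet as b₁ b₂ b₃ c k))
    (tabTime (l + 1) 3 17 + 105) (by omega) ?_ ?_ ?_ ?_ ?_).mono ?_
  · rintro (h | h)
    · have := writes_insTab h; omega
    · exact h
  · rintro k s₁ ⟨hfr, -⟩
    rw [eval_var, hfr _ (by omega), henv.nQ]
  · rintro k s₁ v ⟨hfr, htab⟩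
    exact ⟨fun a ha => by rw [words_setWord_of_ne _ _ _ (by omega), hfr a ha],
      htab.congr (words_setWord_of_ne _ _ _ (by omega))⟩
  · refine ⟨fun _ _ => rfl, ?_⟩
    have : D.underSet as b₁ b₂ b₃ c 0 = ∅ := by ext e; simp [Inst.underSet]
    rw [this]
    exact Tab.empty fun k => Nat.lt_succ_of_le (hfresh k)
  · rintro k s₁ hk ⟨hfr, htab⟩ hik
    have henv1 : Env w l D vp vr α β s₁ := henv.congr hsl (fun a h1 h2 => hfr a (by omega))
    have htest := holds_underTest henv1 has hk hik (by rw [hfr _ (by omega), hc])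
    have hcost := (cost_tests (α := α) has4).1
    have hx := hD.pos_lt b₁ hb₁ k hk
    have hy := hD.pos_lt b₂ hb₂ k hk
    have hz := hD.pos_lt b₃ hb₃ k hk
    have hev : ∀ j < 6, EvalsTo w s₁ (posQ j) (D.pos j k) := by
      intro j hj s' h
      simp only [posQ, WExp.eval, eval_var, h vQ (by omega), hik]
      rw [h _ (by omega), henv1.pos j hj k hk]
    refine Run.cond (fun hb => ?_) (fun hb => Run.nop ?_)
    · rw [htest] at hb
      refine (run_insTab (g := c + 1) (vs := [D.pos b₁ k, D.pos b₂ k, D.pos b₃ k]) (d := 3)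
        hroom henv1.leaf henv1.mul htab
        (.cons (hev b₁ hb₁) (.cons (hev b₂ hb₂) (.cons (hev b₃ hb₃) .nil)))
        (fun s' h => by rw [eval_var, h _ (by omega), hfr _ (by omega), hmark]) rfl (by omega)
        (by simp; omega) hT₁).frame.mono ?_
      rintro t s₂ ⟨⟨ht, htab2⟩, hfr2⟩
      have hcost' : (List.map (fun e : WExp => e.cost + 2) [posQ b₁, posQ b₂, posQ b₃]).sum +
        (var vMarkC).cost = 17 := rfl
      rw [hcost'] at ht
      refine ⟨by omega, fun a ha => ?_, ?_⟩
      · rw [hfr2 a (fun h => by have := writes_insTab h; omega), hfr a ha]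
      · convert htab2 using 1
        ext e
        simp only [Inst.underSet, Set.mem_insert_iff, Set.mem_ofPred_eq, Nat.lt_succ_iff_lt_or_eq]
        constructor
        · rintro ⟨q, hq | rfl, hu, rfl⟩
          · exact Or.inr ⟨q, hq, hu, rfl⟩
          · exact Or.inl rfl
        · rintro (rfl | ⟨q, hq, hu, rfl⟩)
          · exact ⟨k, Or.inr rfl, hb, rfl⟩
          · exact ⟨q, Or.inl hq, hu, rfl⟩
    · rw [htest] at hb
      refine ⟨by omega, hfr, ?_⟩
      convert htab using 1
      ext e
      simp only [Inst.underSet, Set.mem_ofPred_eq, Nat.lt_succ_iff_lt_or_eq]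
      constructor
      · rintro ⟨q, hq | rfl, hu, rfl⟩
        · exact ⟨q, hq, hu, rfl⟩
        · exact absurd hu hb
      · rintro ⟨q, hq, hu, rfl⟩
        exact ⟨q, Or.inl hq, hu, rfl⟩
  · rintro t s' ⟨ht, -, htab⟩
    refine ⟨?_, htab⟩
    rw [cost_var] at ht
    have : D.nQ * (tabTime (l + 1) 3 17 + 105 + (2 + 11)) ≤ D.nQ * (tabTime (l + 1) 3 17 + 120) :=
      Nat.mul_le_mul_left _ (by omega)
    omega

/-- The table `T₂` then represents the points of `R` that no `q` under the cell excludes. -/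
theorem run_loadFree (hroom : Roomy w (l + 1)) (hsl : Slots vp vr α β) (hD : D.Valid l)
    (henv : Env w l D vp vr α β s) (hb : b₁ < 6 ∧ b₂ < 6 ∧ b₃ < 6) (hT₁ : 1000 ≤ T₁)
    (hT₂ : 1000 ≤ T₂) (hT : T₁ ≠ T₂) (hRw : D.nR < 2 ^ w)
    (hmark : s.words vMarkC 0 = c + 1) (hfresh : ∀ k, s.words T₂ k ≤ c)
    (htab₁ : Tab s T₁ (l + 1) 3 (c + 1) (D.underSet as b₁ b₂ b₃ c D.nQ)) :
    Run w (loadFree vr β b₁ b₂ b₃ T₁ T₂) s (fun t s' =>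
      t ≤ D.nR * (2 * tabTime (l + 1) 3 17 + 40) + 20 ∧
        Tab s' T₂ (l + 1) 3 (c + 1) (D.freeSet as b₁ b₂ b₃ c D.nR)) := by
  obtain ⟨hb₁, hb₂, hb₃⟩ := hb
  have hsize := hD.size
  have hone := hroom.lit (n := 1) (by omega)
  have hvr := hsl.vr
  have hβ := hsl.β
  have hw : ∀ a, (Cmd.seq (qryTab T₁ (var vMarkC) [cntR β b₁, cntR β b₂, cntR β b₃])
      (.cond (.wordLe (.lit 1) (var vFd)) .nop
      (insTab T₂ (var vMarkC) [cntR β b₁, cntR β b₂, cntR β b₃]))).Writes a →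
      (60 ≤ a ∧ a ≤ 64) ∨ a = T₂ := by
    rintro a (h | h | h)
    · have := writes_qryTab h; omega
    · exact h.elim
    · have := writes_insTab h; omega
  refine (Run.forUp_const (N := D.nR)
    (fun k s₁ => (∀ a, ¬ ((60 ≤ a ∧ a ≤ 64) ∨ a = vR ∨ a = T₂) → s₁.words a = s.words a) ∧
      Tab s₁ T₂ (l + 1) 3 (c + 1) (D.freeSet as b₁ b₂ b₃ c k))
    (2 * tabTime (l + 1) 3 17 + 15) hRw ?_ ?_ ?_ ?_ ?_).mono ?_
  · intro h
    have := hw _ h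
    omega
  · rintro k s₁ ⟨hfr, -⟩
    rw [eval_var, hfr _ (by omega), henv.nR]
  · rintro k s₁ v ⟨hfr, htab⟩
    exact ⟨fun a ha => by rw [words_setWord_of_ne _ _ _ (by omega), hfr a ha],
      htab.congr (words_setWord_of_ne _ _ _ (by omega))⟩
  · refine ⟨fun _ _ => rfl, ?_⟩
    have : D.freeSet as b₁ b₂ b₃ c 0 = ∅ := by ext e; simp [Inst.freeSet]
    rw [this]
    exact Tab.empty fun k => Nat.lt_succ_of_le (hfresh k)
  · rintro k s₁ hk ⟨hfr, htab⟩ hik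
    have henv1 : Env w l D vp vr α β s₁ := henv.congr hsl (fun a h1 h2 => hfr a (by omega))
    have hx := hD.cR_le b₁ hb₁ k hk
    have hy := hD.cR_le b₂ hb₂ k hk
    have hz := hD.cR_le b₃ hb₃ k hk
    have hev : ∀ s₂ : Store, (∀ a, ¬ (60 ≤ a ∧ a ≤ 64) → s₂.words a = s₁.words a) → ∀ j < 6,
        EvalsTo w s₂ (cntR β j) (D.cR j k) := by
      intro s₂ h2 j hj s' h
      simp only [cntR, WExp.eval, eval_var, h vR (by omega), h2 vR (by omega), hik]
      rw [h _ (by omega), h2 _ (by omega), henv1.cR j hj k hk]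
    have hcost' : (List.map (fun e : WExp => e.cost + 2) [cntR β b₁, cntR β b₂, cntR β b₃]).sum +
        (var vMarkC).cost = 17 := rfl
    have hev1 := hev s₁ (fun _ _ => rfl)
    refine Run.seq ((run_qryTab (g := c + 1) (vs := [D.cR b₁ k, D.cR b₂ k, D.cR b₃ k]) (d := 3)
        hroom henv1.leaf henv1.mul (htab₁.congr (hfr _ (by omega)))
        (.cons (hev1 b₁ hb₁) (.cons (hev1 b₂ hb₂) (.cons (hev1 b₃ hb₃) .nil)))
        (fun s' h => by rw [eval_var, h _ (by omega), hfr _ (by omega), hmark]) rfl (by omega)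
        (by simp; omega) hT₁).frame.mono ?_)
    rintro t₁ s₂ ⟨⟨ht₁, hfd, hfd1⟩, hfr2⟩
    have fr2 : ∀ a, ¬ (60 ≤ a ∧ a ≤ 64) → s₂.words a = s₁.words a := fun a ha =>
      hfr2 a (fun h => ha (writes_qryTab h))
    rw [hcost'] at ht₁
    have henv2 : Env w l D vp vr α β s₂ := henv1.congr hsl (fun a h1 h2 => fr2 a (by omega))
    have hhit : s₂.words vFd 0 = 1 ↔ ∃ q < D.nQ, D.Under as c q ∧
        (D.pos b₁ q < D.cR b₁ k ∧ D.pos b₂ q < D.cR b₂ k ∧ D.pos b₃ q < D.cR b₃ k) := by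
      rw [hfd]
      constructor
      · rintro ⟨e, ⟨q, hq, hu, rfl⟩, hb⟩
        simp only [Below, List.forall₂_cons, List.Forall₂.nil, and_true] at hb
        exact ⟨q, hq, hu, hb⟩
      · rintro ⟨q, hq, hu, hb⟩
        exact ⟨_, ⟨q, hq, hu, rfl⟩, by simpa [Below] using hb⟩
    have hbc : (BExp.wordLe (.lit 1) (var vFd)).cost = 4 := rfl
    refine Run.cond (fun hb => Run.nop ?_) (fun hb => ?_)
    · simp only [BExp.Holds, WExp.eval, eval_var, hone] at hb
      obtain ⟨q, hq, hu, hlt⟩ := hhit.1 (by omega)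
      refine ⟨by omega, fun a ha => by rw [fr2 a (by omega), hfr a ha], ?_⟩
      have hset : D.freeSet as b₁ b₂ b₃ c (k + 1) = D.freeSet as b₁ b₂ b₃ c k := by
        ext e
        simp only [Inst.freeSet, Set.mem_ofPred_eq, Nat.lt_succ_iff_lt_or_eq]
        constructor
        · rintro ⟨r, hr | rfl, hu', rfl⟩
          · exact ⟨r, hr, hu', rfl⟩
          · exact absurd hlt (hu' q hq hu)
        · rintro ⟨r, hr, hu', rfl⟩
          exact ⟨r, Or.inl hr, hu', rfl⟩
      rw [hset]
      exact htab.congr (fr2 _ (by omega))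
    · simp only [BExp.Holds, WExp.eval, eval_var, hone] at hb
      have hno : ∀ q < D.nQ, D.Under as c q →
          ¬ (D.pos b₁ q < D.cR b₁ k ∧ D.pos b₂ q < D.cR b₂ k ∧ D.pos b₃ q < D.cR b₃ k) := by
        intro q hq hu hlt
        have := hhit.2 ⟨q, hq, hu, hlt⟩
        omega
      have hev2 := hev s₂ fr2
      refine (run_insTab (g := c + 1) (vs := [D.cR b₁ k, D.cR b₂ k, D.cR b₃ k]) (d := 3)
        hroom henv2.leaf henv2.mul (htab.congr (fr2 _ (by omega)))
        (.cons (hev2 b₁ hb₁) (.cons (hev2 b₂ hb₂) (.cons (hev2 b₃ hb₃) .nil)))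
        (fun s' h => by rw [eval_var, h _ (by omega), fr2 _ (by omega), hfr _ (by omega), hmark])
        rfl (by omega) (by simp; omega) hT₂).frame.mono ?_
      rintro t₂ s₃ ⟨⟨ht₂, htab3⟩, hfr3⟩
      rw [hcost'] at ht₂
      refine ⟨by omega, fun a ha => ?_, ?_⟩
      · rw [hfr3 a (fun h => by have := writes_insTab h; omega), fr2 a (by omega), hfr a ha]
      · convert htab3 using 1
        ext e
        simp only [Inst.freeSet, Set.mem_insert_iff, Set.mem_ofPred_eq, Nat.lt_succ_iff_lt_or_eq]
        constructor
        · rintro ⟨r, hr | rfl, hu, rfl⟩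
          · exact Or.inr ⟨r, hr, hu, rfl⟩
          · exact Or.inl rfl
        · rintro (rfl | ⟨r, hr, hu, rfl⟩)
          · exact ⟨k, Or.inr rfl, hno, rfl⟩
          · exact ⟨r, Or.inl hr, hu, rfl⟩
  · rintro t s' ⟨ht, -, htab⟩
    refine ⟨?_, htab⟩
    rw [cost_var] at ht
    have : D.nR * (2 * tabTime (l + 1) 3 17 + 15 + (2 + 11)) ≤
      D.nR * (2 * tabTime (l + 1) 3 17 + 40) := Nat.mul_le_mul_left _ (by omega)
    omega

theorem run_listCrossing (hroom : Roomy w (l + 1)) (hsl : Slots vp vr α β) (hD : D.Valid l)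
    (henv : Env w l D vp vr α β s) (has : ∀ j ∈ as, j < 6) (has4 : as.length = 4)
    (hb₃ : b₃ < 6) (hc : s.words vCell 0 = c) :
    Run w (listCrossing as b₃) s (fun t s' => t ≤ D.nQ * 250 + 20 ∧
      s'.words vLen 0 = (D.crossing as b₃ c D.nQ).length ∧
      ∀ i q, (D.crossing as b₃ c D.nQ)[i]? = some q → s'.words aLst i = q) := by
  have hsize := hD.size
  have hleafw := hroom.leaf
  have hone := hroom.lit (n := 1) (by omega)
  have hw : ∀ a, (Cmd.seq (assign vQ (.get (aOrd + b₃) (var vK))) (.cond (crossTest as)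
      (.seq (.setWord aLst (var vLen) (var vQ)) (assign vLen (.add (var vLen) (.lit 1))))
        .nop)).Writes a → a = vQ ∨ a = aLst ∨ a = vLen := by
    intro a h
    simp only [Cmd.Writes, writes_assign] at h
    tauto
  refine Run.seq (Run.assign ?_)
  simp only [WExp.eval, Nat.zero_mod]
  refine (Run.forUp_const (N := D.nQ)
    (fun k s₁ => (∀ a, ¬ (a = vQ ∨ a = vK ∨ a = aLst ∨ a = vLen) → s₁.words a = s.words a) ∧
      s₁.words vLen 0 = (D.crossing as b₃ c k).length ∧ (D.crossing as b₃ c k).length ≤ k ∧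
      ∀ i q, (D.crossing as b₃ c k)[i]? = some q → s₁.words aLst i = q)
    230 (by omega) ?_ ?_ ?_ ?_ ?_).mono ?_
  · intro h
    have := hw _ h
    omega
  · rintro k s₁ ⟨hfr, -⟩
    rw [eval_var, hfr _ (by omega), henv.nQ]
  · rintro k s₁ v ⟨hfr, hlen, hle, hl⟩
    exact ⟨fun a ha => by rw [words_setWord_of_ne _ _ _ (by omega), hfr a ha],
      by rwa [words_setWord_of_ne _ _ _ (by decide)], hle,
      by rwa [words_setWord_of_ne _ _ _ (by decide)]⟩
  · refine ⟨fun a ha => words_setWord_of_ne _ _ _ (by omega), ?_, ?_, ?_⟩ <;>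
      simp [Inst.crossing, words_setWord]
  · rintro k s₁ hk ⟨hfr, hlen, hle, hl⟩ hik
    have henv1 : Env w l D vp vr α β s₁ := henv.congr hsl (fun a h1 h2 => hfr a (by omega))
    refine Run.seq (Run.assign ?_)
    simp only [WExp.eval, eval_var, hik, henv1.ord b₃ hb₃ k hk]
    set q := D.ord b₃ k with hq
    have hqn : q < D.nQ := hD.ord_lt b₃ hb₃ k hk
    set s₂ := s₁.setWord vQ 0 q with hs₂
    have fr2 : ∀ a, a ≠ vQ → s₂.words a = s₁.words a := fun a ha => words_setWord_of_ne _ _ _ ha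
    have henv2 : Env w l D vp vr α β s₂ := henv1.congr hsl (fun a h1 h2 => fr2 a (by omega))
    have hq2 : s₂.words vQ 0 = q := by simp [hs₂, words_setWord]
    have htest := holds_crossTest henv2 has hqn hq2
      (by rw [fr2 _ (by omega), hfr _ (by omega), hc])
    have hcost := (cost_tests (α := α) has4).2.1
    refine Run.cond (fun hb => Run.seq (Run.setWord (Run.assign ?_))) (fun hb => Run.nop ?_)
    · rw [htest] at hb
      simp only [WExp.eval, eval_var, hq2, fr2 vLen (by omega), hlen, hone,
        words_setWord_of_ne _ _ _ (show vLen ≠ aLst by decide)]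
      rw [Nat.mod_eq_of_lt (show (D.crossing as b₃ c k).length + 1 < 2 ^ w by omega)]
      refine ⟨?_, ?_, ?_, ?_, ?_⟩
      · simp only [WExp.cost, cost_var]; omega
      · intro a ha
        rw [words_setWord_of_ne _ _ _ (by omega), words_setWord_of_ne _ _ _ (by omega),
          fr2 a (by omega), hfr a ha]
      · simp [words_setWord, Inst.crossing_succ_of_pos hb]
      · simp only [Inst.crossing_succ_of_pos hb, List.length_append, List.length_singleton]; omega
      · intro i q' hi
        rw [Inst.crossing_succ_of_pos hb, ← hq] at hi
        rw [words_setWord_of_ne _ _ _ (by decide), words_setWord]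
        rcases lt_trichotomy i (D.crossing as b₃ c k).length with h | h | h
        · rw [if_neg (by omega), fr2 _ (by omega)]
          rw [List.getElem?_append_left h] at hi
          exact hl i q' hi
        · subst h
          simpa using hi
        · rw [List.getElem?_append_right h.le, List.getElem?_singleton, if_neg (by omega)] at hi
          exact absurd hi (by simp)
    · rw [htest] at hb
      rw [Inst.crossing_succ_of_neg hb]
      refine ⟨?_, ?_, ?_, by omega, ?_⟩
      · simp only [WExp.cost, cost_var]; omega
      · intro a ha
        rw [fr2 a (by omega), hfr a ha]
      · rw [fr2 _ (by omega), hlen]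
      · rw [fr2 _ (by omega)]; exact hl
  · rintro t s' ⟨ht, -, h1, -, h2⟩
    refine ⟨?_, h1, h2⟩
    simp only [WExp.cost, cost_var] at ht ⊢
    omega

end Cell

/-- For no `q` is `p` above `q` in the coordinates `as` and `r` above `q` in the coordinates
`b₁`, `b₂`, `b₃`. -/
def Inst.Uncovered (D : Inst) (as : List ℕ) (b₁ b₂ b₃ p r : ℕ) : Prop :=
  ∀ q < D.nQ, (∀ j ∈ as, D.pos j q < D.cP j p) →
    ¬ (D.pos b₁ q < D.cR b₁ r ∧ D.pos b₂ q < D.cR b₂ r ∧ D.pos b₃ q < D.cR b₃ r)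

theorem sweepTime_mono {l m m' : ℕ} (h : m ≤ m') : sweepTime l m ≤ sweepTime l m' := by
  have := Nat.mul_le_mul_right (3 * stepTime l + tabTime (l + 1) 2 12 + 150) h
  simp only [sweepTime]; omega

open Classical in
/-- A bound for the time that the sweeps of one cell take. -/
noncomputable def Inst.sweepsTime (D : Inst) (l : ℕ) (as : List ℕ) (c : ℕ) : ℕ :=
  ∑ p ∈ Finset.range D.nP, if D.InCell as c p then sweepTime l (4 * D.B) else 0

section Cell

variable {w l vp vr α β c b₁ b₂ b₃ T₁ T₂ T₃ : ℕ} {D : Inst} {as : List ℕ} {s : Store}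

/-- A pair with its first element in the cell `c` is uncovered if `r` is above no `q` under the cell
and the sweep for `p` misses `r`. -/
theorem Inst.InCell.uncovered_iff (hD : D.Valid l) (hb₃ : b₃ < 6) {p : ℕ} (hp : D.InCell as c p) :
    (∃ r₁ r₂ r₃, [r₁, r₂, r₃] ∈ D.freeSet as b₁ b₂ b₃ c D.nR ∧
      D.Missed as b₁ b₂ b₃ p (fun i => (D.crossing as b₃ c D.nQ).getD i 0)
        (D.crossing as b₃ c D.nQ).length r₁ r₂ r₃) ↔
      ∃ r < D.nR, D.Uncovered as b₁ b₂ b₃ p r := by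
  have hget : ∀ i, i < (D.crossing as b₃ c D.nQ).length →
      (D.crossing as b₃ c D.nQ).getD i 0 ∈ D.crossing as b₃ c D.nQ := by
    intro i hi
    rw [List.getD_eq_getElem _ _ hi]
    exact List.getElem_mem hi
  constructor
  · rintro ⟨r₁, r₂, r₃, ⟨r, hr, hfree, he⟩, hmiss⟩
    simp only [List.cons.injEq, and_true] at he
    obtain ⟨rfl, rfl, rfl⟩ := he
    refine ⟨r, hr, fun q hq hdom => ?_⟩
    rcases hp.dominates_iff.1 hdom with hu | ⟨hc, hd⟩
    · exact hfree q hq hu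
    · obtain ⟨i, hi, he⟩ := List.mem_iff_getElem.1 ((Inst.mem_crossing hD hb₃).2 ⟨hq, hc⟩)
      have := hmiss i hi
      simp only [List.getD_eq_getElem _ _ hi, he] at this
      exact this hd
  · rintro ⟨r, hr, hun⟩
    refine ⟨_, _, _, ⟨r, hr, fun q hq hu => hun q hq (hp.dominates_iff.2 (Or.inl hu)), rfl⟩, ?_⟩
    intro i hi hd
    exact hun _ ((Inst.mem_crossing hD hb₃).1 (hget i hi)).1 hd

/-- Each `p` in the cell has its own mark `c * D.nP + p + 1` for the table `T₃`. Marks increase, so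
that the table is empty at the beginning of each sweep. -/
theorem run_sweepAll (hroom : Roomy w (l + 1)) (hsl : Slots vp vr α β) (hD : D.Valid l)
    (henv : Env w l D vp vr α β s) (has : ∀ j ∈ as, j < 6) (has4 : as.length = 4)
    (hb : b₁ < 6 ∧ b₂ < 6 ∧ b₃ < 6) (hT₂ : 1000 ≤ T₂) (hT₃ : 1000 ≤ T₃) (hT : T₂ ≠ T₃)
    (hc : s.words vCell 0 = c) (hcw : (c + 1) * D.nP < 2 ^ w) (hNP : D.nP < 2 ^ w)
    (hmark : s.words vMarkC 0 = c + 1)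
    (hlen : s.words vLen 0 = (D.crossing as b₃ c D.nQ).length)
    (hlst : ∀ i q, (D.crossing as b₃ c D.nQ)[i]? = some q → s.words aLst i = q)
    (htab : Tab s T₂ (l + 1) 3 (c + 1) (D.freeSet as b₁ b₂ b₃ c D.nR))
    (hfresh : ∀ k, s.words T₃ k ≤ c * D.nP) :
    Run w (sweepAll vp α as b₁ b₂ b₃ T₂ T₃) s (fun t s' =>
      t ≤ D.sweepsTime l as c + D.nP * 280 + 20 ∧
      (s'.words vAns 0 = 0 ∨ s'.words vAns 0 = s.words vAns 0) ∧
      (s'.words vAns 0 = 0 ↔ s.words vAns 0 = 0 ∨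
        ∃ p < D.nP, D.InCell as c p ∧ ∃ r < D.nR, D.Uncovered as b₁ b₂ b₃ p r) ∧
      ∀ k, s'.words T₃ k ≤ (c + 1) * D.nP) := by
  classical
  have hsize := hD.size
  have hleafw := hroom.leaf
  have hone := hroom.lit (n := 1) (by omega)
  set C := D.crossing as b₃ c D.nQ with hC
  have hClen : C.length ≤ 4 * D.B := has4 ▸ Inst.length_crossing_le hD hb.2.2 has
  have hCQ : C.length ≤ D.nQ := by
    have : C.length ≤ ((List.range D.nQ).map (D.ord b₃)).length := List.length_filter_le _ _
    simpa using this
  have hget : ∀ i (hi : i < C.length), C.getD i 0 = C[i] := fun i hi => List.getD_eq_getElem _ _ hi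
  have hmul : (c + 1) * D.nP = c * D.nP + D.nP := Nat.succ_mul _ _
  let W : ℕ → Prop := fun a => (60 ≤ a ∧ a ≤ 64) ∨ (70 ≤ a ∧ a ≤ 73) ∨ (80 ≤ a ∧ a ≤ 85) ∨
    a = vMarkP ∨ a = vP ∨ a = vIx ∨ a = vQ ∨ a = vAns ∨ a = T₃
  refine (Run.forUp (N := D.nP)
    (fun k _ s₁ => (∀ a, ¬ W a → s₁.words a = s.words a) ∧
      (s₁.words vAns 0 = 0 ∨ s₁.words vAns 0 = s.words vAns 0) ∧
      (s₁.words vAns 0 = 0 ↔ s.words vAns 0 = 0 ∨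
        ∃ p < k, D.InCell as c p ∧ ∃ r < D.nR, D.Uncovered as b₁ b₂ b₃ p r) ∧
      ∀ i, s₁.words T₃ i ≤ c * D.nP + k)
    -- Only the elements of the cell cost a sweep.
    (fun p => (if D.InCell as c p then sweepTime l (4 * D.B) else 0) + 250) (φ₀ := 0)
    hNP ?_ ?_ ?_ ?_ ?_).mono ?_
  · rintro ((h | h) | h)
    · rw [writes_assign] at h; omega
    · have := writes_sweep h; omega
    · exact h
  · rintro k φ s₁ ⟨hfr, -⟩
    have := hsl.vp
    rw [eval_var, hfr _ (by simp only [W]; omega), henv.nP]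
  · rintro k φ s₁ v ⟨hfr, h1, h2, h3⟩
    refine ⟨fun a ha => ?_, ?_, ?_, ?_⟩
    · rw [words_setWord_of_ne _ _ _ (by simp only [W] at ha; omega), hfr a ha]
    · rwa [words_setWord_of_ne _ _ _ (by decide)]
    · rwa [words_setWord_of_ne _ _ _ (by decide)]
    · rwa [words_setWord_of_ne _ _ _ (by omega)]
  · exact ⟨fun _ _ => rfl, Or.inr rfl, by simp, hfresh⟩
  · rintro k φ s₁ hk ⟨hfr, h1, h2, h3⟩ hik
    have henv1 : Env w l D vp vr α β s₁ := henv.congr hsl (fun a ha1 ha2 => hfr a (by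
      simp only [W]; omega))
    have hcell := holds_cellTest (c := c) henv1 has hk hik (by
      rw [hfr _ (by simp only [W]; omega)]; exact hc)
    have hcost := (cost_tests (α := α) has4).2.2
    refine Run.cond (fun hb' => Run.seq (Run.assign ?_)) (fun hb' => Run.nop ⟨0, ?_, ?_⟩)
    · rw [hcell] at hb'
      have hlt : c * D.nP < 2 ^ w := by omega
      have hvp' := hsl.vp
      have hev : (WExp.add (.add (.mul (var vCell) (var vp)) (var vP)) (.lit 1)).eval w s₁ =
          c * D.nP + k + 1 := by
        simp only [WExp.eval, eval_var, hik, hone, henv1.nP]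
        rw [hfr vCell (by simp only [W]; omega), hc, Nat.mod_eq_of_lt hlt,
          Nat.mod_eq_of_lt (show c * D.nP + k < 2 ^ w by omega), Nat.mod_eq_of_lt (by omega)]
      rw [hev]
      set s₂ := s₁.setWord vMarkP 0 (c * D.nP + k + 1) with hs₂
      have fr2 : ∀ a, a ≠ vMarkP → s₂.words a = s₁.words a := fun a ha =>
        words_setWord_of_ne _ _ _ ha
      have fr2' : ∀ a, ¬ W a → s₂.words a = s.words a := fun a ha => by
        rw [fr2 a (by simp only [W] at ha; omega), hfr a ha]
      have henv2 : Env w l D vp vr α β s₂ := henv1.congr hsl (fun a ha1 ha2 => fr2 a (by omega))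
      have hpw := Inst.pairwise_crossing (D := D) (as := as) (c := c) hD hb.2.2
      refine (run_sweep (g₂ := c + 1) (g₃ := c * D.nP + k + 1) (m := C.length) (p := k)
        (lst := fun i => C.getD i 0) (RS := D.freeSet as b₁ b₂ b₃ c D.nR)
        hroom hsl hD henv2 has has4 hb hT₂ hT₃ hT hk (by rw [fr2 _ (by omega), hik])
        (by rw [fr2' _ (by simp only [W]; omega), hlen]) (by omega) ?_ ?_ ?_
        (htab.congr (fr2' _ (by simp only [W]; omega)))
        (by rw [fr2' _ (by simp only [W]; omega), hmark])
        (by simp [hs₂, words_setWord]) ?_ ?_).frame.mono ?_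
      · intro i hi
        rw [fr2' _ (by simp only [W]; omega), hget i hi]
        exact hlst i _ (List.getElem?_eq_getElem hi)
      · intro i hi
        rw [hget i hi]
        exact ((Inst.mem_crossing hD hb.2.2).1 (List.getElem_mem hi)).1
      · intro i i' hii hi'
        rw [hget i (by omega), hget i' hi']
        rcases hii.lt_or_eq with h | rfl
        · exact (List.pairwise_iff_getElem.1 hpw i i' (hii.trans_lt hi') hi' h).le
        · exact le_rfl
      · intro i
        rw [fr2 _ (by omega)]
        have := h3 i
        omega
      · rintro r₁ r₂ r₃ ⟨r, hr, -, he⟩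
        simp only [List.cons.injEq, and_true] at he
        obtain ⟨rfl, rfl, rfl⟩ := he
        exact ⟨hD.cR_le _ hb.1 r hr, hD.cR_le _ hb.2.1 r hr, hD.cR_le _ hb.2.2 r hr⟩
      · rintro t s₃ ⟨⟨ht, ha1, ha2, h3'⟩, hfr3⟩
        rw [fr2 _ (by decide)] at ha1 ha2
        refine ⟨0, ?_, ?_, ?_, ?_, ?_⟩
        · have := sweepTime_mono (l := l) hClen
          rw [if_pos hb']
          simp only [WExp.cost, cost_var]
          omega
        · intro a ha
          rw [hfr3 a (fun h => ha (by have := writes_sweep h; simp only [W]; omega)), fr2' a ha]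
        · rcases ha1 with h | h
          · exact Or.inl h
          · rw [h]; exact h1
        · rw [ha2, h2, hb'.uncovered_iff hD hb.2.2, or_assoc]
          refine or_congr_right ?_
          simp only [Nat.lt_succ_iff_lt_or_eq, or_and_right, exists_or, exists_eq_left]
          exact or_congr_right (by simp [hb'])
        · intro i
          have := h3' i
          omega
    · simp only [if_neg (show ¬ D.InCell as c k from hcell.not.1 hb')]; omega
    · rw [hcell] at hb'
      refine ⟨hfr, h1, ?_, fun i => (h3 i).trans (by omega)⟩
      rw [h2]
      refine or_congr_right ?_
      simp only [Nat.lt_succ_iff_lt_or_eq, or_and_right, exists_or, exists_eq_left]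
      simp [hb']
  · rintro t s' ⟨φ', ht, hfr, h1, h2, h3⟩
    refine ⟨?_, h1, h2, fun k => by rw [hmul]; exact h3 k⟩
    simp only [cost_var, Finset.sum_add_distrib, Finset.sum_const, Finset.card_range,
      smul_eq_mul] at ht
    simp only [Inst.sweepsTime]
    omega

/-- A bound for the time of a search in one cell, without the sweeps. -/
def cellTime (l n : ℕ) : ℕ := n * (2 * tabTime (l + 1) 3 17 + 700) + 100

/-- The search in cell `c` with the mark `c + 1` decides whether some pair with its first element in
this cell is uncovered, and leaves the tables ready for the next cell. -/
theorem run_searchCell (hroom : Roomy w (l + 1)) (hsl : Slots vp vr α β) (hD : D.Valid l)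
    (henv : Env w l D vp vr α β s) (has : ∀ j ∈ as, j < 6) (has4 : as.length = 4)
    (hb : b₁ < 6 ∧ b₂ < 6 ∧ b₃ < 6) (hT₁ : 1000 ≤ T₁) (hT₂ : 1000 ≤ T₂) (hT₃ : 1000 ≤ T₃)
    (hT : T₁ ≠ T₂ ∧ T₁ ≠ T₃ ∧ T₂ ≠ T₃)
    (hc : s.words vCell 0 = c) (hcw : (c + 1) * D.nP < 2 ^ w) (hcw' : c + 1 < 2 ^ w)
    (hNP : D.nP < 2 ^ w) (hNR : D.nR < 2 ^ w)
    (hf₁ : ∀ k, s.words T₁ k ≤ c) (hf₂ : ∀ k, s.words T₂ k ≤ c)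
    (hf₃ : ∀ k, s.words T₃ k ≤ c * D.nP) :
    Run w (searchCell vp vr α β as b₁ b₂ b₃ T₁ T₂ T₃) s (fun t s' =>
      t ≤ cellTime l (D.nP + D.nQ + D.nR) + D.sweepsTime l as c ∧
      (s'.words vAns 0 = 0 ∨ s'.words vAns 0 = s.words vAns 0) ∧
      (s'.words vAns 0 = 0 ↔ s.words vAns 0 = 0 ∨
        ∃ p < D.nP, D.InCell as c p ∧ ∃ r < D.nR, D.Uncovered as b₁ b₂ b₃ p r) ∧
      (∀ k, s'.words T₁ k ≤ c + 1) ∧ (∀ k, s'.words T₂ k ≤ c + 1) ∧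
      ∀ k, s'.words T₃ k ≤ (c + 1) * D.nP) := by
  have hone := hroom.lit (n := 1) (by omega)
  refine Run.seq (Run.assign ?_)
  have hev : (WExp.add (var vCell) (.lit 1)).eval w s = c + 1 := by
    simp only [WExp.eval, eval_var, hc, hone]; exact Nat.mod_eq_of_lt hcw'
  rw [hev]
  set s₁ := s.setWord vMarkC 0 (c + 1) with hs₁
  have fr1 : ∀ a, a ≠ vMarkC → s₁.words a = s.words a := fun a ha => words_setWord_of_ne _ _ _ ha
  have hm1 : s₁.words vMarkC 0 = c + 1 := by simp [hs₁, words_setWord]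
  have henv1 : Env w l D vp vr α β s₁ := henv.congr hsl (fun a ha1 ha2 => fr1 a (by omega))
  refine Run.seq ((run_loadUnder hroom hsl hD henv1 has has4 hb hT₁
    (by rw [fr1 _ (by decide), hc]) hm1
    (fun k => by rw [fr1 _ (by omega)]; exact hf₁ k)).frame.mono ?_)
  rintro t₂ s₂ ⟨⟨ht₂, htab₁⟩, hfr2⟩
  have fr2 : ∀ a, ¬ ((60 ≤ a ∧ a ≤ 64) ∨ a = vQ ∨ a = T₁) → s₂.words a = s₁.words a :=
    fun a ha => hfr2 a (fun h => ha (writes_loadUnder h))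
  have henv2 : Env w l D vp vr α β s₂ := henv1.congr hsl (fun a ha1 ha2 => fr2 a (by omega))
  refine Run.seq ((run_loadFree hroom hsl hD henv2 hb hT₁ hT₂ hT.1 hNR
    (by rw [fr2 _ (by omega), hm1])
    (fun k => by rw [fr2 _ (by omega), fr1 _ (by omega)]; exact hf₂ k) htab₁).frame.mono ?_)
  rintro t₃ s₃ ⟨⟨ht₃, htab₂⟩, hfr3⟩
  have fr3 : ∀ a, ¬ ((60 ≤ a ∧ a ≤ 64) ∨ a = vR ∨ a = T₂) → s₃.words a = s₂.words a :=
    fun a ha => hfr3 a (fun h => ha (writes_loadFree h))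
  have henv3 : Env w l D vp vr α β s₃ := henv2.congr hsl (fun a ha1 ha2 => fr3 a (by omega))
  refine Run.seq ((run_listCrossing hroom hsl hD henv3 has has4 hb.2.2
    (by rw [fr3 _ (by omega), fr2 _ (by omega), fr1 _ (by decide), hc])).frame.mono ?_)
  rintro t₄ s₄ ⟨⟨ht₄, hlen, hlst⟩, hfr4⟩
  have fr4 : ∀ a, ¬ (a = vQ ∨ a = vK ∨ a = aLst ∨ a = vLen) → s₄.words a = s₃.words a :=
    fun a ha => hfr4 a (fun h => ha (writes_listCrossing h))
  have henv4 : Env w l D vp vr α β s₄ := henv3.congr hsl (fun a ha1 ha2 => fr4 a (by omega))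
  refine ((run_sweepAll hroom hsl hD henv4 has has4 hb hT₂ hT₃ hT.2.2
    (by rw [fr4 _ (by omega), fr3 _ (by omega), fr2 _ (by omega), fr1 _ (by decide), hc])
    hcw hNP (by rw [fr4 _ (by omega), fr3 _ (by omega), fr2 _ (by omega), hm1]) hlen hlst
    (htab₂.congr (fr4 _ (by omega)))
    (fun k => by
      rw [fr4 _ (by omega), fr3 _ (by omega), fr2 _ (by omega), fr1 _ (by omega)]
      exact hf₃ k)).frame.mono ?_)
  rintro t₅ s₅ ⟨⟨ht₅, ha1, ha2, h3⟩, hfr5⟩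
  have fr5 : ∀ a, ¬ ((60 ≤ a ∧ a ≤ 64) ∨ (70 ≤ a ∧ a ≤ 73) ∨ (80 ≤ a ∧ a ≤ 92) ∨ a = vAns ∨
      a = T₃) → s₅.words a = s₄.words a := fun a ha => hfr5 a (fun h => ha (writes_sweepAll h))
  have hans : s₄.words vAns = s.words vAns := by
    rw [fr4 _ (by omega), fr3 _ (by omega), fr2 _ (by omega), fr1 _ (by decide)]
  rw [hans] at ha1 ha2
  refine ⟨?_, ha1, ha2, fun k => ?_, fun k => ?_, h3⟩
  · simp only [cellTime, WExp.cost, cost_var, add_mul]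
    have h1 := Nat.mul_le_mul_left D.nQ
      (show tabTime (l + 1) 3 17 + 120 + 250 ≤ 2 * tabTime (l + 1) 3 17 + 700 by omega)
    have h2 := Nat.mul_le_mul_left D.nR
      (show 2 * tabTime (l + 1) 3 17 + 40 ≤ 2 * tabTime (l + 1) 3 17 + 700 by omega)
    have h4 := Nat.mul_le_mul_left D.nP
      (show 280 ≤ 2 * tabTime (l + 1) 3 17 + 700 by omega)
    rw [Nat.mul_add D.nQ (tabTime (l + 1) 3 17 + 120)] at h1
    omega
  · rw [fr5 _ (by omega), fr4 _ (by omega), fr3 _ (by omega)]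
    exact htab₁.le k
  · rw [fr5 _ (by omega), fr4 _ (by omega)]
    exact htab₂.le k

end Cell

/-! ### All cells and all splittings of the coordinates -/

notation "vMin" => 105

/-- Search for an uncovered pair in all cells, with fresh tables from `T` on. -/
def searchCells (vp vr α β : ℕ) (as : List ℕ) (b₁ b₂ b₃ T : ℕ) : Cmd :=
  forUp vCell (.mul (.mul (var vBase) (var vBase)) (.mul (var vBase) (var vBase)))
    (searchCell vp vr α β as b₁ b₂ b₃ T (T + 1) (T + 2))

theorem writes_searchCells {vp vr α β : ℕ} {as : List ℕ} {b₁ b₂ b₃ T a : ℕ}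
    (h : (searchCells vp vr α β as b₁ b₂ b₃ T).Writes a) :
    (60 ≤ a ∧ a ≤ 110) ∨ a = vAns ∨ (T ≤ a ∧ a < T + 3) := by
  rw [searchCells, writes_forUp] at h
  rcases h with h | h
  · omega
  · have := writes_searchCell h; omega

theorem Inst.inCell_iff {D : Inst} {a₀ a₁ a₂ a₃ c p : ℕ} : D.InCell [a₀, a₁, a₂, a₃] c p ↔
    D.cP a₀ p / D.B = c % D.b ∧ D.cP a₁ p / D.B = c / D.b % D.b ∧
      D.cP a₂ p / D.B = c / D.b / D.b % D.b ∧ D.cP a₃ p / D.B = c / D.b / D.b / D.b % D.b := by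
  simp [Inst.InCell, digit]

/-- Each element lies in some cell. -/
theorem Inst.exists_inCell {D : Inst} {l : ℕ} (hD : D.Valid l) {as : List ℕ}
    (has : ∀ j ∈ as, j < 6) (has4 : as.length = 4) {p : ℕ} (hp : p < D.nP) :
    ∃ c < D.b ^ 4, D.InCell as c p := by
  match as, has4, has with
  | [a₀, a₁, a₂, a₃], _, has =>
    have hs : ∀ j ∈ [a₀, a₁, a₂, a₃], D.cP j p / D.B < D.b := fun j hj =>
      (Nat.div_lt_iff_lt_mul hD.width).2 ((hD.cP_le j (has j hj) p hp).trans_lt hD.slab)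
    simp only [List.mem_cons, List.not_mem_nil, or_false, forall_eq_or_imp, forall_eq] at hs
    obtain ⟨h₀, h₁, h₂, h₃⟩ := hs
    set d₀ := D.cP a₀ p / D.B
    set d₁ := D.cP a₁ p / D.B
    set d₂ := D.cP a₂ p / D.B
    set d₃ := D.cP a₃ p / D.B
    have hb : 0 < D.b := Nat.zero_lt_of_lt h₀
    have hlt : ∀ {x y M : ℕ}, x < D.b → y < M → x + D.b * y < D.b * M := by
      intro x y M hx hy
      calc x + D.b * y < D.b + D.b * y := by omega
        _ = D.b * (y + 1) := by ring
        _ ≤ D.b * M := Nat.mul_le_mul_left _ hy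
    have hmod : ∀ {x : ℕ} (y : ℕ), x < D.b → (x + D.b * y) % D.b = x := fun y hx => by
      rw [Nat.add_mul_mod_self_left, Nat.mod_eq_of_lt hx]
    have hdiv : ∀ {x : ℕ} (y : ℕ), x < D.b → (x + D.b * y) / D.b = y := fun y hx => by
      rw [Nat.add_mul_div_left _ _ hb, Nat.div_eq_of_lt hx, zero_add]
    refine ⟨d₀ + D.b * (d₁ + D.b * (d₂ + D.b * d₃)), ?_, Inst.inCell_iff.2 ?_⟩
    · have := hlt h₀ (hlt h₁ (hlt h₂ h₃))
      calc _ < _ := this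
        _ = D.b ^ 4 := by ring
    · rw [hdiv _ h₀, hdiv _ h₁, hdiv _ h₂, hmod _ h₀, hmod _ h₁, hmod _ h₂, Nat.mod_eq_of_lt h₃]
      exact ⟨rfl, rfl, rfl, rfl⟩

/-- Each element lies in at most one cell. -/
theorem Inst.InCell.unique {D : Inst} {as : List ℕ} (has4 : as.length = 4) {c c' p : ℕ}
    (hc : c < D.b ^ 4) (hc' : c' < D.b ^ 4) (h : D.InCell as c p) (h' : D.InCell as c' p) :
    c = c' := by
  match as, has4 with
  | [a₀, a₁, a₂, a₃], _ =>
    rw [Inst.inCell_iff] at h h'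
    have key : ∀ {c : ℕ}, c < D.b ^ 4 → c / D.b / D.b / D.b < D.b := by
      intro c hc
      rcases Nat.eq_zero_or_pos D.b with hb | hb
      · simp [hb] at hc
      · rw [Nat.div_div_eq_div_mul, Nat.div_div_eq_div_mul, Nat.div_lt_iff_lt_mul (by positivity)]
        calc c < D.b ^ 4 := hc
          _ = _ := by ring
    rw [Nat.mod_eq_of_lt (key hc)] at h
    rw [Nat.mod_eq_of_lt (key hc')] at h'
    have step : ∀ {x y : ℕ}, x / D.b = y / D.b → x % D.b = y % D.b → x = y := by
      intro x y h1 h2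
      rw [← Nat.div_add_mod x D.b, ← Nat.div_add_mod y D.b, h1, h2]
    exact step (step (step (h.2.2.2.symm.trans h'.2.2.2) (h.2.2.1.symm.trans h'.2.2.1))
      (h.2.1.symm.trans h'.2.1)) (h.1.symm.trans h'.1)

/-- Each element is swept in one cell only. -/
theorem Inst.sum_sweepsTime_le {D : Inst} {l : ℕ} {as : List ℕ} (has4 : as.length = 4) :
    ∑ c ∈ Finset.range (D.b ^ 4), D.sweepsTime l as c ≤ D.nP * sweepTime l (4 * D.B) := by
  classical
  simp only [Inst.sweepsTime]
  rw [Finset.sum_comm]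
  refine (Finset.sum_le_card_nsmul _ _ (sweepTime l (4 * D.B)) fun p _ => ?_).trans (by simp)
  rw [← Finset.sum_filter, Finset.sum_const, smul_eq_mul]
  have : ((Finset.range (D.b ^ 4)).filter fun c => D.InCell as c p).card ≤ 1 := by
    refine Finset.card_le_one.2 fun c hc c' hc' => ?_
    simp only [Finset.mem_filter, Finset.mem_range] at hc hc'
    exact hc.2.unique has4 hc.1 hc'.1 hc'.2
  simpa using Nat.mul_le_mul_right (sweepTime l (4 * D.B)) this

/-- A bound for the time of a search in all cells. -/
def Inst.cellsTime (D : Inst) (l : ℕ) : ℕ :=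
  D.b ^ 4 * (cellTime l (D.nP + D.nQ + D.nR) + 22) + (D.nP + D.nR) * sweepTime l (4 * D.B) + 22

/-- Words are long enough for the marks of the tables. -/
def Inst.Fits (D : Inst) (w : ℕ) : Prop := (D.b ^ 4 + 1) * (D.nP + D.nR + 1) < 2 ^ w

section Search

variable {w l vp vr α β b₁ b₂ b₃ T : ℕ} {D : Inst} {as : List ℕ} {s : Store}

/-- The search in all cells decides whether there is an uncovered pair. -/
theorem run_searchCells (hroom : Roomy w (l + 1)) (hsl : Slots vp vr α β) (hD : D.Valid l)
    (hfit : D.Fits w) (henv : Env w l D vp vr α β s) (has : ∀ j ∈ as, j < 6)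
    (has4 : as.length = 4) (hb : b₁ < 6 ∧ b₂ < 6 ∧ b₃ < 6) (hT : 1000 ≤ T)
    (hz : ∀ a, T ≤ a → ∀ k, s.words a k = 0) :
    Run w (searchCells vp vr α β as b₁ b₂ b₃ T) s (fun t s' =>
      t ≤ D.cellsTime l ∧ (s'.words vAns 0 = 0 ∨ s'.words vAns 0 = s.words vAns 0) ∧
      (s'.words vAns 0 = 0 ↔ s.words vAns 0 = 0 ∨
        ∃ p < D.nP, ∃ r < D.nR, D.Uncovered as b₁ b₂ b₃ p r)) := by
  have hfit' : D.b ^ 4 * D.nP + D.b ^ 4 * D.nR + D.b ^ 4 + (D.nP + D.nR + 1) < 2 ^ w := by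
    have h := hfit
    rw [Inst.Fits] at h
    calc _ = (D.b ^ 4 + 1) * (D.nP + D.nR + 1) := by ring
      _ < _ := h
  have hW : ∀ {a : ℕ}, (searchCell vp vr α β as b₁ b₂ b₃ T (T + 1) (T + 2)).Writes a →
      (60 ≤ a ∧ a ≤ 94) ∨ a = aLst ∨ a = vLen ∨ a = vAns ∨ (T ≤ a ∧ a ≤ T + 2) := fun h => by
    have := writes_searchCell h; omega
  refine (Run.forUp (N := D.b ^ 4)
    (fun c _ s₁ => Env w l D vp vr α β s₁ ∧
      (s₁.words vAns 0 = 0 ∨ s₁.words vAns 0 = s.words vAns 0) ∧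
      (s₁.words vAns 0 = 0 ↔ s.words vAns 0 = 0 ∨
        ∃ c' < c, ∃ p < D.nP, D.InCell as c' p ∧ ∃ r < D.nR, D.Uncovered as b₁ b₂ b₃ p r) ∧
      (∀ k, s₁.words T k ≤ c) ∧ (∀ k, s₁.words (T + 1) k ≤ c) ∧
      ∀ k, s₁.words (T + 2) k ≤ c * D.nP)
    (fun c => cellTime l (D.nP + D.nQ + D.nR) + D.sweepsTime l as c) (φ₀ := 0)
    (by omega) ?_ ?_ ?_ ?_ ?_).mono ?_
  · intro h
    have := hW h
    omega
  · rintro c φ s₁ ⟨henv1, -⟩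
    have hpow : D.b * D.b * (D.b * D.b) = D.b ^ 4 := by ring
    have h2 : D.b * D.b ≤ D.b ^ 4 := by
      rw [← hpow]
      rcases Nat.eq_zero_or_pos (D.b * D.b) with h | h
      · simp [h]
      · exact Nat.le_mul_of_pos_right _ h
    simp only [WExp.eval, eval_var, henv1.b]
    rw [Nat.mod_eq_of_lt (show D.b * D.b < 2 ^ w by omega), hpow, Nat.mod_eq_of_lt (by omega)]
  · rintro c φ s₁ v ⟨henv1, h1, h2, h3, h4, h5⟩
    refine ⟨henv1.congr hsl fun a ha _ => words_setWord_of_ne _ _ _ (by omega), ?_, ?_, ?_, ?_, ?_⟩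
    · rwa [words_setWord_of_ne _ _ _ (by decide)]
    · rwa [words_setWord_of_ne _ _ _ (by decide)]
    · rwa [words_setWord_of_ne _ _ _ (by omega)]
    · rwa [words_setWord_of_ne _ _ _ (by omega)]
    · rwa [words_setWord_of_ne _ _ _ (by omega)]
  · refine ⟨henv, Or.inr rfl, by simp, fun k => ?_, fun k => ?_, fun k => ?_⟩
    · simp [hz T le_rfl k]
    · simp [hz (T + 1) (by omega) k]
    · simp [hz (T + 2) (by omega) k]
  · rintro c φ s₁ hc ⟨henv1, h1, h2, h3, h4, h5⟩ hic
    have hc1 : (c + 1) * D.nP ≤ D.b ^ 4 * D.nP := Nat.mul_le_mul_right _ hc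
    refine (run_searchCell hroom hsl hD henv1 has has4 hb hT (by omega) (by omega) (by omega) hic
      (by omega) (by omega) (by omega) (by omega) h3 h4 h5).frame.mono ?_
    rintro t s₂ ⟨⟨ht, ha1, ha2, hf⟩, hfr⟩
    refine ⟨0, by omega, henv1.congr hsl fun a ha hne => hfr a fun h => ?_, ?_, ?_, hf⟩
    · have := hW h; omega
    · rcases ha1 with h | h
      · exact Or.inl h
      · rw [h]; exact h1
    · rw [ha2, h2, or_assoc]
      refine or_congr_right ?_
      simp only [Nat.lt_succ_iff_lt_or_eq, or_and_right, exists_or, exists_eq_left]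
  · rintro t s' ⟨φ', ht, -, h1, h2, -⟩
    refine ⟨?_, h1, ?_⟩
    · have hs := Inst.sum_sweepsTime_le (D := D) (l := l) has4
      have hm : D.nP * sweepTime l (4 * D.B) ≤ (D.nP + D.nR) * sweepTime l (4 * D.B) :=
        Nat.mul_le_mul_right _ (by omega)
      simp only [Finset.sum_add_distrib, Finset.sum_const, Finset.card_range, smul_eq_mul,
        WExp.cost, cost_var] at ht
      simp only [Inst.cellsTime, Nat.mul_add (D.b ^ 4)]
      omega
    · rw [h2]
      refine or_congr_right ⟨?_, ?_⟩
      · rintro ⟨c, -, p, hp, -, hr⟩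
        exact ⟨p, hp, hr⟩
      · rintro ⟨p, hp, hr⟩
        obtain ⟨c, hc, hin⟩ := Inst.exists_inCell hD has has4 hp
        exact ⟨c, hc, p, hp, hin, hr⟩

/-- Search for all given splittings `(as, b₁, b₂, b₃)` of the coordinates. -/
def searchTuples (vp vr α β : ℕ) : ℕ → List (List ℕ × ℕ × ℕ × ℕ) → Cmd
  | _, [] => .nop
  | T, (as, b₁, b₂, b₃) :: ts =>
    .seq (searchCells vp vr α β as b₁ b₂ b₃ T) (searchTuples vp vr α β (T + 3) ts)

theorem writes_searchTuples {vp vr α β a : ℕ} : ∀ {T : ℕ} {ts : List (List ℕ × ℕ × ℕ × ℕ)},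
    (searchTuples vp vr α β T ts).Writes a →
      (60 ≤ a ∧ a ≤ 110) ∨ a = vAns ∨ (T ≤ a ∧ a < T + 3 * ts.length)
  | _, [], h => h.elim
  | T, (as, b₁, b₂, b₃) :: ts, h => by
    rw [List.length_cons]
    rcases h with h | h
    · have := writes_searchCells h; omega
    · have := writes_searchTuples h; omega

/-- Four coordinates and three coordinates. -/
def IsTuple (x : List ℕ × ℕ × ℕ × ℕ) : Prop :=
  (∀ j ∈ x.1, j < 6) ∧ x.1.length = 4 ∧ x.2.1 < 6 ∧ x.2.2.1 < 6 ∧ x.2.2.2 < 6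

theorem run_searchTuples (hroom : Roomy w (l + 1)) (hsl : Slots vp vr α β) (hD : D.Valid l)
    (hfit : D.Fits w) : ∀ (ts : List (List ℕ × ℕ × ℕ × ℕ)) (T : ℕ) (s : Store),
    (∀ x ∈ ts, IsTuple x) → Env w l D vp vr α β s → 1000 ≤ T →
    (∀ a, T ≤ a → ∀ k, s.words a k = 0) →
    Run w (searchTuples vp vr α β T ts) s (fun t s' =>
      t ≤ ts.length * D.cellsTime l + 1 ∧
      (s'.words vAns 0 = 0 ∨ s'.words vAns 0 = s.words vAns 0) ∧
      (s'.words vAns 0 = 0 ↔ s.words vAns 0 = 0 ∨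
        ∃ x ∈ ts, ∃ p < D.nP, ∃ r < D.nR, D.Uncovered x.1 x.2.1 x.2.2.1 x.2.2.2 p r))
  | [], T, s, _, _, _, _ => Run.nop ⟨by simp, Or.inr rfl, by simp⟩
  | (as, b₁, b₂, b₃) :: ts, T, s, hts, henv, hT, hz => by
    obtain ⟨has, has4, hb⟩ := hts _ List.mem_cons_self
    refine Run.seq ((run_searchCells hroom hsl hD hfit henv has has4 hb hT hz).frame.mono ?_)
    rintro t₁ s₁ ⟨⟨ht₁, h1, h2⟩, hfr⟩
    have fr : ∀ a, ¬ ((60 ≤ a ∧ a ≤ 110) ∨ a = vAns ∨ (T ≤ a ∧ a < T + 3)) →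
        s₁.words a = s.words a := fun a ha => hfr a fun h => ha (writes_searchCells h)
    refine (run_searchTuples hroom hsl hD hfit ts (T + 3) s₁
      (fun x hx => hts x (List.mem_cons_of_mem _ hx))
      (henv.congr hsl fun a ha hne => fr a (by omega)) (by omega)
      (fun a ha k => by rw [fr a (by omega), hz a (by omega)])).mono ?_
    rintro t₂ s₂ ⟨ht₂, h3, h4⟩
    refine ⟨?_, ?_, ?_⟩
    · rw [List.length_cons, Nat.succ_mul]; omega
    · rcases h3 with h | h
      · exact Or.inl h
      · rw [h]; exact h1
    · rw [h4, h2, or_assoc]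
      simp only [List.mem_cons, exists_eq_or_imp]

end Search

/-! ### Deciding a ranked instance -/

/-- No `q` is below both `p` and `r` in all coordinates. -/
def Inst.Bad (D : Inst) (p r : ℕ) : Prop :=
  ∀ q < D.nQ, ¬ ((∀ j < 6, D.pos j q < D.cP j p) ∧ ∀ j < 6, D.pos j q < D.cR j r)

/-- No `q` is below `p` in all coordinates and below `r` in the coordinate `j`. -/
def Inst.NearlyBad (D : Inst) (j p r : ℕ) : Prop :=
  ∀ q < D.nQ, ¬ ((∀ i < 6, D.pos i q < D.cP i p) ∧ D.pos j q < D.cR j r)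

/-- The instance with the outer sets interchanged. -/
def Inst.swap (D : Inst) : Inst := { D with nP := D.nR, nR := D.nP, cP := D.cR, cR := D.cP }

theorem Inst.Valid.swap {D : Inst} {l : ℕ} (h : D.Valid l) : D.swap.Valid l :=
  ⟨h.size, h.pos_lt, h.ord_lt, h.pos_ord, h.ord_pos, h.cR_le, h.cP_le, h.width, h.slab⟩

theorem Inst.Fits.swap {D : Inst} {w : ℕ} (h : D.Fits w) : D.swap.Fits w := by
  unfold Inst.Fits at h ⊢
  simpa only [Inst.swap, add_comm D.nR] using h

theorem Inst.bad_swap {D : Inst} {p r : ℕ} : D.swap.Bad r p ↔ D.Bad p r :=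
  forall₂_congr fun _ _ => not_congr and_comm

theorem Env.swap {w l vp vr α β : ℕ} {D : Inst} {s : Store} (h : Env w l D vp vr α β s) :
    Env w l D.swap vr vp β α s :=
  ⟨h.nR, h.nQ, h.nP, h.b, h.B, h.leaf, h.mul, h.half, h.pos, h.ord, h.cR, h.cP⟩

theorem Slots.swap {vp vr α β : ℕ} (h : Slots vp vr α β) : Slots vr vp β α :=
  ⟨h.vr, h.vp, h.β, h.α⟩

/-- The splittings of the coordinates for which the search is done. Most of them are superfluous,
but no splitting leads to a wrong answer. -/
def splittings : List (List ℕ × ℕ × ℕ × ℕ) :=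
  (List.range 6 ×ˢ List.range 6 ×ˢ List.range 6 ×ˢ List.range 6 ×ˢ List.range 6 ×ˢ List.range 6 ×ˢ
    List.range 6).map fun x => ([x.1, x.2.1, x.2.2.1, x.2.2.2.1], x.2.2.2.2)

theorem mem_splittings {x : List ℕ × ℕ × ℕ × ℕ} : x ∈ splittings ↔ IsTuple x := by
  obtain ⟨as, b₁, b₂, b₃⟩ := x
  simp only [splittings, List.mem_map, Prod.exists, List.mem_product, List.mem_range,
    Prod.mk.injEq, IsTuple]
  constructor
  · rintro ⟨a₀, a₁, a₂, a₃, c₁, c₂, c₃, ⟨h₀, h₁, h₂, h₃, h₄⟩, rfl, rfl, rfl, rfl⟩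
    exact ⟨by simp [*], rfl, h₄⟩
  · rintro ⟨h, h4, hb⟩
    match as, h4, h with
    | [a₀, a₁, a₂, a₃], _, h =>
      simp only [List.mem_cons, List.not_mem_nil, or_false, forall_eq_or_imp, forall_eq] at h
      exact ⟨a₀, a₁, a₂, a₃, b₁, b₂, b₃, ⟨h.1, h.2.1, h.2.2.1, h.2.2.2, hb⟩, rfl, rfl, rfl, rfl⟩

/-- A set of at most `n` coordinates is contained in a list of `n` coordinates. -/
theorem exists_list_of_card_le {S : Finset ℕ} (hS : S ⊆ Finset.range 6) {n : ℕ} (hn : S.card ≤ n) :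
    ∃ as : List ℕ, as.length = n ∧ (∀ j ∈ as, j < 6) ∧ ∀ j ∈ S, j ∈ as := by
  refine ⟨S.toList ++ List.replicate (n - S.card) 0, by simp; omega, fun j hj => ?_, fun j hj => ?_⟩
  · rcases List.mem_append.1 hj with h | h
    · exact Finset.mem_range.1 (hS (Finset.mem_toList.1 h))
    · rw [List.eq_of_mem_replicate h]; decide
  · exact List.mem_append_left _ (Finset.mem_toList.2 hj)

/-- Every division of the coordinates into at most four and at most three is among the splittings.
-/
theorem exists_splitting {S S' : Finset ℕ} (hS : S ⊆ Finset.range 6) (hS' : S' ⊆ Finset.range 6)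
    (h4 : S.card ≤ 4) (h3 : S'.card ≤ 3) :
    ∃ x ∈ splittings, (∀ j ∈ S, j ∈ x.1) ∧ ∀ j ∈ S', j = x.2.1 ∨ j = x.2.2.1 ∨ j = x.2.2.2 := by
  obtain ⟨as, hl, has, hmem⟩ := exists_list_of_card_le hS h4
  obtain ⟨bs, hl', hbs, hmem'⟩ := exists_list_of_card_le hS' h3
  match bs, hl', hbs, hmem' with
  | [b₁, b₂, b₃], _, hbs, hmem' =>
    exact ⟨(as, b₁, b₂, b₃), mem_splittings.2 ⟨has, hl, hbs _ (by simp), hbs _ (by simp),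
      hbs _ (by simp)⟩, hmem, fun j hj => by simpa using hmem' j hj⟩

/-- An uncovered pair is found in one of the searches: the six coordinates are divided according to
which of `p` and `r` imposes the stronger condition. -/
theorem Inst.bad_iff {D : Inst} {p r : ℕ} : D.Bad p r ↔
    ((∃ j < 6, D.NearlyBad j p r) ∨
      ∃ x ∈ splittings, D.Uncovered x.1 x.2.1 x.2.2.1 x.2.2.2 p r) ∨
    (∃ j < 6, D.swap.NearlyBad j r p) ∨
      ∃ x ∈ splittings, D.swap.Uncovered x.1 x.2.1 x.2.2.1 x.2.2.2 r p := by
  have sound : ∀ {D : Inst} {p r : ℕ}, ((∃ j < 6, D.NearlyBad j p r) ∨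
      ∃ x ∈ splittings, D.Uncovered x.1 x.2.1 x.2.2.1 x.2.2.2 p r) → D.Bad p r := by
    rintro D p r (⟨j, hj, h⟩ | ⟨x, hx, h⟩) q hq ⟨h1, h2⟩
    · exact h q hq ⟨h1, h2 j hj⟩
    · obtain ⟨has, -, hb₁, hb₂, hb₃⟩ := mem_splittings.1 hx
      exact h q hq (fun j hj => h1 j (has j hj)) ⟨h2 _ hb₁, h2 _ hb₂, h2 _ hb₃⟩
  -- Completeness in case at least three conditions come from `p`.
  have complete : ∀ {D : Inst} {p r : ℕ} (I J : Finset ℕ), I ⊆ Finset.range 6 →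
      J ⊆ Finset.range 6 → J.card ≤ 3 → I.card ≤ 4 ∨ J.card ≤ 1 →
      (∀ j < 6, j ∈ I ∨ j ∈ J) →
      (∀ q < D.nQ, ¬ ((∀ j ∈ I, D.pos j q < D.cP j p) ∧ ∀ j ∈ J, D.pos j q < D.cR j r)) →
      (∃ j < 6, D.NearlyBad j p r) ∨
        ∃ x ∈ splittings, D.Uncovered x.1 x.2.1 x.2.2.1 x.2.2.2 p r := by
    intro D p r I J hI hJ h3 hor hIJ h
    rcases hor with h4 | h1
    · obtain ⟨x, hx, h1, h2⟩ := exists_splitting hI hJ h4 h3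
      refine Or.inr ⟨x, hx, fun q hq hd hr => h q hq ⟨fun j hj => hd j (h1 j hj), fun j hj => ?_⟩⟩
      rcases h2 j hj with rfl | rfl | rfl
      · exact hr.1
      · exact hr.2.1
      · exact hr.2.2
    · left
      rcases J.eq_empty_or_nonempty with rfl | ⟨j, hj⟩
      · exact ⟨0, by decide, fun q hq hd => h q hq
          ⟨fun i hi => hd.1 i (Finset.mem_range.1 (hI hi)), by simp⟩⟩
      · refine ⟨j, Finset.mem_range.1 (hJ hj), fun q hq hd => h q hq
          ⟨fun i hi => hd.1 i (Finset.mem_range.1 (hI hi)), fun i hi => ?_⟩⟩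
        rw [Finset.card_le_one.1 h1 i hi j hj]
        exact hd.2
  constructor
  · intro h
    -- `I` and `J` collect the coordinates in which `p`, respectively `r`, has the smaller count.
    set I := (Finset.range 6).filter fun j => D.cP j p ≤ D.cR j r with hI
    set J := (Finset.range 6).filter fun j => ¬ D.cP j p ≤ D.cR j r with hJ
    have hcard : I.card + J.card = 6 := by
      rw [hI, hJ, Finset.card_filter_add_card_filter_not, Finset.card_range]
    have hIJ : ∀ j < 6, j ∈ I ∨ j ∈ J := fun j hj => by simp [hI, hJ, hj]; omega
    have hno : ∀ q < D.nQ,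
        ¬ ((∀ j ∈ I, D.pos j q < D.cP j p) ∧ ∀ j ∈ J, D.pos j q < D.cR j r) := by
      rintro q hq ⟨h1, h2⟩
      refine h q hq ⟨fun j hj => ?_, fun j hj => ?_⟩
      · by_cases hle : D.cP j p ≤ D.cR j r
        · exact h1 j (by simp [hI, hj, hle])
        · have := h2 j (by simp [hJ, hj]; omega)
          omega
      · by_cases hle : D.cP j p ≤ D.cR j r
        · have := h1 j (by simp [hI, hj, hle])
          omega
        · exact h2 j (by simp [hJ, hj]; omega)
    rcases Nat.lt_or_ge I.card 3 with h3 | h3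
    · exact Or.inr (complete J I (Finset.filter_subset _ _) (Finset.filter_subset _ _) (by omega)
        (by omega) (fun j hj => (hIJ j hj).symm) fun q hq hd => hno q hq hd.symm)
    · exact Or.inl (complete I J (Finset.filter_subset _ _) (Finset.filter_subset _ _) (by omega)
        (by omega) hIJ hno)
  · rintro (h | h)
    · exact sound h
    · exact Inst.bad_swap.1 (sound h)

/-- All elements of `Q` with all their coordinates. -/
def Inst.points (D : Inst) (k : ℕ) : Set (List ℕ) :=
  {e | ∃ q < k, e = (List.range 6).map fun i => D.pos i q}

/-- Enter all elements of `Q` into the table `T`. -/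
def loadAll (T : ℕ) : Cmd := forUp vQ (var vNQ) (insTab T (.lit 1) ((List.range 6).map posQ))

theorem writes_loadAll {T a : ℕ} (h : (loadAll T).Writes a) :
    (60 ≤ a ∧ a ≤ 64) ∨ a = vQ ∨ a = T := by
  rw [loadAll, writes_forUp] at h
  rcases h with h | h
  · omega
  · have := writes_insTab h; omega

/-- The coordinate `i` of the current `p`, and in the case `i = j` the minimum of this number and of
`vMin`. Here `min x y` is computed as `x - (x - y)` with truncated subtraction. -/
def cutP (α j i : ℕ) : WExp :=
  if i = j then .sub (.get (α + i) (var vP)) (.sub (.get (α + i) (var vP)) (var vMin))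
  else .get (α + i) (var vP)

/-- Search for a pair such that no `q` is below `p` in all coordinates and below `r` in the
coordinate `j`. -/
def minCheck (vp vr α β T j : ℕ) : Cmd :=
  .seq (assign vMin (var vNQ)) (.seq
    (forUp vR (var vr) (.cond (.wordLe (var vMin) (cntR β j)) .nop (assign vMin (cntR β j))))
    (forUp vP (var vp) (.seq (qryTab T (.lit 1) ((List.range 6).map (cutP α j)))
      (.cond (.wordLe (.lit 1) (var vFd)) .nop (assign vAns (.lit 0))))))

theorem writes_minCheck {vp vr α β T j a : ℕ} (h : (minCheck vp vr α β T j).Writes a) :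
    (60 ≤ a ∧ a ≤ 110) ∨ a = vAns := by
  simp only [minCheck, Cmd.Writes, writes_assign, writes_forUp, false_or] at h
  rcases h with h | h | h | h | h
  · omega
  · omega
  · omega
  · have := writes_qryTab h; omega
  · omega

section Search

variable {w l vp vr α β T j : ℕ} {D : Inst} {s : Store}

theorem run_loadAll (hroom : Roomy w (l + 1)) (hsl : Slots vp vr α β) (hD : D.Valid l)
    (henv : Env w l D vp vr α β s) (hT : 1000 ≤ T) (hz : ∀ k, s.words T k = 0) :
    Run w (loadAll T) s (fun t s' => t ≤ D.nQ * (tabTime (l + 1) 6 31 + 20) + 20 ∧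
      Tab s' T (l + 1) 6 1 (D.points D.nQ)) := by
  have hsize := hD.size
  have hleafw := hroom.leaf
  have hone := hroom.lit (n := 1) (by omega)
  refine (Run.forUp_const (N := D.nQ)
    (fun k s₁ => (∀ a, ¬ ((60 ≤ a ∧ a ≤ 64) ∨ a = vQ ∨ a = T) → s₁.words a = s.words a) ∧
      Tab s₁ T (l + 1) 6 1 (D.points k))
    (tabTime (l + 1) 6 31) (by omega) ?_ ?_ ?_ ?_ ?_).mono ?_
  · intro h
    have := writes_insTab h
    omega
  · rintro k s₁ ⟨hfr, -⟩
    rw [eval_var, hfr _ (by omega), henv.nQ]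
  · rintro k s₁ v ⟨hfr, htab⟩
    exact ⟨fun a ha => by rw [words_setWord_of_ne _ _ _ (by omega), hfr a ha],
      htab.congr (words_setWord_of_ne _ _ _ (by omega))⟩
  · refine ⟨fun _ _ => rfl, ?_⟩
    have : D.points 0 = ∅ := by ext e; simp [Inst.points]
    rw [this]
    exact Tab.empty fun k => by rw [hz]; decide
  · rintro k s₁ hk ⟨hfr, htab⟩ hik
    have henv1 : Env w l D vp vr α β s₁ := henv.congr hsl fun a h1 h2 => hfr a (by omega)
    have hes : List.Forall₂ (EvalsTo w s₁) ((List.range 6).map posQ)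
        ((List.range 6).map fun i => D.pos i k) := by
      rw [List.forall₂_map_left_iff, List.forall₂_map_right_iff, List.forall₂_same]
      intro i hi s' h
      rw [List.mem_range] at hi
      simp only [posQ, WExp.eval, eval_var]
      rw [h vQ (by omega), hik, h _ (by omega), henv1.pos i hi k hk]
    refine (run_insTab hroom henv1.leaf henv1.mul htab hes (st := .lit 1) (fun s' _ => hone)
      (by simp) le_rfl ?_ hT).frame.mono ?_
    · intro x hx
      obtain ⟨i, hi, rfl⟩ := List.mem_map.1 hx
      have := hD.pos_lt i (List.mem_range.1 hi) k hk
      omega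
    · rintro t s₂ ⟨⟨ht, htab2⟩, hfr2⟩
      refine ⟨ht.trans (le_of_eq ?_), fun a ha => ?_, ?_⟩
      · rfl
      · rw [hfr2 a (fun h => by have := writes_insTab h; omega), hfr a ha]
      · convert htab2 using 1
        ext e
        simp only [Inst.points, Set.mem_insert_iff, Set.mem_ofPred_eq, Nat.lt_succ_iff_lt_or_eq]
        constructor
        · rintro ⟨q, hq | rfl, rfl⟩
          · exact Or.inr ⟨q, hq, rfl⟩
          · exact Or.inl rfl
        · rintro (rfl | ⟨q, hq, rfl⟩)
          · exact ⟨k, Or.inr rfl, rfl⟩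
          · exact ⟨q, Or.inl hq, rfl⟩
  · rintro t s' ⟨ht, -, htab⟩
    refine ⟨?_, htab⟩
    rw [cost_var] at ht
    have : D.nQ * (tabTime (l + 1) 6 31 + (2 + 11)) ≤ D.nQ * (tabTime (l + 1) 6 31 + 20) :=
      Nat.mul_le_mul_left _ (by omega)
    omega

/-- If only one coordinate is left to `r`, then the `r` with the minimal count in this coordinate is
the best choice for every `p`. -/
theorem Inst.exists_nearlyBad_iff {m p : ℕ} (hj : j < 6) (hm : ∀ r < D.nR, m ≤ D.cR j r)
    (hm' : ∃ r < D.nR, m = D.cR j r) : (∃ r < D.nR, D.NearlyBad j p r) ↔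
      ¬ ∃ e ∈ D.points D.nQ,
        Below e ((List.range 6).map fun i => if i = j then min (D.cP i p) m else D.cP i p) := by
  have hb : ∀ q, Below ((List.range 6).map fun i => D.pos i q)
      ((List.range 6).map fun i => if i = j then min (D.cP i p) m else D.cP i p) ↔
        (∀ i < 6, D.pos i q < D.cP i p) ∧ D.pos j q < m := by
    intro q
    rw [Below, List.forall₂_map_left_iff, List.forall₂_map_right_iff, List.forall₂_same]
    simp only [List.mem_range]
    constructor
    · intro h
      refine ⟨fun i hi => ?_, ?_⟩
      · have := h i hi
        split_ifs at this
        · exact (lt_min_iff.1 this).1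
        · exact this
      · have := h j hj
        rw [if_pos rfl] at this
        exact (lt_min_iff.1 this).2
    · rintro ⟨h1, h2⟩ i hi
      split_ifs with h
      · subst h; exact lt_min (h1 i hi) h2
      · exact h1 i hi
  constructor
  · rintro ⟨r, hr, h⟩ ⟨e, ⟨q, hq, rfl⟩, hbel⟩
    have := (hb q).1 hbel
    exact h q hq ⟨this.1, this.2.trans_le (hm r hr)⟩
  · intro h
    obtain ⟨r, hr, rfl⟩ := hm'
    exact ⟨r, hr, fun q hq hd => h ⟨_, ⟨q, hq, rfl⟩, (hb q).2 hd⟩⟩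

/-- A bound for the time of `minCheck`. -/
def minTime (l n : ℕ) : ℕ := n * (tabTime (l + 1) 6 40 + 100) + 100

/-- If `R` is nonempty, then `minCheck` decides whether there is a pair as in `Inst.NearlyBad`. -/
theorem run_minCheck (hroom : Roomy w (l + 1)) (hsl : Slots vp vr α β) (hD : D.Valid l)
    (hfit : D.Fits w) (henv : Env w l D vp vr α β s) (hT : 1000 ≤ T) (hj : j < 6)
    (hnR : 1 ≤ D.nR) (htab : Tab s T (l + 1) 6 1 (D.points D.nQ)) :
    Run w (minCheck vp vr α β T j) s (fun t s' => t ≤ minTime l (D.nP + D.nR) ∧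
      (s'.words vAns 0 = 0 ∨ s'.words vAns 0 = s.words vAns 0) ∧
      (s'.words vAns 0 = 0 ↔ s.words vAns 0 = 0 ∨
        ∃ p < D.nP, ∃ r < D.nR, D.NearlyBad j p r)) := by
  have hsize := hD.size
  have hleafw := hroom.leaf
  have hone := hroom.lit (n := 1) (by omega)
  have hvp := hsl.vp
  have hvr := hsl.vr
  have hα := hsl.α
  have hβ := hsl.β
  have hfit' : D.nP + D.nR + 1 < 2 ^ w :=
    lt_of_le_of_lt (Nat.le_mul_of_pos_left _ (Nat.succ_pos _)) hfit
  have hcR : (cntR β j).cost = 3 := rfl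
  refine Run.seq (Run.assign (Run.seq ?_))
  rw [eval_var, henv.nQ]
  refine (Run.forUp_const (N := D.nR)
    -- `vMin` is the minimum of `D.nQ` and the first `k` counts.
    (fun k s₁ => (∀ a, ¬ (a = vR ∨ a = vMin) → s₁.words a = s.words a) ∧
      (∀ r < k, s₁.words vMin 0 ≤ D.cR j r) ∧ s₁.words vMin 0 ≤ D.nQ ∧
      (s₁.words vMin 0 = D.nQ ∨ ∃ r < k, s₁.words vMin 0 = D.cR j r))
    20 (by omega) ?_ ?_ ?_ ?_ ?_).mono ?_
  · rintro (h | h)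
    · exact h.elim
    · rw [writes_assign] at h; omega
  · rintro k s₁ ⟨hfr, -⟩
    rw [eval_var, hfr _ (by omega), henv.nR]
  · rintro k s₁ v ⟨hfr, h⟩
    rw [words_setWord_of_ne _ _ _ (show vMin ≠ vR by decide)]
    exact ⟨fun a ha => by rw [words_setWord_of_ne _ _ _ (by omega), hfr a ha], h⟩
  · refine ⟨fun a ha => words_setWord_of_ne _ _ _ (by omega), by simp, ?_, Or.inl ?_⟩ <;>
      simp [words_setWord]
  · rintro k s₁ hk ⟨hfr, h1, h2, h3⟩ hik
    have hev : (cntR β j).eval w s₁ = D.cR j k := by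
      simp only [cntR, WExp.eval, eval_var, hik]
      rw [hfr _ (by omega), henv.cR j hj k hk]
    have hbc : (BExp.wordLe (var vMin) (cntR β j)).cost = 6 := rfl
    refine Run.cond (fun hb => Run.nop ⟨by omega, hfr, ?_, h2, ?_⟩)
      (fun hb => Run.assign ⟨by omega, ?_, ?_, ?_, ?_⟩)
    · simp only [BExp.Holds, eval_var, hev] at hb
      intro r hr
      rcases Nat.lt_succ_iff_lt_or_eq.1 hr with h | rfl
      · exact h1 r h
      · exact hb
    · rcases h3 with h | ⟨r, hr, h⟩
      · exact Or.inl h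
      · exact Or.inr ⟨r, by omega, h⟩
    · exact fun a ha => by rw [words_setWord_of_ne _ _ _ (by omega), hfr a ha]
    · simp only [BExp.Holds, eval_var, hev] at hb
      simp only [words_setWord, and_self, if_true, hev]
      intro r hr
      rcases Nat.lt_succ_iff_lt_or_eq.1 hr with h | rfl
      · have := h1 r h; omega
      · exact le_rfl
    · simp only [words_setWord, and_self, if_true, hev]
      exact hD.cR_le j hj k hk
    · simp only [words_setWord, and_self, if_true, hev]
      exact Or.inr ⟨k, Nat.lt_succ_self k, rfl⟩
  rintro t₁ s₁ ⟨ht₁, hfr1, h1, h2, h3⟩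
  set m := s₁.words vMin 0 with hm
  -- All counts are at most `D.nQ`, so the minimum is attained by a count.
  have hm' : ∃ r < D.nR, m = D.cR j r := by
    rcases h3 with h | h
    · have := h1 0 (by omega)
      have := hD.cR_le j hj 0 (by omega)
      exact ⟨0, by omega, by omega⟩
    · exact h
  have henv1 : Env w l D vp vr α β s₁ := henv.congr hsl fun a h1 h2 => hfr1 a (by omega)
  refine (Run.forUp_const (N := D.nP)
    (fun k s₂ => (∀ a, ¬ ((60 ≤ a ∧ a ≤ 64) ∨ a = vP ∨ a = vAns) → s₂.words a = s₁.words a) ∧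
      (s₂.words vAns 0 = 0 ∨ s₂.words vAns 0 = s.words vAns 0) ∧
      (s₂.words vAns 0 = 0 ↔ s.words vAns 0 = 0 ∨
        ∃ p < k, ∃ r < D.nR, D.NearlyBad j p r))
    (tabTime (l + 1) 6 40 + 20) (by omega) ?_ ?_ ?_ ?_ ?_).mono ?_
  · rintro (h | h | h)
    · have := writes_qryTab h; omega
    · exact h.elim
    · rw [writes_assign] at h; omega
  · rintro k s₂ ⟨hfr, -⟩
    by_cases hvpa : vp = vAns
    · omega
    · rw [eval_var, hfr _ (by omega), henv1.nP]
  · rintro k s₂ v ⟨hfr, h⟩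
    rw [words_setWord_of_ne _ _ _ (show vAns ≠ vP by decide)]
    exact ⟨fun a ha => by rw [words_setWord_of_ne _ _ _ (by omega), hfr a ha], h⟩
  · have : s₁.words vAns = s.words vAns := hfr1 _ (by omega)
    exact ⟨fun _ _ => rfl, by rw [this]; exact Or.inr rfl, by rw [this]; simp⟩
  · rintro k s₂ hk ⟨hfr, ha1, ha2⟩ hik
    have henv2 : Env w l D vp vr α β s₂ := henv1.congr hsl fun a h1 h2 => hfr a (by omega)
    have hes : List.Forall₂ (EvalsTo w s₂) ((List.range 6).map (cutP α j))
        ((List.range 6).map fun i => if i = j then min (D.cP i k) m else D.cP i k) := by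
      rw [List.forall₂_map_left_iff, List.forall₂_map_right_iff, List.forall₂_same]
      intro i hi s' h
      rw [List.mem_range] at hi
      have e1 : (WExp.get (α + i) (var vP)).eval w s' = D.cP i k := by
        simp only [WExp.eval, eval_var]
        rw [h vP (by omega), hik, h _ (by omega), henv2.cP i hi k hk]
      unfold cutP
      split_ifs
      · have e2 : (var vMin).eval w s' = m := by
          rw [eval_var, h _ (by omega), hfr _ (by omega), ← hm]
        change WExp.eval w s' (.get (α + i) (var vP)) -
          (WExp.eval w s' (.get (α + i) (var vP)) - WExp.eval w s' (var vMin)) = _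
        rw [e1, e2]
        omega
      · exact e1
    have hcost : (((List.range 6).map (cutP α j)).map fun e => e.cost + 2).sum +
        (WExp.lit 1).cost = 38 := by
      interval_cases j <;> rfl
    refine Run.seq ((run_qryTab hroom henv2.leaf henv2.mul (htab.congr (by
      rw [hfr _ (by omega), hfr1 _ (by omega)])) hes (st := .lit 1) (fun s' _ => hone)
      (by simp) le_rfl ?_ hT).frame.mono ?_)
    · intro x hx
      obtain ⟨i, hi, rfl⟩ := List.mem_map.1 hx
      have := hD.cP_le i (List.mem_range.1 hi) k hk
      split_ifs <;> omega
    · rintro t s₃ ⟨⟨ht, hfd, hfd1⟩, hfr3⟩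
      rw [hcost] at ht
      have ht' : tabTime (l + 1) 6 38 ≤ tabTime (l + 1) 6 40 := by unfold tabTime; omega
      have fr3 : ∀ a, ¬ (60 ≤ a ∧ a ≤ 64) → s₃.words a = s₂.words a := fun a ha =>
        hfr3 a fun h => ha (writes_qryTab h)
      have hbc : (BExp.wordLe (.lit 1) (var vFd)).cost = 4 := rfl
      have hlc : (WExp.lit 0).cost = 1 := rfl
      have hiff := Inst.exists_nearlyBad_iff (p := k) hj h1 hm'
      refine Run.cond (fun hb => Run.nop ⟨by omega, ?_, ?_, ?_⟩)
        (fun hb => Run.assign ⟨by omega, ?_, ?_, ?_⟩)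
      · exact fun a ha => by rw [fr3 a (by omega), hfr a ha]
      · rw [fr3 _ (by omega)]; exact ha1
      · simp only [BExp.Holds, WExp.eval, eval_var, hone] at hb
        rw [fr3 _ (by omega), ha2]
        have hno : ¬ ∃ r < D.nR, D.NearlyBad j k r := by
          rw [hiff, not_not]
          exact hfd.1 (by omega)
        simp only [Nat.lt_succ_iff_lt_or_eq, or_and_right, exists_or, exists_eq_left, hno, or_false]
      · exact fun a ha => by rw [words_setWord_of_ne _ _ _ (by omega), fr3 a (by omega), hfr a ha]
      · simp [words_setWord, WExp.eval]
      · simp only [BExp.Holds, WExp.eval, eval_var, hone] at hb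
        have hyes : ∃ r < D.nR, D.NearlyBad j k r := by
          rw [hiff]
          intro h
          have := hfd.2 h
          omega
        simp only [words_setWord, WExp.eval, and_self, if_true, Nat.zero_mod, true_iff]
        exact Or.inr ⟨k, Nat.lt_succ_self k, hyes⟩
  · rintro t₂ s₂ ⟨ht₂, -, ha1, ha2⟩
    refine ⟨?_, ha1, ha2⟩
    rw [cost_var] at ht₁ ht₂
    simp only [minTime, cost_var, add_mul]
    have e1 : D.nR * (20 + (2 + 11)) ≤ D.nR * (tabTime (l + 1) 6 40 + 100) :=
      Nat.mul_le_mul_left _ (by omega)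
    have e2 : D.nP * (tabTime (l + 1) 6 40 + 20 + (2 + 11)) ≤
        D.nP * (tabTime (l + 1) 6 40 + 100) := Nat.mul_le_mul_left _ (by omega)
    omega

end Search

/-- `minCheck` for several coordinates. -/
def minChecks (vp vr α β T : ℕ) : List ℕ → Cmd
  | [] => .nop
  | j :: js => .seq (minCheck vp vr α β T j) (minChecks vp vr α β T js)

theorem writes_minChecks {vp vr α β T a : ℕ} : ∀ {js : List ℕ},
    (minChecks vp vr α β T js).Writes a → (60 ≤ a ∧ a ≤ 110) ∨ a = vAns
  | [], h => h.elim
  | j :: js, h => by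
    rcases h with h | h
    · exact writes_minCheck h
    · exact writes_minChecks h

/-- All searches in which most of the conditions come from the first of the two outer sets; `T₀` is
the table of all elements of `Q`, and there are fresh tables from `T` on. -/
def searchSide (vp vr α β T₀ T : ℕ) : Cmd :=
  .seq (minChecks vp vr α β T₀ (List.range 6)) (searchTuples vp vr α β T splittings)

theorem writes_searchSide {vp vr α β T₀ T a : ℕ} (h : (searchSide vp vr α β T₀ T).Writes a) :
    (60 ≤ a ∧ a ≤ 110) ∨ a = vAns ∨ (T ≤ a ∧ a < T + 3 * splittings.length) := by
  rcases h with h | h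
  · have := writes_minChecks h; omega
  · exact writes_searchTuples h

/-- Decide whether there is an uncovered pair, and set `vAns` to `0` in this case. -/
def search : Cmd :=
  .cond (.and (.wordLe (.lit 1) (var vNP)) (.wordLe (.lit 1) (var vNR)))
    (.seq (loadAll 1000) (.seq (searchSide vNP vNR 40 50 1000 1001)
      (searchSide vNR vNP 50 40 1000 (1001 + 3 * splittings.length))))
    .nop

/-- A bound for the time of `searchSide`. -/
def Inst.sideTime (D : Inst) (l : ℕ) : ℕ :=
  6 * minTime l (D.nP + D.nR) + splittings.length * D.cellsTime l + 2

theorem Inst.sideTime_swap (D : Inst) (l : ℕ) : D.swap.sideTime l = D.sideTime l := by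
  have h : D.nR + D.nP = D.nP + D.nR := add_comm _ _
  have h' : D.nR + D.nQ + D.nP = D.nP + D.nQ + D.nR := by ring
  simp only [Inst.sideTime, Inst.cellsTime, Inst.swap, h, h']

section Search

variable {w l vp vr α β T T₀ : ℕ} {D : Inst} {s : Store}

theorem run_minChecks (hroom : Roomy w (l + 1)) (hsl : Slots vp vr α β) (hD : D.Valid l)
    (hfit : D.Fits w) (hT : 1000 ≤ T) (hnR : 1 ≤ D.nR) : ∀ (js : List ℕ) (s : Store),
    (∀ j ∈ js, j < 6) → Env w l D vp vr α β s → Tab s T (l + 1) 6 1 (D.points D.nQ) →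
    Run w (minChecks vp vr α β T js) s (fun t s' =>
      t ≤ js.length * minTime l (D.nP + D.nR) + 1 ∧
      (s'.words vAns 0 = 0 ∨ s'.words vAns 0 = s.words vAns 0) ∧
      (s'.words vAns 0 = 0 ↔ s.words vAns 0 = 0 ∨
        ∃ j ∈ js, ∃ p < D.nP, ∃ r < D.nR, D.NearlyBad j p r))
  | [], s, _, _, _ => Run.nop ⟨by simp, Or.inr rfl, by simp⟩
  | j :: js, s, hjs, henv, htab => by
    refine Run.seq ((run_minCheck hroom hsl hD hfit henv hT (hjs j List.mem_cons_self) hnR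
      htab).frame.mono ?_)
    rintro t₁ s₁ ⟨⟨ht₁, h1, h2⟩, hfr⟩
    have fr : ∀ a, ¬ ((60 ≤ a ∧ a ≤ 110) ∨ a = vAns) → s₁.words a = s.words a := fun a ha =>
      hfr a fun h => ha (writes_minCheck h)
    refine (run_minChecks hroom hsl hD hfit hT hnR js s₁
      (fun i hi => hjs i (List.mem_cons_of_mem _ hi))
      (henv.congr hsl fun a ha hne => fr a (by omega)) (htab.congr (fr _ (by omega)))).mono ?_
    rintro t₂ s₂ ⟨ht₂, h3, h4⟩
    refine ⟨?_, ?_, ?_⟩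
    · rw [List.length_cons, Nat.succ_mul]; omega
    · rcases h3 with h | h
      · exact Or.inl h
      · rw [h]; exact h1
    · rw [h4, h2, or_assoc]
      simp only [List.mem_cons, exists_eq_or_imp]

theorem run_searchSide (hroom : Roomy w (l + 1)) (hsl : Slots vp vr α β) (hD : D.Valid l)
    (hfit : D.Fits w) (henv : Env w l D vp vr α β s) (hT₀ : 1000 ≤ T₀) (hT : T₀ < T)
    (hnR : 1 ≤ D.nR) (htab : Tab s T₀ (l + 1) 6 1 (D.points D.nQ))
    (hz : ∀ a, T ≤ a → ∀ k, s.words a k = 0) :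
    Run w (searchSide vp vr α β T₀ T) s (fun t s' => t ≤ D.sideTime l ∧
      (s'.words vAns 0 = 0 ∨ s'.words vAns 0 = s.words vAns 0) ∧
      (s'.words vAns 0 = 0 ↔ s.words vAns 0 = 0 ∨ ∃ p < D.nP, ∃ r < D.nR,
        (∃ j < 6, D.NearlyBad j p r) ∨
          ∃ x ∈ splittings, D.Uncovered x.1 x.2.1 x.2.2.1 x.2.2.2 p r)) := by
  refine Run.seq ((run_minChecks hroom hsl hD hfit hT₀ hnR (List.range 6) s
    (fun j hj => List.mem_range.1 hj) henv htab).frame.mono ?_)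
  rintro t₁ s₁ ⟨⟨ht₁, h1, h2⟩, hfr⟩
  have fr : ∀ a, ¬ ((60 ≤ a ∧ a ≤ 110) ∨ a = vAns) → s₁.words a = s.words a := fun a ha =>
    hfr a fun h => ha (writes_minChecks h)
  refine (run_searchTuples hroom hsl hD hfit splittings T s₁ (fun x hx => mem_splittings.1 hx)
    (henv.congr hsl fun a ha hne => fr a (by omega)) (by omega)
    (fun a ha k => by rw [fr a (by omega), hz a ha])).mono ?_
  rintro t₂ s₂ ⟨ht₂, h3, h4⟩
  refine ⟨?_, ?_, ?_⟩
  · rw [List.length_range] at ht₁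
    unfold Inst.sideTime
    omega
  · rcases h3 with h | h
    · exact Or.inl h
    · rw [h]; exact h1
  · rw [h4, h2, or_assoc]
    refine or_congr_right ⟨?_, ?_⟩
    · rintro (⟨j, hj, p, hp, r, hr, h⟩ | ⟨x, hx, p, hp, r, hr, h⟩)
      · exact ⟨p, hp, r, hr, Or.inl ⟨j, List.mem_range.1 hj, h⟩⟩
      · exact ⟨p, hp, r, hr, Or.inr ⟨x, hx, h⟩⟩
    · rintro ⟨p, hp, r, hr, (⟨j, hj, h⟩ | ⟨x, hx, h⟩)⟩
      · exact Or.inl ⟨j, List.mem_range.2 hj, p, hp, r, hr, h⟩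
      · exact Or.inr ⟨x, hx, p, hp, r, hr, h⟩

/-- A bound for the time of the search. -/
def Inst.searchTime (D : Inst) (l : ℕ) : ℕ :=
  D.nQ * (tabTime (l + 1) 6 31 + 20) + 2 * D.sideTime l + 40

/-- The search decides whether a ranked instance has a bad pair. If `P` or `R` is empty, the minimum
in `minCheck` is not attained by any count, so that this case is excluded beforehand. -/
theorem run_search (hroom : Roomy w (l + 1)) (hD : D.Valid l) (hfit : D.Fits w)
    (henv : Env w l D vNP vNR 40 50 s) (hz : ∀ a, 1000 ≤ a → ∀ k, s.words a k = 0) :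
    Run w search s (fun t s' => t ≤ D.searchTime l ∧
      (s'.words vAns 0 = 0 ∨ s'.words vAns 0 = s.words vAns 0) ∧
      (s'.words vAns 0 = 0 ↔ s.words vAns 0 = 0 ∨ ∃ p < D.nP, ∃ r < D.nR, D.Bad p r)) := by
  have hone := hroom.lit (n := 1) (by omega)
  have hsl : Slots vNP vNR 40 50 := ⟨by omega, by omega, by omega, by omega⟩
  have hbc : (BExp.and (.wordLe (.lit 1) (var vNP)) (.wordLe (.lit 1) (var vNR))).cost = 9 := rfl
  refine Run.cond (fun hb => ?_) (fun hb => Run.nop ⟨?_, Or.inr rfl, ?_⟩)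
  · simp only [BExp.Holds, WExp.eval, eval_var, hone, henv.nP, henv.nR] at hb
    refine Run.seq ((run_loadAll hroom hsl hD henv le_rfl (hz 1000 le_rfl)).frame.mono ?_)
    rintro t₁ s₁ ⟨⟨ht₁, htab⟩, hfr1⟩
    have fr1 : ∀ a, ¬ ((60 ≤ a ∧ a ≤ 64) ∨ a = vQ ∨ a = 1000) → s₁.words a = s.words a :=
      fun a ha => hfr1 a fun h => ha (writes_loadAll h)
    have henv1 : Env w l D vNP vNR 40 50 s₁ := henv.congr hsl fun a h1 h2 => fr1 a (by omega)
    refine Run.seq ((run_searchSide (T := 1001) hroom hsl hD hfit henv1 le_rfl (by omega) hb.2 htab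
      (fun a ha k => by rw [fr1 a (by omega), hz a (by omega)])).frame.mono ?_)
    rintro t₂ s₂ ⟨⟨ht₂, h1, h2⟩, hfr2⟩
    have fr2 : ∀ a, ¬ ((60 ≤ a ∧ a ≤ 110) ∨ a = vAns ∨
        (1001 ≤ a ∧ a < 1001 + 3 * splittings.length)) → s₂.words a = s₁.words a :=
      fun a ha => hfr2 a fun h => ha (writes_searchSide h)
    have henv2 : Env w l D vNP vNR 40 50 s₂ := henv1.congr hsl fun a h1 h2 => fr2 a (by omega)
    refine (run_searchSide (D := D.swap) (T := 1001 + 3 * splittings.length) hroom hsl.swap hD.swap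
      hfit.swap henv2.swap le_rfl (by omega) hb.1 (htab.congr (fr2 _ (by omega)))
      (fun a ha k => by rw [fr2 a (by omega), fr1 a (by omega), hz a (by omega)])).mono ?_
    rintro t₃ s₃ ⟨ht₃, h3, h4⟩
    rw [fr1 _ (by omega)] at h1 h2
    rw [Inst.sideTime_swap] at ht₃
    refine ⟨?_, ?_, ?_⟩
    · unfold Inst.searchTime
      omega
    · rcases h3 with h | h
      · exact Or.inl h
      · rw [h]; exact h1
    · rw [h4, h2, or_assoc]
      refine or_congr_right ⟨?_, ?_⟩
      · rintro (⟨p, hp, r, hr, h⟩ | ⟨r, hr, p, hp, h⟩)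
        · exact ⟨p, hp, r, hr, Inst.bad_iff.2 (Or.inl h)⟩
        · exact ⟨p, hp, r, hr, Inst.bad_iff.2 (Or.inr h)⟩
      · rintro ⟨p, hp, r, hr, h⟩
        rcases Inst.bad_iff.1 h with h | h
        · exact Or.inl ⟨p, hp, r, hr, h⟩
        · exact Or.inr ⟨r, hr, p, hp, h⟩
  · unfold Inst.searchTime
    omega
  · simp only [BExp.Holds, WExp.eval, eval_var, hone, henv.nP, henv.nR] at hb
    constructor
    · exact Or.inl
    · rintro (h | ⟨p, hp, r, hr, -⟩)
      · exact h
      · exact absurd ⟨by omega, by omega⟩ hb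

end Search

/-! ### Ranks -/

/-- The order of indices by their keys, ties being broken by the indices themselves. -/
def LexLt (key : ℕ → ℝ) (e q : ℕ) : Prop := key e < key q ∨ (key e = key q ∧ e < q)

theorem LexLt.irrefl {key : ℕ → ℝ} {q : ℕ} : ¬ LexLt key q q := by simp [LexLt]

theorem LexLt.trans {key : ℕ → ℝ} {a b c : ℕ} (h : LexLt key a b) (h' : LexLt key b c) :
    LexLt key a c := by
  rcases h with h | ⟨h, h1⟩ <;> rcases h' with h' | ⟨h', h2⟩
  · exact Or.inl (h.trans h')
  · exact Or.inl (h' ▸ h)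
  · exact Or.inl (h ▸ h')
  · exact Or.inr ⟨h.trans h', h1.trans h2⟩

theorem LexLt.trichotomous (key : ℕ → ℝ) (a b : ℕ) : LexLt key a b ∨ a = b ∨ LexLt key b a := by
  unfold LexLt
  rcases lt_trichotomy (key a) (key b) with h | h | h
  · exact Or.inl (Or.inl h)
  · rcases lt_trichotomy a b with h' | h' | h'
    · exact Or.inl (Or.inr ⟨h, h'⟩)
    · exact Or.inr (Or.inl h')
    · exact Or.inr (Or.inr (Or.inr ⟨h.symm, h'⟩))
  · exact Or.inr (Or.inr (Or.inl h))

open Classical in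
/-- The number of elements of `A` with the property `S`. -/
noncomputable def countIn (A : Finset ℕ) (S : ℕ → Prop) : ℕ := (A.filter S).card

/-- The rank of `q` in `A`. -/
noncomputable def rank (key : ℕ → ℝ) (A : Finset ℕ) (q : ℕ) : ℕ := countIn A fun e => LexLt key e q

/-- A property that is inherited by smaller elements. -/
def DownClosed (key : ℕ → ℝ) (S : ℕ → Prop) : Prop := ∀ e q, LexLt key e q → S q → S e

theorem downClosed_lexLt (key : ℕ → ℝ) (q : ℕ) : DownClosed key fun e => LexLt key e q :=
  fun _ _ h h' => h.trans h'

theorem downClosed_le (key : ℕ → ℝ) (x : ℝ) : DownClosed key fun e => key e ≤ x := by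
  rintro e q (h | ⟨h, -⟩) h'
  · exact h.le.trans h'
  · exact h.le.trans h'

theorem countIn_le (A : Finset ℕ) (S : ℕ → Prop) : countIn A S ≤ A.card := by
  classical exact Finset.card_filter_le _ _

/-- The elements with an inherited property are those of small rank. -/
theorem rank_lt_countIn {key : ℕ → ℝ} {A : Finset ℕ} {S : ℕ → Prop} (hS : DownClosed key S) {q : ℕ}
    (hq : q ∈ A) : rank key A q < countIn A S ↔ S q := by
  classical
  constructor
  · intro h
    by_contra hn
    refine absurd h (not_lt.2 (Finset.card_le_card fun e he => ?_))
    simp only [Finset.mem_filter] at he ⊢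
    refine ⟨he.1, ?_⟩
    rcases LexLt.trichotomous key e q with h | rfl | h
    · exact h
    · exact absurd he.2 hn
    · exact absurd (hS _ _ h he.2) hn
  · intro h
    refine Finset.card_lt_card ⟨fun e he => ?_, fun hsub => ?_⟩
    · simp only [Finset.mem_filter] at he ⊢
      exact ⟨he.1, hS _ _ he.2 h⟩
    · have := hsub (Finset.mem_filter.2 ⟨hq, h⟩)
      exact LexLt.irrefl (Finset.mem_filter.1 this).2

theorem rank_lt_card {key : ℕ → ℝ} {A : Finset ℕ} {q : ℕ} (hq : q ∈ A) : rank key A q < A.card := by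
  classical
  refine Finset.card_lt_card ⟨Finset.filter_subset _ _, fun hsub => ?_⟩
  exact LexLt.irrefl (Finset.mem_filter.1 (hsub hq)).2

theorem rank_injOn {key : ℕ → ℝ} {A : Finset ℕ} {q q' : ℕ} (hq : q ∈ A) (hq' : q' ∈ A)
    (h : rank key A q = rank key A q') : q = q' := by
  rcases LexLt.trichotomous key q q' with h' | h' | h'
  · exact absurd ((rank_lt_countIn (downClosed_lexLt key q') hq).2 h') (by
      rw [h]; exact lt_irrefl _)
  · exact h'
  · exact absurd ((rank_lt_countIn (downClosed_lexLt key q) hq').2 h') (by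
      rw [← h]; exact lt_irrefl _)

theorem exists_rank_eq {key : ℕ → ℝ} {A : Finset ℕ} {t : ℕ} (ht : t < A.card) :
    ∃ q ∈ A, rank key A q = t := by
  have h := Finset.surj_on_of_inj_on_of_card_le (s := A) (t := Finset.range A.card)
    (fun q _ => rank key A q) (fun q hq => Finset.mem_range.2 (rank_lt_card hq))
    (fun q q' hq hq' h => rank_injOn hq hq' h) (by simp) t (Finset.mem_range.2 ht)
  obtain ⟨q, hq, he⟩ := h
  exact ⟨q, hq, he.symm⟩

/-- The length of block number `k`, for `n` elements and blocks of the length `B`. -/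
def blockLen (n B k : ℕ) : ℕ := B - (B - (n - k * B))

/-- Block number `k`. -/
def block (n B k : ℕ) : Finset ℕ := Finset.Ico (k * B) (k * B + blockLen n B k)

theorem card_block (n B k : ℕ) : (block n B k).card = blockLen n B k := by simp [block]

theorem mem_block {n B k e : ℕ} (hB : 1 ≤ B) : e ∈ block n B k ↔ e < n ∧ e / B = k := by
  have h1 := Nat.div_add_mod e B
  have h2 := Nat.mod_lt e hB
  simp only [block, Finset.mem_Ico, blockLen]
  constructor
  · rintro ⟨h3, h4⟩
    refine ⟨by omega, ?_⟩
    rw [Nat.div_eq_of_lt_le h3 (by rw [Nat.succ_mul]; omega)]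
  · rintro ⟨h3, rfl⟩
    rw [mul_comm] at h1
    omega

theorem sum_countIn_block {n B b : ℕ} (hB : 1 ≤ B) (hn : n < b * B) (S : ℕ → Prop) :
    ∑ k ∈ Finset.range b, countIn (block n B k) S = countIn (Finset.range n) S := by
  classical
  rw [countIn, Finset.card_eq_sum_card_fiberwise (f := fun e => e / B) (t := Finset.range b)]
  · refine Finset.sum_congr rfl fun k _ => ?_
    rw [countIn]
    congr 1
    ext e
    simp only [Finset.mem_filter, mem_block hB, Finset.mem_range]
    tauto
  · intro e he
    simp only [Finset.coe_filter, Finset.mem_range, Set.mem_ofPred_eq] at he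
    simp only [Finset.coe_range, Set.mem_Iio]
    exact (Nat.div_lt_iff_lt_mul hB).2 (he.1.trans hn)

/-- A search in the sorted list of `A` for the first element without an inherited property counts
the elements with this property. -/
theorem countIn_eq {key : ℕ → ℝ} {A : Finset ℕ} {S : ℕ → Prop} (hS : DownClosed key S)
    {elem : ℕ → ℕ} (helem : ∀ i < A.card, elem i ∈ A ∧ rank key A (elem i) = i) {v : ℕ}
    (hv : v ≤ A.card) (h1 : ∀ i < v, S (elem i)) (h2 : v < A.card → ¬ S (elem v)) :
    countIn A S = v := by
  have hiff : ∀ i < A.card, (i < countIn A S ↔ S (elem i)) := by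
    intro i hi
    obtain ⟨hm, hr⟩ := helem i hi
    rw [← rank_lt_countIn hS hm, hr]
  have hle := countIn_le A S
  refine le_antisymm ?_ ?_
  · by_contra hlt
    exact h2 (by omega) ((hiff v (by omega)).1 (by omega))
  · rcases Nat.eq_zero_or_pos v with h | h
    · omega
    · have := (hiff (v - 1) (by omega)).2 (h1 _ (by omega))
      omega

/-! ### Programs for ranking -/

notation "aBo" => 120
notation "vE" => 121
notation "vCt" => 122
notation "vBk" => 123
notation "vLo" => 124
notation "vSz" => 125
notation "vRk" => 126
notation "vI" => 127

/-- The test for the order `LexLt` of the indices `e` and `q`, if `K` is the key. -/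
def lexTest (K : WExp → RExp) (e q : WExp) : BExp :=
  .not (.and (.realLe (K q) (K e)) (.not (.and (.realLe (K e) (K q)) (.not (.wordLe q e)))))

/-- For memories with the real arrays `R`, the expression `K` computes the function `key`. -/
def Gives (w : ℕ) (R : ℕ → ℕ → ℝ) (K : WExp → RExp) (n : ℕ) (key : ℕ → ℝ) : Prop :=
  ∀ s : Store, s.reals = R → ∀ e i, e.eval w s = i → i < n → (K e).eval w s = key i

theorem holds_lexTest {w n i q : ℕ} {K : WExp → RExp} {key : ℕ → ℝ} {s : Store}
    (hK : Gives w s.reals K n key) {e f : WExp} (he : e.eval w s = i) (hf : f.eval w s = q)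
    (hi : i < n) (hq : q < n) : (lexTest K e f).Holds w s ↔ LexLt key i q := by
  simp only [lexTest, BExp.Holds, hK s rfl e i he hi, hK s rfl f q hf hq, he, hf, LexLt, not_and,
    Classical.not_imp, not_le, not_lt]
  constructor
  · intro h
    rcases lt_or_ge (key i) (key q) with h' | h'
    · exact Or.inl h'
    · exact Or.inr ⟨le_antisymm (h h').1 h', (h h').2⟩
  · rintro (h | ⟨h, h'⟩) hle
    · exact absurd h (not_lt.2 hle)
    · exact ⟨h.le, h'⟩

/-- The part of an instance that is in the memory before ranking. -/
structure Base (l : ℕ) (D : Inst) (s : Store) : Prop where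
  nP : s.words vNP 0 = D.nP
  nQ : s.words vNQ 0 = D.nQ
  nR : s.words vNR 0 = D.nR
  b : s.words vBase 0 = D.b
  B : s.words vWid 0 = D.B
  leaf : s.words vLeaf 0 = 2 ^ (l + 1)
  mul : s.words vMul 0 = 2 * 2 ^ (l + 1)
  half : s.words vHalf 0 = 2 ^ l

theorem Base.congr {l : ℕ} {D : Inst} {s s' : Store} (h : Base l D s)
    (he : ∀ a, a < 20 → s'.words a = s.words a) : Base l D s' := by
  refine ⟨?_, ?_, ?_, ?_, ?_, ?_, ?_, ?_⟩ <;> rw [he _ (by omega)]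
  exacts [h.nP, h.nQ, h.nR, h.b, h.B, h.leaf, h.mul, h.half]

/-- The sizes in an instance fit to each other and into words. -/
structure Inst.Sizes (D : Inst) (w l : ℕ) : Prop where
  width : 1 ≤ D.B
  slab : D.nQ < D.b * D.B
  size : D.nQ + 2 ≤ 2 ^ (l + 1)
  words : 2 * 2 ^ (l + 1) ≤ 2 ^ w
  const : 1024 < 2 ^ w
  blocks : (D.b + 1) * (D.B + 1) < 2 ^ w

/-- Set `vSz` to the length of the block that starts at `vLo`, the minimum of `vWid` and the number
of remaining elements. -/
def setSize : Cmd := assign vSz (.sub (var vWid) (.sub (var vWid) (.sub (var vNQ) (var vLo))))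

/-- Sort the blocks of indices, by counting for each element the smaller ones in its block. -/
def sortBlocks (K : WExp → RExp) : Cmd :=
  forUp vQ (var vNQ) (.seq (assign vRk (.lit 0))
    (.seq (assign vLo (.mul (.div (var vQ) (var vWid)) (var vWid))) (.seq setSize
      (.seq (forUp vI (var vSz) (.seq (assign vE (.add (var vLo) (var vI)))
        (.cond (lexTest K (var vE) (var vQ)) (assign vRk (.add (var vRk) (.lit 1))) .nop)))
        (.setWord aBo (.add (var vLo) (var vRk)) (var vQ))))))

theorem writes_sortBlocks {K : WExp → RExp} {a : ℕ} (h : (sortBlocks K).Writes a) :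
    a = vQ ∨ (120 ≤ a ∧ a ≤ 127) := by
  simp only [sortBlocks, setSize, Cmd.Writes, writes_forUp, writes_assign, or_false] at h
  omega

theorem realFree_sortBlocks (K : WExp → RExp) : (sortBlocks K).RealFree := by
  simp [sortBlocks, setSize, Cmd.RealFree]

/-- The test whether at least `vBc` elements of the current block have a property. -/
def blockTest (tst : BExp) : Cmd :=
  .cond (.wordLe (var vBc) (var vSz))
    (.seq (assign vE (.get aBo (.sub (.add (var vLo) (var vBc)) (.lit 1))))
      (.cond tst (assign vTv (.lit 1)) (assign vTv (.lit 0))))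
    (assign vTv (.lit 0))

/-- Count the elements with an inherited property, by binary search in each of the sorted blocks. -/
def countBlocks (tst : BExp) : Cmd :=
  .seq (assign vCt (.lit 0)) (forUp vBk (var vBase)
    (.seq (assign vLo (.mul (var vBk) (var vWid))) (.seq setSize
      (.seq (bsearch (blockTest tst)) (assign vCt (.add (var vCt) (var vBv)))))))

theorem writes_blockTest {tst : BExp} {a : ℕ} (h : (blockTest tst).Writes a) :
    a = vE ∨ a = vTv := by
  simp only [blockTest, Cmd.Writes, writes_assign] at h
  omega

theorem writes_countBlocks {tst : BExp} {a : ℕ} (h : (countBlocks tst).Writes a) :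
    (70 ≤ a ∧ a ≤ 73) ∨ (121 ≤ a ∧ a ≤ 125) := by
  simp only [countBlocks, setSize, Cmd.Writes, writes_forUp, writes_assign, writes_bsearch] at h
  rcases h with h | h | h | h | (h | h | h | h) | h
  any_goals omega
  have := writes_blockTest h
  omega

theorem realFree_countBlocks (tst : BExp) : (countBlocks tst).RealFree := by
  have : (bsearch (blockTest tst)).RealFree :=
    realFree_bsearch (by simp [blockTest, Cmd.RealFree])
  simp [countBlocks, setSize, Cmd.RealFree, this]

theorem countIn_Ico_succ {lo i : ℕ} {S : ℕ → Prop} [Decidable (S (lo + i))] :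
    countIn (Finset.Ico lo (lo + (i + 1))) S =
      countIn (Finset.Ico lo (lo + i)) S + if S (lo + i) then 1 else 0 := by
  classical
  rw [countIn, countIn, ← add_assoc,
    ← Finset.insert_Ico_right_eq_Ico_add_one (Nat.le_add_right _ _), Finset.filter_insert]
  split_ifs with h
  · rw [Finset.card_insert_of_notMem (by simp)]
  · rfl

/-- The blocks are sorted in the array `aBo`. -/
def Sorted (D : Inst) (key : ℕ → ℝ) (s : Store) : Prop :=
  ∀ k, ∀ i < blockLen D.nQ D.B k, s.words aBo (k * D.B + i) ∈ block D.nQ D.B k ∧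
    rank key (block D.nQ D.B k) (s.words aBo (k * D.B + i)) = i

section Ranking

variable {w l : ℕ} {D : Inst} {s : Store} {K : WExp → RExp} {key : ℕ → ℝ}

theorem Inst.Sizes.mul_lt (h : D.Sizes w l) {k : ℕ} (hk : k ≤ D.b) :
    k * D.B + D.B < 2 ^ w := by
  have h1 := h.blocks
  have h2 : k * D.B ≤ D.b * D.B := Nat.mul_le_mul_right _ hk
  have h3 : (D.b + 1) * (D.B + 1) = D.b * D.B + D.b + D.B + 1 := by ring
  omega

theorem Inst.Sizes.base_lt (h : D.Sizes w l) : D.b < 2 ^ w := by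
  have h1 := h.blocks
  have h3 : (D.b + 1) * (D.B + 1) = D.b * D.B + D.b + D.B + 1 := by ring
  omega

theorem blockLen_le {n B k : ℕ} : blockLen n B k ≤ B ∧ blockLen n B k ≤ n := by
  unfold blockLen; omega

/-- Sorting within the blocks takes `O(D.B)` for each element. -/
theorem run_sortBlocks (hsz : D.Sizes w l) (hbase : Base l D s) (hK : Gives w s.reals K D.nQ key)
    (hcost : (lexTest K (var vE) (var vQ)).cost ≤ 100) :
    Run w (sortBlocks K) s (fun t s' => t ≤ D.nQ * (D.B * 150 + 100) + 20 ∧ Sorted D key s') := by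
  classical
  have hB := hsz.width
  have hone : 1 % 2 ^ w = 1 := Nat.mod_eq_of_lt (by have := hsz.const; omega)
  have hsize := hsz.size
  have hwords := hsz.words
  -- The place of `q` in the array of sorted blocks; different elements have different places.
  let pos : ℕ → ℕ := fun q => q / D.B * D.B + rank key (block D.nQ D.B (q / D.B)) q
  have hrk : ∀ q < D.nQ, rank key (block D.nQ D.B (q / D.B)) q < blockLen D.nQ D.B (q / D.B) := by
    intro q hq
    rw [← card_block]
    exact rank_lt_card ((mem_block hB).2 ⟨hq, rfl⟩)
  have hrkB : ∀ q < D.nQ, rank key (block D.nQ D.B (q / D.B)) q < D.B := fun q hq =>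
    (hrk q hq).trans_le blockLen_le.1
  have hinj : ∀ q < D.nQ, ∀ q' < D.nQ, pos q = pos q' → q = q' := by
    intro q hq q' hq' he
    have hd : ∀ q < D.nQ, pos q / D.B = q / D.B := by
      intro q hq
      have := hrkB q hq
      simp only [pos]
      rw [mul_comm, Nat.mul_add_div hB, Nat.div_eq_of_lt this, add_zero]
    have h1 : q / D.B = q' / D.B := by rw [← hd q hq, he, hd q' hq']
    simp only [pos, h1] at he
    exact rank_injOn (key := key) ((mem_block hB).2 ⟨hq, h1⟩) ((mem_block hB).2 ⟨hq', rfl⟩)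
      (by omega)
  refine ((Run.forUp_const (N := D.nQ)
    (fun m s₁ => s₁.reals = s.reals ∧
      (∀ a, ¬ (a = vQ ∨ (120 ≤ a ∧ a ≤ 127)) → s₁.words a = s.words a) ∧
      ∀ q < m, s₁.words aBo (pos q) = q)
    (D.B * 150 + 80) (by omega) ?_ ?_ ?_ ?_ ?_).mono ?_)
  · intro h
    simp only [setSize, Cmd.Writes, writes_forUp, writes_assign, or_false] at h
    omega
  · rintro m s₁ ⟨-, hfr, -⟩
    rw [eval_var, hfr _ (by omega), hbase.nQ]
  · rintro m s₁ v ⟨hre, hfr, h⟩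
    refine ⟨hre, fun a ha => ?_, ?_⟩
    · rw [words_setWord_of_ne _ _ _ (by omega), hfr a ha]
    · rwa [words_setWord_of_ne _ _ _ (by decide)]
  · exact ⟨rfl, fun _ _ => rfl, by simp⟩
  · rintro m s₁ hm ⟨hre, hfr, hpos⟩ him
    have hb1 : Base l D s₁ := hbase.congr fun a ha => hfr a (by omega)
    have hmb : m / D.B ≤ D.b :=
      ((Nat.div_lt_iff_lt_mul hB).2 (hm.trans hsz.slab)).le
    have hlt := hsz.mul_lt hmb
    set lo := m / D.B * D.B with hlo
    set L := blockLen D.nQ D.B (m / D.B) with hL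
    have hLB : L ≤ D.B := blockLen_le.1
    refine Run.seq (Run.assign (Run.seq (Run.assign (Run.seq (Run.assign ?_)))))
    set s₂ := s₁.setWord vRk 0 (WExp.eval w s₁ (.lit 0)) with hs₂
    have fr2 : ∀ a, a ≠ vRk → s₂.words a = s₁.words a := fun a ha => words_setWord_of_ne _ _ _ ha
    have e1 : (WExp.mul (.div (var vQ) (var vWid)) (var vWid)).eval w s₂ = lo := by
      simp only [WExp.eval, eval_var]
      rw [fr2 _ (by decide), fr2 _ (by decide), him, hb1.B]
      exact Nat.mod_eq_of_lt (by omega)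
    rw [e1]
    set s₃ := s₂.setWord vLo 0 lo with hs₃
    have fr3 : ∀ a, a ≠ vRk → a ≠ vLo → s₃.words a = s₁.words a := fun a h1 h2 => by
      rw [hs₃, words_setWord_of_ne _ _ _ h2, fr2 a h1]
    have e2 : (WExp.sub (var vWid) (.sub (var vWid) (.sub (var vNQ) (var vLo)))).eval w s₃ = L := by
      simp only [WExp.eval, eval_var]
      rw [fr3 _ (by decide) (by decide), fr3 _ (by decide) (by decide), hb1.B, hb1.nQ]
      simp [hs₃, words_setWord, hL, blockLen, hlo]
    rw [e2]
    set s₄ := s₃.setWord vSz 0 L with hs₄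
    have fr4 : ∀ a, a ≠ vRk → a ≠ vLo → a ≠ vSz → s₄.words a = s₁.words a := fun a h1 h2 h3 => by
      rw [hs₄, words_setWord_of_ne _ _ _ h3, fr3 a h1 h2]
    have hre4 : s₄.reals = s.reals := hre
    refine Run.seq ((Run.forUp_const (N := L)
      (fun i s₅ => s₅.reals = s.reals ∧
        (∀ a, ¬ (a = vI ∨ a = vE ∨ a = vRk) → s₅.words a = s₄.words a) ∧
        s₅.words vRk 0 = countIn (Finset.Ico lo (lo + i)) fun e => LexLt key e m)
      120 (by omega) ?_ ?_ ?_ ?_ ?_).mono ?_)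
    · intro h
      simp only [Cmd.Writes, writes_assign, or_false] at h
      omega
    · rintro i s₅ ⟨-, hfr5, -⟩
      rw [eval_var, hfr5 _ (by decide)]
      simp [hs₄, words_setWord]
    · rintro i s₅ v ⟨hre5, hfr5, h5⟩
      refine ⟨hre5, fun a ha => ?_, ?_⟩
      · rw [words_setWord_of_ne _ _ _ (by omega), hfr5 a ha]
      · rwa [words_setWord_of_ne _ _ _ (by decide)]
    · refine ⟨hre4, fun _ _ => rfl, ?_⟩
      simp [hs₄, hs₃, hs₂, words_setWord, WExp.eval, countIn]
    · rintro i s₅ hi ⟨hre5, hfr5, h5⟩ hii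
      have e3 : (WExp.add (var vLo) (var vI)).eval w s₅ = lo + i := by
        simp only [WExp.eval, eval_var, hii]
        rw [hfr5 vLo (by decide)]
        have : s₄.words vLo 0 = lo := by simp [hs₄, hs₃, words_setWord]
        rw [this]
        exact Nat.mod_eq_of_lt (by omega)
      refine Run.seq (Run.assign ?_)
      rw [e3]
      set s₆ := s₅.setWord vE 0 (lo + i) with hs₆
      have fr6 : ∀ a, a ≠ vE → s₆.words a = s₅.words a := fun a ha => words_setWord_of_ne _ _ _ ha
      have hq6 : s₆.words vQ 0 = m := by
        rw [fr6 _ (by decide), hfr5 _ (by decide), fr4 _ (by decide) (by decide) (by decide), him]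
      have hin : lo + i < D.nQ := by
        have : lo + i ∈ block D.nQ D.B (m / D.B) := by
          simp only [block, Finset.mem_Ico]; omega
        exact ((mem_block hB).1 this).1
      have hK6 : Gives w s₆.reals K D.nQ key := by
        have : s₆.reals = s.reals := hre5
        rwa [this]
      have htst := holds_lexTest (e := var vE) (f := var vQ) (i := lo + i) (q := m) hK6
        (by simp [hs₆, words_setWord]) (by rw [eval_var, hq6]) hin hm
      have hrk6 : s₆.words vRk = s₅.words vRk := fr6 _ (by decide)
      have hcle : countIn (Finset.Ico lo (lo + i)) (fun e => LexLt key e m) ≤ i := by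
        refine (countIn_le _ _).trans ?_
        simp
      refine Run.cond (fun hb => Run.assign ⟨?_, hre5, ?_, ?_⟩)
        (fun hb => Run.nop ⟨?_, hre5, ?_, ?_⟩)
      · simp only [WExp.cost, cost_var]; omega
      · exact fun a ha => by
          rw [words_setWord_of_ne _ _ _ (by omega), fr6 a (by omega), hfr5 a ha]
      · rw [htst] at hb
        rw [countIn_Ico_succ, if_pos hb]
        simp only [words_setWord, and_self, if_true, WExp.eval, eval_var, hrk6, h5, hone]
        exact Nat.mod_eq_of_lt (by omega)
      · simp only [WExp.cost, cost_var]; omega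
      · exact fun a ha => by rw [fr6 a (by omega), hfr5 a ha]
      · rw [htst] at hb
        rw [countIn_Ico_succ, if_neg hb, hrk6, h5, add_zero]
    · rintro t₅ s₅ ⟨ht₅, hre5, hfr5, h5⟩
      have hr5 : s₅.words vRk 0 = rank key (block D.nQ D.B (m / D.B)) m := h5
      have hlo5 : s₅.words vLo 0 = lo := by
        rw [hfr5 _ (by decide)]; simp [hs₄, hs₃, words_setWord]
      have hq5 : s₅.words vQ 0 = m := by
        rw [hfr5 _ (by decide), fr4 _ (by decide) (by decide) (by decide), him]
      have hrm := hrkB m hm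
      have e4 : (WExp.add (var vLo) (var vRk)).eval w s₅ = pos m := by
        simp only [WExp.eval, eval_var, hr5, hlo5, pos]
        exact Nat.mod_eq_of_lt (by omega)
      refine Run.setWord ⟨?_, hre5, fun a ha => ?_, fun q hq => ?_⟩
      · have : L * (120 + ((var vSz).cost + 11)) ≤ D.B * 150 :=
          Nat.mul_le_mul hLB (by rw [cost_var]; omega)
        simp only [WExp.cost, cost_var] at ht₅ this ⊢
        omega
      · rw [words_setWord_of_ne _ _ _ (by omega), hfr5 a (by omega),
          fr4 a (by omega) (by omega) (by omega), hfr a ha]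
      · rw [e4, eval_var, hq5, words_setWord]
        by_cases he : pos q = pos m
        · rw [if_pos ⟨rfl, he⟩]
          exact (hinj q (by omega) m hm he).symm
        · rw [if_neg (fun h => he h.2), hfr5 _ (by decide),
            fr4 _ (by decide) (by decide) (by decide)]
          have hqm : q ≠ m := fun h => he (by rw [h])
          exact hpos q (by omega)
  · rintro t s' ⟨ht, -, -, hpos⟩
    refine ⟨?_, ?_⟩
    · rw [cost_var] at ht
      have : D.nQ * (D.B * 150 + 80 + (2 + 11)) ≤ D.nQ * (D.B * 150 + 100) :=
        Nat.mul_le_mul_left _ (by omega)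
      exact ht.trans (Nat.add_le_add this (by norm_num))
    · intro k i hi
      obtain ⟨q, hq, hr⟩ := exists_rank_eq (key := key) (A := block D.nQ D.B k)
        (by rw [card_block]; exact hi)
      obtain ⟨hqn, rfl⟩ := (mem_block hB).1 hq
      have := hpos q hqn
      simp only [pos, hr] at this
      rw [this]
      exact ⟨hq, hr⟩

/-- A bound for the time of `countBlocks`. -/
def countTime (l b : ℕ) : ℕ := b * ((l + 1) * 180 + 100) + 30

/-- Counting takes a binary search for each of the `D.b` blocks. -/
theorem run_countBlocks (hsz : D.Sizes w l) (hbase : Base l D s) (hsort : Sorted D key s)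
    {tst : BExp} (hcost : tst.cost ≤ 100) {S : ℕ → Prop} (hS : DownClosed key S)
    (htst : ∀ s' : Store, s'.reals = s.reals →
      (∀ a, ¬ ((70 ≤ a ∧ a ≤ 73) ∨ (121 ≤ a ∧ a ≤ 125)) → s'.words a = s.words a) →
      ∀ e < D.nQ, s'.words vE 0 = e → (tst.Holds w s' ↔ S e)) :
    Run w (countBlocks tst) s (fun t s' => t ≤ countTime l D.b ∧
      s'.words vCt 0 = countIn (Finset.range D.nQ) S) := by
  have hB := hsz.width
  have h1024 := hsz.const
  have hone : 1 % 2 ^ w = 1 := Nat.mod_eq_of_lt (by omega)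
  have hsize := hsz.size
  have hwords := hsz.words
  have hpow : 2 ^ (l + 1) = 2 * 2 ^ l := by rw [pow_succ]; ring
  have htot : ∀ k ≤ D.b, ∑ i ∈ Finset.range k, countIn (block D.nQ D.B i) S ≤ D.nQ := by
    intro k hk
    calc _ ≤ ∑ i ∈ Finset.range D.b, countIn (block D.nQ D.B i) S :=
          Finset.sum_le_sum_of_subset (Finset.range_mono hk)
      _ = countIn (Finset.range D.nQ) S := sum_countIn_block hB hsz.slab S
      _ ≤ D.nQ := by simpa using countIn_le (Finset.range D.nQ) S
  refine Run.seq (Run.assign ?_)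
  have e0 : (WExp.lit 0).eval w s = 0 := Nat.zero_mod _
  rw [e0]
  refine (Run.forUp_const (N := D.b)
    (fun k s₁ => s₁.reals = s.reals ∧
      (∀ a, ¬ ((70 ≤ a ∧ a ≤ 73) ∨ (121 ≤ a ∧ a ≤ 125)) → s₁.words a = s.words a) ∧
      s₁.words vCt 0 = ∑ i ∈ Finset.range k, countIn (block D.nQ D.B i) S)
    ((l + 1) * 180 + 60) hsz.base_lt ?_ ?_ ?_ ?_ ?_).mono ?_
  · intro h
    simp only [setSize, Cmd.Writes, writes_assign, writes_bsearch] at h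
    rcases h with h | h | (h | h | h | h) | h
    any_goals omega
    have := writes_blockTest h
    omega
  · rintro k s₁ ⟨-, hfr, -⟩
    rw [eval_var, hfr _ (by omega), hbase.b]
  · rintro k s₁ v ⟨hre, hfr, h⟩
    refine ⟨hre, fun a ha => ?_, ?_⟩
    · rw [words_setWord_of_ne _ _ _ (by omega), hfr a ha]
    · rwa [words_setWord_of_ne _ _ _ (by decide)]
  · refine ⟨rfl, fun a ha => words_setWord_of_ne _ _ _ (by omega), ?_⟩
    simp [words_setWord]
  · rintro k s₁ hk ⟨hre, hfr, hsum⟩ hik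
    have hb1 : Base l D s₁ := hbase.congr fun a ha => hfr a (by omega)
    have hlt := hsz.mul_lt hk.le
    set L := blockLen D.nQ D.B k with hL
    have hLB : L ≤ D.B := blockLen_le.1
    have hLQ : L ≤ D.nQ := blockLen_le.2
    refine Run.seq (Run.assign (Run.seq (Run.assign ?_)))
    have e1 : (WExp.mul (var vBk) (var vWid)).eval w s₁ = k * D.B := by
      simp only [WExp.eval, eval_var, hik, hb1.B]
      exact Nat.mod_eq_of_lt (by omega)
    rw [e1]
    set s₂ := s₁.setWord vLo 0 (k * D.B) with hs₂
    have fr2 : ∀ a, a ≠ vLo → s₂.words a = s₁.words a := fun a ha => words_setWord_of_ne _ _ _ ha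
    have e2 : (WExp.sub (var vWid) (.sub (var vWid) (.sub (var vNQ) (var vLo)))).eval w s₂ = L := by
      simp only [WExp.eval, eval_var]
      rw [fr2 _ (by decide), fr2 _ (by decide), hb1.B, hb1.nQ]
      simp [hs₂, words_setWord, hL, blockLen]
    rw [e2]
    set s₃ := s₂.setWord vSz 0 L with hs₃
    have fr3 : ∀ a, ¬ (a = vLo ∨ a = vSz) → s₃.words a = s₁.words a := fun a ha => by
      rw [hs₃, words_setWord_of_ne _ _ _ (by omega), fr2 a (by omega)]
    have hre3 : s₃.reals = s.reals := hre
    have hlo3 : s₃.words vLo 0 = k * D.B := by simp [hs₃, hs₂, words_setWord]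
    have hsz3 : s₃.words vSz 0 = L := by simp [hs₃, words_setWord]
    have hbo3 : ∀ x, s₃.words aBo x = s.words aBo x := fun x => by
      rw [fr3 _ (by decide), hfr _ (by decide)]
    let elem : ℕ → ℕ := fun i => s.words aBo (k * D.B + i)
    have helem : ∀ i < (block D.nQ D.B k).card, elem i ∈ block D.nQ D.B k ∧
        rank key (block D.nQ D.B k) (elem i) = i :=
      fun i hi => hsort k i (by rwa [card_block] at hi)
    have hdown : ∀ i i', i ≤ i' → i' < L → S (elem i') → S (elem i) := by
      intro i i' hii hi' h
      obtain ⟨h1, h2⟩ := helem i (by rw [card_block]; omega)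
      obtain ⟨h3, h4⟩ := helem i' (by rw [card_block]; omega)
      rw [← rank_lt_countIn hS h1, h2]
      have := (rank_lt_countIn hS h3).2 h
      omega
    have hrf : (blockTest tst).RealFree := by simp [blockTest, Cmd.RealFree]
    have hw : ¬ (blockTest tst).Writes vBv ∧ ¬ (blockTest tst).Writes vBs ∧
        ¬ (blockTest tst).Writes vBc := by
      refine ⟨fun h => ?_, fun h => ?_, fun h => ?_⟩ <;>
        (have := writes_blockTest h; omega)
    refine Run.seq (((run_bsearch (w := w) (s := s₃) (l := l) (T := 130)
      (fun v => v ≤ L ∧ ∀ i < v, S (elem i)) (by omega) (by omega)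
      (by rw [fr3 _ (by decide)]; exact hb1.half) hrf hw
      ⟨Nat.zero_le _, by simp⟩ (by omega) ?_).frame_reals (realFree_bsearch hrf)).mono ?_)
    · intro s₄ c hre4 hfr4 hc hc1 hc2
      have fr4 : ∀ a, ¬ ((70 ≤ a ∧ a ≤ 73) ∨ a = vE) → s₄.words a = s₃.words a := fun a ha =>
        hfr4 a (fun h => by have := writes_blockTest h; omega) (by omega) (by omega) (by omega)
      have hbc : (BExp.wordLe (var vBc) (var vSz)).cost = 5 := rfl
      have hl0 : (WExp.lit 0).cost = 1 := rfl
      have hl1 : (WExp.lit 1).cost = 1 := rfl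
      have hle : (WExp.get aBo (.sub (.add (var vLo) (var vBc)) (.lit 1))).cost = 8 := rfl
      refine Run.cond (fun hb => Run.seq (Run.assign ?_)) (fun hb => Run.assign ⟨by omega, ?_⟩)
      · simp only [BExp.Holds, eval_var, hc] at hb
        rw [fr4 _ (by decide), hsz3] at hb
        have e3 : (WExp.get aBo (.sub (.add (var vLo) (var vBc)) (.lit 1))).eval w s₄ =
            elem (c - 1) := by
          simp only [WExp.eval, eval_var, hc, hone]
          rw [fr4 _ (by decide), fr4 _ (by decide), hlo3, hbo3, Nat.mod_eq_of_lt (by omega),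
            Nat.add_sub_assoc hc1]
        rw [e3]
        set s₅ := s₄.setWord vE 0 (elem (c - 1)) with hs₅
        have hmem := (helem (c - 1) (by rw [card_block]; omega)).1
        have hiff := htst s₅ (by rw [hs₅, reals_setWord, hre4, hre3]) (fun a ha => by
          rw [hs₅, words_setWord_of_ne _ _ _ (by omega), fr4 a (by omega), fr3 a (by omega),
            hfr a ha]) (elem (c - 1)) ((mem_block hB).1 hmem).1 (by simp [hs₅, words_setWord])
        have hp : S (elem (c - 1)) ↔ c ≤ L ∧ ∀ i < c, S (elem i) :=
          ⟨fun h => ⟨hb, fun i hi => hdown i (c - 1) (by omega) (by omega) h⟩,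
            fun h => h.2 _ (by omega)⟩
        refine Run.cond (fun hb' => Run.assign ⟨by omega, ?_⟩)
          (fun hb' => Run.assign ⟨by omega, ?_⟩)
        · rw [hiff, hp] at hb'
          simp only [words_setWord, and_self, if_true, WExp.eval, hone, le_refl, true_iff]
          exact hb'
        · rw [hiff, hp] at hb'
          simp only [words_setWord, and_self, if_true, WExp.eval, Nat.zero_mod]
          exact iff_of_false (by omega) hb'
      · simp only [BExp.Holds, eval_var, hc] at hb
        rw [fr4 _ (by decide), hsz3] at hb
        simp only [words_setWord, and_self, if_true, WExp.eval, Nat.zero_mod]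
        exact iff_of_false (by omega) fun h => hb h.1
    · rintro t₄ s₄ ⟨⟨ht₄, hp1, hp2, hp3⟩, hre4, hfr4⟩
      have fr4 : ∀ a, ¬ ((70 ≤ a ∧ a ≤ 73) ∨ a = vE) → s₄.words a = s₃.words a := fun a ha =>
        hfr4 a (fun h => by
          rcases writes_bsearch.1 h with h | h | h | h
          any_goals omega
          have := writes_blockTest h
          omega)
      have hv : countIn (block D.nQ D.B k) S = s₄.words vBv 0 := by
        refine countIn_eq hS helem (by rw [card_block]; exact hp1.1) hp1.2 fun hlt h => hp2 ?_
        rw [card_block] at hlt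
        refine ⟨hlt, fun i hi => ?_⟩
        rcases Nat.lt_succ_iff_lt_or_eq.1 hi with h' | rfl
        · exact hp1.2 i h'
        · exact h
      have hct : s₄.words vCt 0 = ∑ i ∈ Finset.range k, countIn (block D.nQ D.B i) S := by
        rw [fr4 _ (by decide), fr3 _ (by decide), hsum]
      have hle := htot (k + 1) hk
      rw [Finset.sum_range_succ] at hle
      refine Run.assign ⟨?_, ?_, fun a ha => ?_, ?_⟩
      · have : (l + 1) * (130 + 30) + (l + 1) * 20 = (l + 1) * 180 := by ring
        simp only [WExp.cost, cost_var]
        omega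
      · rw [reals_setWord, hre4, hre3]
      · rw [words_setWord_of_ne _ _ _ (by omega), fr4 a (by omega), fr3 a (by omega), hfr a ha]
      · simp only [words_setWord, and_self, if_true, WExp.eval, eval_var, hct, ← hv,
          Finset.sum_range_succ]
        exact Nat.mod_eq_of_lt (by omega)
  · rintro t s' ⟨ht, -, -, hct⟩
    refine ⟨?_, by rw [hct, sum_countIn_block hB hsz.slab]⟩
    rw [cost_var] at ht
    have h0 : (WExp.lit 0).cost = 1 := rfl
    have : D.b * ((l + 1) * 180 + 60 + (2 + 11)) ≤ D.b * ((l + 1) * 180 + 100) :=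
      Nat.mul_le_mul_left _ (by omega)
    unfold countTime
    omega

end Ranking

/-- Coordinate number `j` of cube number `i` on the side of `Q`, for cubes stored in `f`: the lower
ends of the three intervals and, with opposite signs, the upper ends. -/
noncomputable def lowVal (f : ℕ → ℝ) (j i : ℕ) : ℝ :=
  if j < 3 then f (4 * i + j) else 0 - (f (4 * i + (j - 3)) + f (4 * i + 3))

/-- Coordinate number `j` of cube number `i` on the side of `P` and `R`: the upper ends of the three
intervals and, with opposite signs, the lower ends. -/
noncomputable def highVal (f : ℕ → ℝ) (j i : ℕ) : ℝ :=
  if j < 3 then f (4 * i + j) + f (4 * i + 3) else 0 - f (4 * i + (j - 3))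

/-- Number `m` of the four numbers of cube number `e`. -/
def field (arr : ℕ) (e : WExp) (m : ℕ) : RExp := .get arr (.add (.mul (.lit 4) e) (.lit m))

/-- The expression for `lowVal`. -/
def lowKey (arr j : ℕ) (e : WExp) : RExp :=
  if j < 3 then field arr e j
  else .sub (.ofWord (.lit 0)) (.add (field arr e (j - 3)) (field arr e 3))

/-- The expression for `highVal`. -/
def highKey (arr j : ℕ) (e : WExp) : RExp :=
  if j < 3 then .add (field arr e j) (field arr e 3)
  else .sub (.ofWord (.lit 0)) (field arr e (j - 3))

theorem eval_field {w n m i : ℕ} {arr : ℕ} {s : Store} {e : WExp} (hw : 4 * n + 4 ≤ 2 ^ w)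
    (he : e.eval w s = i) (hi : i < n) (hm : m < 4) :
    (field arr e m).eval w s = s.reals arr (4 * i + m) := by
  simp only [field, RExp.eval, WExp.eval, he]
  rw [Nat.mod_eq_of_lt (show 4 < 2 ^ w by omega), Nat.mod_eq_of_lt (show m < 2 ^ w by omega),
    Nat.mod_eq_of_lt (show 4 * i < 2 ^ w by omega), Nat.mod_eq_of_lt (by omega)]

theorem gives_lowKey {w n arr j : ℕ} {R : ℕ → ℕ → ℝ} (hw : 4 * n + 4 ≤ 2 ^ w) (hj : j < 6) :
    Gives w R (lowKey arr j) n (lowVal (R arr) j) := by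
  rintro s rfl e i he hi
  unfold lowKey lowVal
  split_ifs with h
  · rw [eval_field hw he hi (by omega)]
  · rw [RExp.eval, RExp.eval, RExp.eval, eval_field hw he hi (by omega),
      eval_field hw he hi (by omega)]
    simp [WExp.eval]

theorem gives_highKey {w n arr j : ℕ} {R : ℕ → ℕ → ℝ} (hw : 4 * n + 4 ≤ 2 ^ w) (hj : j < 6) :
    Gives w R (highKey arr j) n (highVal (R arr) j) := by
  rintro s rfl e i he hi
  unfold highKey highVal
  split_ifs with h
  · rw [RExp.eval, eval_field hw he hi (by omega), eval_field hw he hi (by omega)]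
  · rw [RExp.eval, RExp.eval, eval_field hw he hi (by omega)]
    simp [WExp.eval]

open Classical in
/-- The instance given by three lists of cubes that are stored in the real arrays. -/
noncomputable def rankedInst (R : ℕ → ℕ → ℝ) (nP nQ nR b B : ℕ) : Inst where
  nP := nP
  nQ := nQ
  nR := nR
  b := b
  B := B
  pos := fun j q => rank (lowVal (R 1) j) (Finset.range nQ) q
  ord := fun j k =>
    if h : ∃ q < nQ, rank (lowVal (R 1) j) (Finset.range nQ) q = k then h.choose else 0
  cP := fun j p => countIn (Finset.range nQ) fun e => lowVal (R 1) j e ≤ highVal (R 0) j p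
  cR := fun j r => countIn (Finset.range nQ) fun e => lowVal (R 1) j e ≤ highVal (R 2) j r

theorem rankedInst_ord_spec {R : ℕ → ℕ → ℝ} {nP nQ nR b B j k : ℕ} (hk : k < nQ) :
    (rankedInst R nP nQ nR b B).ord j k < nQ ∧
      rank (lowVal (R 1) j) (Finset.range nQ) ((rankedInst R nP nQ nR b B).ord j k) = k := by
  have h : ∃ q < nQ, rank (lowVal (R 1) j) (Finset.range nQ) q = k := by
    obtain ⟨q, hq, hr⟩ := exists_rank_eq (key := lowVal (R 1) j) (A := Finset.range nQ)
      (by rwa [Finset.card_range])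
    exact ⟨q, Finset.mem_range.1 hq, hr⟩
  simp only [rankedInst, dif_pos h]
  exact h.choose_spec

theorem rankedInst_ord_rank {R : ℕ → ℕ → ℝ} {nP nQ nR b B j q : ℕ} (hq : q < nQ) :
    (rankedInst R nP nQ nR b B).ord j (rank (lowVal (R 1) j) (Finset.range nQ) q) = q := by
  have hlt : rank (lowVal (R 1) j) (Finset.range nQ) q < nQ := by
    simpa using rank_lt_card (key := lowVal (R 1) j) (Finset.mem_range.2 hq)
  obtain ⟨h1, h2⟩ := rankedInst_ord_spec (R := R) (nP := nP) (nR := nR) (b := b) (B := B)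
    (j := j) hlt
  exact rank_injOn (Finset.mem_range.2 h1) (Finset.mem_range.2 hq) h2

theorem rankedInst_valid {R : ℕ → ℕ → ℝ} {nP nQ nR b B w l : ℕ}
    (h : (rankedInst R nP nQ nR b B).Sizes w l) : (rankedInst R nP nQ nR b B).Valid l where
  size := h.size
  width := h.width
  slab := h.slab
  pos_lt := fun j _ q hq => by
    simpa [rankedInst] using rank_lt_card (key := lowVal (R 1) j) (Finset.mem_range.2 hq)
  ord_lt := fun j _ k hk => (rankedInst_ord_spec hk).1
  pos_ord := fun j _ k hk => (rankedInst_ord_spec hk).2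
  ord_pos := fun j _ q hq => rankedInst_ord_rank hq
  cP_le := fun j _ p _ => by
    simpa [rankedInst] using countIn_le (Finset.range nQ) _
  cR_le := fun j _ p _ => by
    simpa [rankedInst] using countIn_le (Finset.range nQ) _

/-- Compute the ranks of the elements of `Q` in the coordinate `j`. -/
def rankQ (j : ℕ) : Cmd :=
  forUp vQ (var vNQ) (.seq (countBlocks (lexTest (lowKey 1 j) (var vE) (var vQ)))
    (.seq (.setWord (aPos + j) (var vQ) (var vCt)) (.setWord (aOrd + j) (var vCt) (var vQ))))

/-- Compute the numbers of elements of `Q` below the elements of an outer set. -/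
def rankOuter (v arr α j : ℕ) : Cmd :=
  forUp vP (var v) (.seq (countBlocks (.realLe (lowKey 1 j (var vE)) (highKey arr j (var vP))))
    (.setWord (α + j) (var vP) (var vCt)))

/-- Compute all ranks in the coordinate `j`. -/
def rankCoord (j : ℕ) : Cmd :=
  .seq (sortBlocks (lowKey 1 j)) (.seq (rankQ j)
    (.seq (rankOuter vNP 0 40 j) (rankOuter vNR 2 50 j)))

/-- Compute all ranks in the first `j` coordinates. -/
def rankUpTo : ℕ → Cmd
  | 0 => .nop
  | j + 1 => .seq (rankUpTo j) (rankCoord j)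

theorem writes_rankQ {j a : ℕ} (h : (rankQ j).Writes a) :
    (70 ≤ a ∧ a ≤ 73) ∨ (121 ≤ a ∧ a ≤ 125) ∨ a = vQ ∨ a = aPos + j ∨ a = aOrd + j := by
  rw [rankQ, writes_forUp] at h
  rcases h with h | h | h | h
  · omega
  · have := writes_countBlocks h; omega
  · simp only [Cmd.Writes] at h; omega
  · simp only [Cmd.Writes] at h; omega

theorem writes_rankOuter {v arr α j a : ℕ} (h : (rankOuter v arr α j).Writes a) :
    (70 ≤ a ∧ a ≤ 73) ∨ (121 ≤ a ∧ a ≤ 125) ∨ a = vP ∨ a = α + j := by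
  rw [rankOuter, writes_forUp] at h
  rcases h with h | h | h
  · omega
  · have := writes_countBlocks h; omega
  · simp only [Cmd.Writes] at h; omega

theorem realFree_rankQ (j : ℕ) : (rankQ j).RealFree := by
  simp [rankQ, Cmd.RealFree, realFree_countBlocks]

theorem realFree_rankOuter (v arr α j : ℕ) : (rankOuter v arr α j).RealFree := by
  simp [rankOuter, Cmd.RealFree, realFree_countBlocks]

theorem writes_rankCoord {j a : ℕ} (h : (rankCoord j).Writes a) :
    (70 ≤ a ∧ a ≤ 73) ∨ (120 ≤ a ∧ a ≤ 127) ∨ a = vQ ∨ a = vP ∨ a = 20 + j ∨ a = 30 + j ∨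
      a = 40 + j ∨ a = 50 + j := by
  rcases h with h | h | h | h
  · have := writes_sortBlocks h; omega
  · have := writes_rankQ h; omega
  · have := writes_rankOuter h; omega
  · have := writes_rankOuter h; omega

theorem writes_rankUpTo {a : ℕ} : ∀ {j : ℕ}, (rankUpTo j).Writes a →
    (70 ≤ a ∧ a ≤ 73) ∨ (120 ≤ a ∧ a ≤ 127) ∨ a = vQ ∨ a = vP ∨ (20 ≤ a ∧ a < 50 + j)
  | 0, h => h.elim
  | j + 1, h => by
    rcases h with h | h
    · have := writes_rankUpTo h; omega
    · have := writes_rankCoord h; omega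

theorem realFree_rankCoord (j : ℕ) : (rankCoord j).RealFree :=
  ⟨realFree_sortBlocks _, realFree_rankQ _, realFree_rankOuter _ _ _ _, realFree_rankOuter _ _ _ _⟩

theorem realFree_rankUpTo : ∀ j, (rankUpTo j).RealFree
  | 0 => trivial
  | j + 1 => ⟨realFree_rankUpTo j, realFree_rankCoord j⟩

theorem cost_rankTests {arr j : ℕ} (hj : j < 6) :
    (lexTest (lowKey 1 j) (var vE) (var vQ)).cost ≤ 100 ∧
      (BExp.realLe (lowKey 1 j (var vE)) (highKey arr j (var vP))).cost ≤ 100 := by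
  interval_cases j <;> exact ⟨Nat.le_of_ble_eq_true rfl, Nat.le_of_ble_eq_true rfl⟩

section Ranking

variable {w l j : ℕ} {D : Inst} {s : Store}

theorem run_rankQ (hsz : D.Sizes w l) (hw : 4 * D.nQ + 4 ≤ 2 ^ w) (hbase : Base l D s)
    (hj : j < 6) (hsort : Sorted D (lowVal (s.reals 1) j) s) :
    Run w (rankQ j) s (fun t s' => t ≤ D.nQ * (countTime l D.b + 30) + 20 ∧
      ∀ q < D.nQ, s'.words (aPos + j) q = rank (lowVal (s.reals 1) j) (Finset.range D.nQ) q ∧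
        s'.words (aOrd + j) (rank (lowVal (s.reals 1) j) (Finset.range D.nQ) q) = q) := by
  have hsize := hsz.size
  have hwords := hsz.words
  set key := lowVal (s.reals 1) j with hkey
  set rk := rank key (Finset.range D.nQ) with hrk
  have hinj : ∀ q < D.nQ, ∀ q' < D.nQ, rk q = rk q' → q = q' := fun q hq q' hq' h =>
    rank_injOn (Finset.mem_range.2 hq) (Finset.mem_range.2 hq') h
  let W : ℕ → Prop := fun a => (70 ≤ a ∧ a ≤ 73) ∨ (121 ≤ a ∧ a ≤ 125) ∨ a = vQ ∨ a = aPos + j ∨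
    a = aOrd + j
  refine (Run.forUp_const (N := D.nQ)
    (fun m s₁ => s₁.reals = s.reals ∧ (∀ a, ¬ W a → s₁.words a = s.words a) ∧
      ∀ q < m, s₁.words (aPos + j) q = rk q ∧ s₁.words (aOrd + j) (rk q) = q)
    (countTime l D.b + 10) (by omega) ?_ ?_ ?_ ?_ ?_).mono ?_
  · rintro (h | h | h)
    · have := writes_countBlocks h; omega
    · simp only [Cmd.Writes] at h; omega
    · simp only [Cmd.Writes] at h; omega
  · rintro m s₁ ⟨-, hfr, -⟩
    rw [eval_var, hfr _ (by simp only [W]; omega), hbase.nQ]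
  · rintro m s₁ v ⟨hre, hfr, h⟩
    refine ⟨hre, fun a ha => ?_, ?_⟩
    · rw [words_setWord_of_ne _ _ _ (by simp only [W] at ha; omega), hfr a ha]
    · rwa [words_setWord_of_ne _ _ _ (by omega), words_setWord_of_ne _ _ _ (by omega)]
  · exact ⟨rfl, fun _ _ => rfl, by simp⟩
  · rintro m s₁ hm ⟨hre, hfr, hold⟩ him
    refine Run.seq (((run_countBlocks (key := key) hsz
      (hbase.congr fun a ha => hfr a (by simp only [W]; omega))
      (by unfold Sorted; rw [hfr _ (by simp only [W]; omega)]; exact hsort)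
      (cost_rankTests (arr := 0) hj).1
      (downClosed_lexLt key m) ?_).frame_reals (realFree_countBlocks _)).mono ?_)
    · intro s' hre' hfr' e he hve
      refine holds_lexTest (n := D.nQ) ?_ (by rw [eval_var, hve])
        (by rw [eval_var, hfr' _ (by omega), him]) he hm
      rw [hre', hre]
      exact gives_lowKey hw hj
    · rintro t s₂ ⟨⟨ht, hct⟩, hre2, hfr2⟩
      have hct' : s₂.words vCt 0 = rk m := hct
      have fr2 : ∀ a, ¬ ((70 ≤ a ∧ a ≤ 73) ∨ (121 ≤ a ∧ a ≤ 125)) → s₂.words a = s₁.words a :=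
        fun a ha => hfr2 a fun h => ha (writes_countBlocks h)
      have hq2 : s₂.words vQ 0 = m := by rw [fr2 _ (by omega), him]
      refine Run.seq (Run.setWord (Run.setWord ⟨?_, ?_, fun a ha => ?_, fun q hq => ?_⟩))
      · simp only [cost_var]; omega
      · rw [reals_setWord, reals_setWord, hre2, hre]
      · simp only [W] at ha
        rw [words_setWord_of_ne _ _ _ (by omega), words_setWord_of_ne _ _ _ (by omega),
          fr2 a (by omega), hfr a (by simp only [W]; omega)]
      · simp only [eval_var]
        rw [words_setWord_of_ne _ _ _ (show aPos + j ≠ aOrd + j by omega), words_setWord,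
          words_setWord, words_setWord_of_ne _ _ _ (show vCt ≠ aPos + j by omega),
          words_setWord_of_ne _ _ _ (show vQ ≠ aPos + j by omega),
          words_setWord_of_ne _ _ _ (show aOrd + j ≠ aPos + j by omega), hct', hq2,
          fr2 _ (by omega), fr2 _ (by omega)]
        by_cases he : q = m
        · subst he
          simp
        · rw [if_neg (by tauto), if_neg (fun h => he (hinj q (by omega) m hm h.2))]
          exact hold q (by omega)
  · rintro t s' ⟨ht, -, -, h⟩
    refine ⟨?_, h⟩
    rw [cost_var] at ht
    have : D.nQ * (countTime l D.b + 10 + (2 + 11)) ≤ D.nQ * (countTime l D.b + 30) :=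
      Nat.mul_le_mul_left _ (by omega)
    exact ht.trans (Nat.add_le_add this (by norm_num))

theorem run_rankOuter {v arr α n : ℕ} (hsz : D.Sizes w l) (hw : 4 * D.nQ + 4 ≤ 2 ^ w)
    (hn : 4 * n + 4 ≤ 2 ^ w) (hv : v < 10) (hα : 40 ≤ α ∧ α ≤ 50) (hbase : Base l D s)
    (hnv : s.words v 0 = n) (hj : j < 6) (hsort : Sorted D (lowVal (s.reals 1) j) s) :
    Run w (rankOuter v arr α j) s (fun t s' => t ≤ n * (countTime l D.b + 30) + 20 ∧
      ∀ p < n, s'.words (α + j) p = countIn (Finset.range D.nQ) fun e =>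
        lowVal (s.reals 1) j e ≤ highVal (s.reals arr) j p) := by
  set key := lowVal (s.reals 1) j with hkey
  let W : ℕ → Prop := fun a => (70 ≤ a ∧ a ≤ 73) ∨ (121 ≤ a ∧ a ≤ 125) ∨ a = vP ∨ a = α + j
  refine (Run.forUp_const (N := n)
    (fun m s₁ => s₁.reals = s.reals ∧ (∀ a, ¬ W a → s₁.words a = s.words a) ∧
      ∀ p < m, s₁.words (α + j) p = countIn (Finset.range D.nQ) fun e =>
        key e ≤ highVal (s.reals arr) j p)
    (countTime l D.b + 10) (by omega) ?_ ?_ ?_ ?_ ?_).mono ?_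
  · rintro (h | h)
    · have := writes_countBlocks h; omega
    · simp only [Cmd.Writes] at h; omega
  · rintro m s₁ ⟨-, hfr, -⟩
    rw [eval_var, hfr _ (by simp only [W]; omega), hnv]
  · rintro m s₁ v ⟨hre, hfr, h⟩
    refine ⟨hre, fun a ha => ?_, ?_⟩
    · rw [words_setWord_of_ne _ _ _ (by simp only [W] at ha; omega), hfr a ha]
    · rwa [words_setWord_of_ne _ _ _ (by omega)]
  · exact ⟨rfl, fun _ _ => rfl, by simp⟩
  · rintro m s₁ hm ⟨hre, hfr, hold⟩ him
    refine Run.seq (((run_countBlocks (key := key) hsz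
      (hbase.congr fun a ha => hfr a (by simp only [W]; omega))
      (by unfold Sorted; rw [hfr _ (by simp only [W]; omega)]; exact hsort)
      (cost_rankTests (arr := arr) hj).2
      (downClosed_le key (highVal (s.reals arr) j m)) ?_).frame_reals
        (realFree_countBlocks _)).mono ?_)
    · intro s' hre' hfr' e he hve
      have hre'' : s'.reals = s.reals := hre'.trans hre
      rw [BExp.Holds, gives_lowKey hw hj s' hre'' (var vE) e (by rw [eval_var, hve]) he,
        gives_highKey hn hj s' hre'' (var vP) m (by rw [eval_var, hfr' _ (by omega), him]) hm]
    · rintro t s₂ ⟨⟨ht, hct⟩, hre2, hfr2⟩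
      have fr2 : ∀ a, ¬ ((70 ≤ a ∧ a ≤ 73) ∨ (121 ≤ a ∧ a ≤ 125)) → s₂.words a = s₁.words a :=
        fun a ha => hfr2 a fun h => ha (writes_countBlocks h)
      have hp2 : s₂.words vP 0 = m := by rw [fr2 _ (by omega), him]
      refine Run.setWord ⟨?_, ?_, fun a ha => ?_, fun p hp => ?_⟩
      · simp only [cost_var]; omega
      · rw [reals_setWord, hre2, hre]
      · simp only [W] at ha
        rw [words_setWord_of_ne _ _ _ (by omega), fr2 a (by omega), hfr a (by simp only [W]; omega)]
      · simp only [eval_var]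
        rw [words_setWord, hct, hp2, fr2 _ (by omega)]
        by_cases he : p = m
        · subst he
          simp
        · rw [if_neg (by tauto)]
          exact hold p (by omega)
  · rintro t s' ⟨ht, -, -, h⟩
    refine ⟨?_, h⟩
    rw [cost_var] at ht
    have : n * (countTime l D.b + 10 + (2 + 11)) ≤ n * (countTime l D.b + 30) :=
      Nat.mul_le_mul_left _ (by omega)
    exact ht.trans (Nat.add_le_add this (by norm_num))

/-- The first `m` coordinates of the instance `D` are in the memory. -/
def RankedUpTo (D : Inst) (m : ℕ) (s : Store) : Prop :=
  ∀ j < m, (∀ q < D.nQ, s.words (aPos + j) q = D.pos j q) ∧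
    (∀ k < D.nQ, s.words (aOrd + j) k = D.ord j k) ∧
    (∀ p < D.nP, s.words (40 + j) p = D.cP j p) ∧ ∀ r < D.nR, s.words (50 + j) r = D.cR j r

/-- A bound for the time of ranking in one coordinate. -/
def Inst.rankTime (D : Inst) (l : ℕ) : ℕ :=
  D.nQ * (D.B * 150 + 100) + (D.nP + D.nQ + D.nR) * (countTime l D.b + 30) + 80

theorem run_rankUpTo {R : ℕ → ℕ → ℝ} {nP nQ nR b B : ℕ}
    (hD : D = rankedInst R nP nQ nR b B) (hsz : D.Sizes w l)
    (hw : 4 * (D.nP + D.nQ + D.nR) + 4 ≤ 2 ^ w) (hbase : Base l D s) (hR : s.reals = R) :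
    ∀ m ≤ 6, Run w (rankUpTo m) s (fun t s' => t ≤ m * D.rankTime l + 1 ∧ RankedUpTo D m s')
  | 0, _ => Run.nop ⟨by simp, fun j hj => absurd hj (Nat.not_lt_zero _)⟩
  | m + 1, hm6 => by
    refine Run.seq (((run_rankUpTo hD hsz hw hbase hR m (by omega)).frame_reals
      (realFree_rankUpTo m)).mono ?_)
    rintro t₁ s₁ ⟨⟨ht₁, hrk⟩, hre1, hfr1⟩
    have fr1 : ∀ a, a < 20 → s₁.words a = s.words a := fun a ha => hfr1 a fun h => by
      have := writes_rankUpTo h; omega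
    have hb1 : Base l D s₁ := hbase.congr fr1
    refine Run.seq (((run_sortBlocks hsz hb1 (K := lowKey 1 m) (key := lowVal (R 1) m)
      (by rw [hre1, hR]; exact gives_lowKey (by omega) (by omega))
      (cost_rankTests (arr := 0) (by omega)).1).frame_reals (realFree_sortBlocks _)).mono ?_)
    rintro t₂ s₂ ⟨⟨ht₂, hsort⟩, hre2, hfr2⟩
    have fr2 : ∀ a, ¬ (a = vQ ∨ (120 ≤ a ∧ a ≤ 127)) → s₂.words a = s₁.words a := fun a ha =>
      hfr2 a fun h => ha (writes_sortBlocks h)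
    have hR2 : s₂.reals = R := by rw [hre2, hre1, hR]
    have hb2 : Base l D s₂ := hb1.congr fun a ha => fr2 a (by omega)
    refine Run.seq (((run_rankQ hsz (by omega) hb2 (show m < 6 by omega)
      (by rw [hR2]; exact hsort)).frame_reals (realFree_rankQ _)).mono ?_)
    rintro t₃ s₃ ⟨⟨ht₃, hpos⟩, hre3, hfr3⟩
    have fr3 : ∀ a, ¬ ((70 ≤ a ∧ a ≤ 73) ∨ (121 ≤ a ∧ a ≤ 125) ∨ a = vQ ∨ a = aPos + m ∨
        a = aOrd + m) → s₃.words a = s₂.words a := fun a ha => hfr3 a fun h => ha (writes_rankQ h)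
    have hR3 : s₃.reals = R := by rw [hre3, hR2]
    have hb3 : Base l D s₃ := hb2.congr fun a ha => fr3 a (by omega)
    refine Run.seq (((run_rankOuter (arr := 0) (α := 40) hsz (by omega)
      (show 4 * D.nP + 4 ≤ 2 ^ w by omega) (by omega) (by omega) hb3 hb3.nP (show m < 6 by omega)
      (by rw [hR3]; unfold Sorted; rw [fr3 _ (by omega)]; exact hsort)).frame_reals
        (realFree_rankOuter _ _ _ _)).mono ?_)
    rintro t₄ s₄ ⟨⟨ht₄, hcP⟩, hre4, hfr4⟩
    have fr4 : ∀ a, ¬ ((70 ≤ a ∧ a ≤ 73) ∨ (121 ≤ a ∧ a ≤ 125) ∨ a = vP ∨ a = 40 + m) →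
        s₄.words a = s₃.words a := fun a ha => hfr4 a fun h => ha (writes_rankOuter h)
    have hR4 : s₄.reals = R := by rw [hre4, hR3]
    have hb4 : Base l D s₄ := hb3.congr fun a ha => fr4 a (by omega)
    refine ((run_rankOuter (arr := 2) (α := 50) hsz (by omega)
      (show 4 * D.nR + 4 ≤ 2 ^ w by omega) (by omega) (by omega) hb4 hb4.nR (show m < 6 by omega)
      (by rw [hR4]; unfold Sorted; rw [fr4 _ (by omega), fr3 _ (by omega)]; exact hsort)).frame.mono
        ?_)
    rintro t₅ s₅ ⟨⟨ht₅, hcR⟩, hfr5⟩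
    have fr5 : ∀ a, ¬ ((70 ≤ a ∧ a ≤ 73) ∨ (121 ≤ a ∧ a ≤ 125) ∨ a = vP ∨ a = 50 + m) →
        s₅.words a = s₄.words a := fun a ha => hfr5 a fun h => ha (writes_rankOuter h)
    rw [hR2] at hpos
    rw [hR3] at hcP
    rw [hR4] at hcR
    refine ⟨?_, fun j hj => ?_⟩
    · rw [Nat.succ_mul, Inst.rankTime]
      have h1 : (D.nP + D.nQ + D.nR) * (countTime l D.b + 30) = D.nP * (countTime l D.b + 30) +
        D.nQ * (countTime l D.b + 30) + D.nR * (countTime l D.b + 30) := by ring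
      rw [h1]
      rw [Inst.rankTime, h1] at ht₁
      omega
    · rcases Nat.lt_succ_iff_lt_or_eq.1 hj with h | rfl
      · have hsame : ∀ a, 20 ≤ a → a < 60 → a ≠ 20 + m → a ≠ 30 + m → a ≠ 40 + m → a ≠ 50 + m →
            s₅.words a = s₁.words a := fun a h1 h2 h3 h4 h5 h6 => by
          rw [fr5 a (by omega), fr4 a (by omega), fr3 a (by omega), fr2 a (by omega)]
        rw [hsame _ (by omega) (by omega) (by omega) (by omega) (by omega) (by omega),
          hsame _ (by omega) (by omega) (by omega) (by omega) (by omega) (by omega),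
          hsame _ (by omega) (by omega) (by omega) (by omega) (by omega) (by omega),
          hsame _ (by omega) (by omega) (by omega) (by omega) (by omega) (by omega)]
        exact hrk j h
      · refine ⟨fun q hq => ?_, fun k hk => ?_, fun p hp => ?_, fun r hr => ?_⟩
        · rw [fr5 _ (by omega), fr4 _ (by omega), (hpos q hq).1, hD]
          rfl
        · rw [fr5 _ (by omega), fr4 _ (by omega)]
          have hv := rankedInst_valid (hD ▸ hsz)
          rw [hD] at hk
          have h1 := hv.ord_lt j (by omega) k hk
          have h2 := hv.pos_ord j (by omega) k hk
          have h3 := (hpos _ (by rw [hD]; exact h1)).2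
          rw [hD] at h3 ⊢
          have h4 : rank (lowVal (R 1) j) (Finset.range (rankedInst R nP nQ nR b B).nQ)
            ((rankedInst R nP nQ nR b B).ord j k) = k := h2
          rw [h4] at h3
          exact h3
        · rw [fr5 _ (by omega), hcP p hp, hD]
          rfl
        · rw [hcR r hr, hD]
          rfl

end Ranking

/-! ### Preparation -/

notation "vTot" => 4

/-- The fifth power of `vBase`. -/
def fifth : WExp :=
  .mul (.mul (.mul (var vBase) (var vBase)) (.mul (var vBase) (var vBase))) (var vBase)

/-- Set `vBase` to the least positive number whose fifth power is at least `vTot`. -/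
def findBase : Cmd :=
  .seq (assign vBase (.lit 1)) (.loop (.not (.wordLe (var vTot) fifth))
    (assign vBase (.add (var vBase) (.lit 1))))

/-- Set `vHalf` to the least power of two that is at least `vTot + 2`. -/
def findHalf : Cmd :=
  .seq (assign vHalf (.lit 1)) (.loop (.not (.wordLe (.add (var vTot) (.lit 2)) (var vHalf)))
    (assign vHalf (.mul (var vHalf) (.lit 2))))

/-- Compute all parameters from the numbers of cubes. -/
def setup : Cmd :=
  .seq (assign vNP (.get 0 (.lit 0))) (.seq (assign vNQ (.get 0 (.lit 1)))
    (.seq (assign vNR (.get 0 (.lit 2)))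
      (.seq (assign vTot (.add (.add (var vNP) (var vNQ)) (var vNR))) (.seq findBase
        (.seq (assign vWid (.add (.div (var vTot) (var vBase)) (.lit 1))) (.seq findHalf
          (.seq (assign vLeaf (.mul (.lit 2) (var vHalf)))
            (.seq (assign vMul (.mul (.lit 4) (var vHalf))) (assign vAns (.lit 1))))))))))

theorem writes_setup {a : ℕ} (h : setup.Writes a) : 1 ≤ a ∧ a ≤ 10 := by
  simp only [setup, findBase, findHalf, Cmd.Writes, writes_assign] at h
  omega

theorem realFree_setup : setup.RealFree := by
  simp [setup, findBase, findHalf, Cmd.RealFree]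

/-- Words are long enough for an input of `N` cubes. -/
def Wide (N w : ℕ) : Prop := 2 ^ 24 * (N + 1) ^ 6 < 2 ^ w

theorem Wide.pow_lt {N w : ℕ} (h : Wide N w) {i : ℕ} (hi : i ≤ 6) :
    2 ^ 24 * (N + 1) ^ i < 2 ^ w :=
  lt_of_le_of_lt (Nat.mul_le_mul_left _ (Nat.pow_le_pow_right (Nat.succ_pos _) hi)) h

/-- The number of slabs for an input of `N` cubes. -/
structure IsBase (N b : ℕ) : Prop where
  pos : 1 ≤ b
  le : b ≤ N + 1
  pow : N ≤ b ^ 5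
  least : b = 1 ∨ (b - 1) ^ 5 < N

/-- The exponent that determines the size of the tables for an input of `N` cubes. -/
structure IsExp (N l : ℕ) : Prop where
  le : N + 2 ≤ 2 ^ l
  ge : 2 ^ l ≤ 2 * N + 4

section Setup

variable {w N : ℕ} {s : Store}

/-- The base is at most `N + 1`, so that counting up to it takes linear time. -/
theorem run_findBase (hw : Wide N w) (hN : s.words vTot 0 = N) :
    Run w findBase s (fun t s' => t ≤ 40 * N + 40 ∧ IsBase N (s'.words vBase 0)) := by
  have h1 := hw.pow_lt (i := 1) (by omega)
  rw [pow_one] at h1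
  have h5 := hw.pow_lt (i := 5) (by omega)
  have hone : 1 % 2 ^ w = 1 := Nat.mod_eq_of_lt (by omega)
  have hc1 : (WExp.lit 1).cost = 1 := rfl
  have hc2 : (WExp.add (var vBase) (.lit 1)).cost = 4 := rfl
  have hbc : (BExp.not (.wordLe (var vTot) fifth)).cost = 18 := rfl
  have hev : ∀ s' : Store, s'.words vBase 0 ≤ N + 1 → fifth.eval w s' = s'.words vBase 0 ^ 5 := by
    intro s' hb
    have hb5 : s'.words vBase 0 ^ 5 ≤ (N + 1) ^ 5 := Nat.pow_le_pow_left hb 5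
    have hb4 : s'.words vBase 0 ^ 4 ≤ (N + 1) ^ 5 :=
      (Nat.pow_le_pow_left hb 4).trans (Nat.pow_le_pow_right (by omega) (by omega))
    have hb2 : s'.words vBase 0 * s'.words vBase 0 ≤ (N + 1) ^ 5 := by
      rw [← pow_two]
      exact (Nat.pow_le_pow_left hb 2).trans (Nat.pow_le_pow_right (by omega) (by omega))
    have e4 : s'.words vBase 0 * s'.words vBase 0 * (s'.words vBase 0 * s'.words vBase 0) =
        s'.words vBase 0 ^ 4 := by ring
    simp only [fifth, WExp.eval, eval_var]
    rw [Nat.mod_eq_of_lt (show s'.words vBase 0 * s'.words vBase 0 < 2 ^ w by omega), e4,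
      Nat.mod_eq_of_lt (show s'.words vBase 0 ^ 4 < 2 ^ w by omega), ← pow_succ]
    exact Nat.mod_eq_of_lt (show s'.words vBase 0 ^ 5 < 2 ^ w by omega)
  refine Run.seq (Run.assign ?_)
  refine (Run.loop (φ := N * 40)
    (fun φ s₁ => s₁.words vTot 0 = N ∧ 1 ≤ s₁.words vBase 0 ∧ s₁.words vBase 0 ≤ N + 1 ∧
      (s₁.words vBase 0 = 1 ∨ (s₁.words vBase 0 - 1) ^ 5 < N) ∧
      φ = (N + 1 - s₁.words vBase 0) * 40) ?_ ?_).mono ?_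
  · rintro φ s₁ ⟨hT, hb1, hb2, hb3, rfl⟩ hb
    simp only [BExp.Holds, eval_var, hT, hev s₁ hb2, not_le] at hb
    have hle : s₁.words vBase 0 ≤ s₁.words vBase 0 ^ 5 := Nat.le_self_pow (by omega) _
    have e1 : (WExp.add (var vBase) (.lit 1)).eval w s₁ = s₁.words vBase 0 + 1 := by
      simp only [WExp.eval, eval_var, hone]
      exact Nat.mod_eq_of_lt (by omega)
    refine Run.assign ?_
    rw [e1]
    refine ⟨_, ?_, ?_, ?_, ?_, ?_, rfl⟩
    · simp only [words_setWord, and_self, if_true]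
      omega
    · rw [words_setWord_of_ne _ _ _ (by decide), hT]
    all_goals simp only [words_setWord, and_self, if_true]
    · omega
    · omega
    · exact Or.inr (by simpa using hb)
  · refine ⟨by rw [words_setWord_of_ne _ _ _ (by decide), hN], ?_⟩
    simp [words_setWord, WExp.eval, hone]
  · rintro t s' ⟨φ', ht, ⟨hT, hb1, hb2, hb3, -⟩, hb⟩
    simp only [BExp.Holds, eval_var, hT, hev s' hb2, not_le, not_lt] at hb
    exact ⟨by omega, hb1, hb2, hb, hb3⟩

theorem run_findHalf (hw : Wide N w) (hN : s.words vTot 0 = N) :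
    Run w findHalf s (fun t s' => t ≤ 40 * N + 100 ∧
      ∃ l, IsExp N l ∧ s'.words vHalf 0 = 2 ^ l) := by
  have h1 := hw.pow_lt (i := 1) (by omega)
  rw [pow_one] at h1
  have hone : 1 % 2 ^ w = 1 := Nat.mod_eq_of_lt (by omega)
  have htwo : 2 % 2 ^ w = 2 := Nat.mod_eq_of_lt (by omega)
  have hc1 : (WExp.lit 1).cost = 1 := rfl
  have hc2 : (WExp.mul (var vHalf) (.lit 2)).cost = 4 := rfl
  have hbc : (BExp.not (.wordLe (.add (var vTot) (.lit 2)) (var vHalf))).cost = 8 := rfl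
  have hev : (N + 2) % 2 ^ w = N + 2 := Nat.mod_eq_of_lt (by omega)
  refine Run.seq (Run.assign ?_)
  refine (Run.loop (φ := (N + 1) * 40)
    (fun φ s₁ => s₁.words vTot 0 = N ∧ ∃ l, s₁.words vHalf 0 = 2 ^ l ∧ 2 ^ l ≤ 2 * N + 4 ∧
      φ = (N + 2 - 2 ^ l) * 40) ?_ ?_).mono ?_
  · rintro φ s₁ ⟨hT, l, hl, hle, rfl⟩ hb
    simp only [BExp.Holds, WExp.eval, eval_var, hT, htwo, hev, hl, not_le] at hb
    have hpos : 1 ≤ 2 ^ l := Nat.one_le_two_pow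
    have e1 : (WExp.mul (var vHalf) (.lit 2)).eval w s₁ = 2 ^ (l + 1) := by
      simp only [WExp.eval, eval_var, htwo, hl]
      rw [Nat.mod_eq_of_lt (by omega), pow_succ]
    refine Run.assign ?_
    rw [e1]
    refine ⟨_, ?_, ?_, l + 1, ?_, ?_, rfl⟩
    · rw [pow_succ]; omega
    · rw [words_setWord_of_ne _ _ _ (by decide), hT]
    · simp [words_setWord]
    · rw [pow_succ]; omega
  · refine ⟨by rw [words_setWord_of_ne _ _ _ (by decide), hN], 0, ?_, by omega, by simp⟩
    simp [words_setWord, WExp.eval, hone]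
  · rintro t s' ⟨φ', ht, ⟨hT, l, hl, hle, -⟩, hb⟩
    simp only [BExp.Holds, WExp.eval, eval_var, hT, htwo, hev, hl, not_le, not_lt] at hb
    exact ⟨by omega, l, ⟨hb, hle⟩, hl⟩

theorem run_setup {nP nQ nR : ℕ} {R : ℕ → ℕ → ℝ} (hw : Wide (nP + nQ + nR) w)
    (h0 : s.words 0 0 = nP ∧ s.words 0 1 = nQ ∧ s.words 0 2 = nR) :
    Run w setup s (fun t s' => t ≤ 80 * (nP + nQ + nR) + 300 ∧ s'.words vAns 0 = 1 ∧
      ∃ b l, IsBase (nP + nQ + nR) b ∧ IsExp (nP + nQ + nR) l ∧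
        Base l (rankedInst R nP nQ nR b ((nP + nQ + nR) / b + 1)) s') := by
  have h1 := hw.pow_lt (i := 1) (by omega)
  rw [pow_one] at h1
  have hlit : ∀ {x : ℕ}, x ≤ 1024 → x % 2 ^ w = x := fun hx => Nat.mod_eq_of_lt (by omega)
  obtain ⟨h00, h01, h02⟩ := h0
  refine Run.seq (Run.assign (Run.seq (Run.assign (Run.seq (Run.assign (Run.seq
    (Run.assign ?_)))))))
  simp only [WExp.eval, eval_var, hlit (show 0 ≤ 1024 by omega), hlit (show 1 ≤ 1024 by omega),
    hlit (show 2 ≤ 1024 by omega), words_setWord, h00, h01, h02, OfNat.ofNat_ne_zero, and_self,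
    if_true, if_false, false_and, OfNat.zero_ne_ofNat, zero_ne_one, one_ne_zero,
    OfNat.ofNat_ne_one, OfNat.one_ne_ofNat, Nat.reduceEqDiff]
  rw [Nat.mod_eq_of_lt (show nP + nQ < 2 ^ w by omega),
    Nat.mod_eq_of_lt (show nP + nQ + nR < 2 ^ w by omega)]
  set N := nP + nQ + nR with hN
  set s₁ := (((s.setWord vNP 0 nP).setWord vNQ 0 nQ).setWord vNR 0 nR).setWord vTot 0 N with hs₁
  have hP1 : s₁.words vNP 0 = nP := by simp [hs₁, words_setWord]
  have hQ1 : s₁.words vNQ 0 = nQ := by simp [hs₁, words_setWord]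
  have hR1 : s₁.words vNR 0 = nR := by simp [hs₁, words_setWord]
  have hT1 : s₁.words vTot 0 = N := by simp [hs₁, words_setWord]
  refine Run.seq ((run_findBase hw hT1).frame.mono ?_)
  rintro t₂ s₂ ⟨⟨ht₂, hb⟩, hfr2⟩
  have fr2 : ∀ a, a ≠ vBase → s₂.words a = s₁.words a := fun a ha => hfr2 a fun h => by
    simp only [findBase, Cmd.Writes, writes_assign] at h; omega
  set b := s₂.words vBase 0 with hbdef
  have e3 : (WExp.add (.div (var vTot) (var vBase)) (.lit 1)).eval w s₂ = N / b + 1 := by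
    simp only [WExp.eval, eval_var, hlit (show 1 ≤ 1024 by omega), fr2 vTot (by decide), hT1,
      ← hbdef]
    have := Nat.div_le_self N b
    exact Nat.mod_eq_of_lt (by omega)
  refine Run.seq (Run.assign ?_)
  rw [e3]
  set s₃ := s₂.setWord vWid 0 (N / b + 1) with hs₃
  have fr3 : ∀ a, a ≠ vWid → s₃.words a = s₂.words a := fun a ha => words_setWord_of_ne _ _ _ ha
  refine Run.seq ((run_findHalf hw (by
    rw [fr3 _ (by decide), fr2 _ (by decide), hT1])).frame.mono ?_)
  rintro t₄ s₄ ⟨⟨ht₄, l, hl, hh⟩, hfr4⟩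
  have fr4 : ∀ a, a ≠ vHalf → s₄.words a = s₃.words a := fun a ha => hfr4 a fun h => by
    simp only [findHalf, Cmd.Writes, writes_assign] at h; omega
  have hlw : 2 ^ l ≤ 2 * N + 4 := hl.ge
  refine Run.seq (Run.assign (Run.seq (Run.assign (Run.assign ?_))))
  simp only [WExp.eval, eval_var, hlit (show 1 ≤ 1024 by omega), hlit (show 2 ≤ 1024 by omega),
    hlit (show 4 ≤ 1024 by omega)]
  rw [words_setWord_of_ne _ _ _ (show vHalf ≠ vLeaf by decide), hh,
    Nat.mod_eq_of_lt (show 2 * 2 ^ l < 2 ^ w by omega),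
    Nat.mod_eq_of_lt (show 4 * 2 ^ l < 2 ^ w by omega)]
  set s₅ := ((s₄.setWord vLeaf 0 (2 * 2 ^ l)).setWord vMul 0 (4 * 2 ^ l)).setWord vAns 0 1 with hs₅
  have fr5 : ∀ a, a ≠ vLeaf → a ≠ vMul → a ≠ vAns → s₅.words a = s₄.words a := by
    intro a h1 h2 h3
    rw [hs₅, words_setWord_of_ne _ _ _ h3, words_setWord_of_ne _ _ _ h2,
      words_setWord_of_ne _ _ _ h1]
  refine ⟨?_, by simp [hs₅, words_setWord], b, l, hb, hl, ?_⟩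
  · simp only [WExp.cost, cost_var]
    omega
  · refine ⟨?_, ?_, ?_, ?_, ?_, ?_, ?_, ?_⟩
    · rw [fr5 _ (by decide) (by decide) (by decide), fr4 _ (by decide), fr3 _ (by decide),
        fr2 _ (by decide)]
      exact hP1
    · rw [fr5 _ (by decide) (by decide) (by decide), fr4 _ (by decide), fr3 _ (by decide),
        fr2 _ (by decide)]
      exact hQ1
    · rw [fr5 _ (by decide) (by decide) (by decide), fr4 _ (by decide), fr3 _ (by decide),
        fr2 _ (by decide)]
      exact hR1
    · rw [fr5 _ (by decide) (by decide) (by decide), fr4 _ (by decide), fr3 _ (by decide)]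
      rfl
    · rw [fr5 _ (by decide) (by decide) (by decide), fr4 _ (by decide)]
      simp [hs₃, words_setWord, rankedInst]
    · rw [pow_succ, mul_comm]
      simp [hs₅, words_setWord]
    · rw [pow_succ]
      simp [hs₅, words_setWord]
      ring
    · rw [fr5 _ (by decide) (by decide) (by decide)]
      exact hh

/-- With the parameters that are chosen, words are long enough for all purposes. -/
theorem wide_sizes {nP nQ nR b l : ℕ} {R : ℕ → ℕ → ℝ} (hw : Wide (nP + nQ + nR) w)
    (hb : IsBase (nP + nQ + nR) b) (hl : IsExp (nP + nQ + nR) l) :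
    Roomy w (l + 1) ∧ (rankedInst R nP nQ nR b ((nP + nQ + nR) / b + 1)).Sizes w l ∧
      (rankedInst R nP nQ nR b ((nP + nQ + nR) / b + 1)).Fits w ∧
      4 * (nP + nQ + nR) + 4 ≤ 2 ^ w := by
  set N := nP + nQ + nR with hN
  have h1 := hw.pow_lt (i := 1) (by omega)
  rw [pow_one] at h1
  have h2 := hw.pow_lt (i := 2) (by omega)
  have h5 := hw.pow_lt (i := 5) (by omega)
  have hle := hl.le
  have hge := hl.ge
  have hbN := hb.le
  have hdiv := Nat.div_le_self N b
  refine ⟨⟨?_, by omega⟩, ⟨?_, ?_, ?_, ?_, ?_, ?_⟩, ?_, by omega⟩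
  · calc (2 * 2 ^ (l + 1)) ^ 6 ≤ (16 * (N + 1)) ^ 6 :=
          Nat.pow_le_pow_left (by rw [pow_succ]; omega) 6
      _ = 2 ^ 24 * (N + 1) ^ 6 := by rw [mul_pow]; norm_num
      _ ≤ 2 ^ w := le_of_lt hw
  · exact Nat.succ_pos _
  · show nQ < b * (N / b + 1)
    exact lt_of_le_of_lt (show nQ ≤ N by omega) (Nat.lt_mul_div_succ N hb.pos)
  · show nQ + 2 ≤ 2 ^ (l + 1)
    rw [pow_succ]; omega
  · rw [pow_succ]; omega
  · omega
  · show (b + 1) * (N / b + 1 + 1) < 2 ^ w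
    calc (b + 1) * (N / b + 1 + 1) ≤ (2 * (N + 1)) * (2 * (N + 1)) :=
          Nat.mul_le_mul (by omega) (by omega)
      _ = 4 * (N + 1) ^ 2 := by ring
      _ < 2 ^ w := by omega
  · show (b ^ 4 + 1) * (nP + nR + 1) < 2 ^ w
    have hb4 : b ^ 4 ≤ (N + 1) ^ 4 := Nat.pow_le_pow_left hbN 4
    have h4 : 1 ≤ (N + 1) ^ 4 := Nat.one_le_pow _ _ (by omega)
    calc (b ^ 4 + 1) * (nP + nR + 1) ≤ (2 * (N + 1) ^ 4) * (N + 1) :=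
          Nat.mul_le_mul (by omega) (by omega)
      _ = 2 * (N + 1) ^ 5 := by ring
      _ < 2 ^ w := by omega

end Setup

/-- The whole program. -/
def decideProgram : Cmd :=
  .seq setup (.seq (rankUpTo 6) (.seq search (.setWord 0 (.lit 0) (var vAns))))

/-- A bound for the time of the program. -/
noncomputable def Inst.totalTime (D : Inst) (l : ℕ) : ℕ :=
  80 * (D.nP + D.nQ + D.nR) + 6 * D.rankTime l + D.searchTime l + 400

/-- The whole program decides whether the ranked instance of its input has a bad pair. -/
theorem run_decideProgram {w nP nQ nR : ℕ} {s : Store} (hw : Wide (nP + nQ + nR) w)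
    (h0 : s.words 0 0 = nP ∧ s.words 0 1 = nQ ∧ s.words 0 2 = nR)
    (hz : ∀ a, a ≠ 0 → ∀ k, s.words a k = 0) :
    Run w decideProgram s (fun t s' => ∃ b l D, IsBase (nP + nQ + nR) b ∧
      IsExp (nP + nQ + nR) l ∧ D = rankedInst s.reals nP nQ nR b ((nP + nQ + nR) / b + 1) ∧
      t ≤ D.totalTime l ∧ (s'.output = 0 ∨ s'.output = 1) ∧
      (s'.output = 0 ↔ ∃ p < nP, ∃ r < nR, D.Bad p r)) := by
  refine Run.seq (((run_setup (R := s.reals) hw h0).frame_reals realFree_setup).mono ?_)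
  rintro t₁ s₁ ⟨⟨ht₁, hans, b, l, hb, hl, hbase⟩, hre1, hfr1⟩
  have fr1 : ∀ a, 10 < a → s₁.words a = s.words a := fun a ha => hfr1 a fun h => by
    have := writes_setup h; omega
  obtain ⟨hroom, hsz, hfit, hword⟩ := wide_sizes (R := s.reals) hw hb hl
  set D := rankedInst s.reals nP nQ nR b ((nP + nQ + nR) / b + 1) with hD
  refine Run.seq ((run_rankUpTo hD hsz hword hbase hre1 6 le_rfl).frame.mono ?_)
  rintro t₂ s₂ ⟨⟨ht₂, hrk⟩, hfr2⟩
  have fr2 : ∀ a, a < 20 ∨ 127 < a → s₂.words a = s₁.words a := fun a ha => hfr2 a fun h => by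
    have := writes_rankUpTo h; omega
  have hb2 : Base l D s₂ := hbase.congr fun a ha => fr2 a (by omega)
  have henv : Env w l D vNP vNR 40 50 s₂ :=
    ⟨hb2.nP, hb2.nQ, hb2.nR, hb2.b, hb2.B, hb2.leaf, hb2.mul, hb2.half, fun j hj => (hrk j hj).1,
      fun j hj => (hrk j hj).2.1, fun j hj => (hrk j hj).2.2.1, fun j hj => (hrk j hj).2.2.2⟩
  refine Run.seq ((run_search hroom (rankedInst_valid hsz) hfit henv (fun a ha k => by
    rw [fr2 a (by omega), fr1 a (by omega), hz a (by omega)])).mono ?_)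
  rintro t₃ s₃ ⟨ht₃, h1, h2⟩
  have hans2 : s₂.words vAns 0 = 1 := by rw [fr2 _ (by omega), hans]
  rw [hans2] at h1 h2
  have hout : ∀ v, (s₃.setWord 0 ((WExp.lit 0).eval w s₃) v).output = v := by
    intro v
    simp [Store.output, words_setWord, WExp.eval]
  refine Run.setWord ⟨b, l, D, hb, hl, rfl, ?_, ?_, ?_⟩
  · have e1 : D.nP = nP := rfl
    have e2 : D.nQ = nQ := rfl
    have e3 : D.nR = nR := rfl
    have ht₃' : t₃ ≤ D.searchTime l := ht₃
    simp only [Inst.totalTime, e1, e2, e3, WExp.cost, cost_var]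
    omega
  · rw [hout, eval_var]
    exact h1
  · rw [hout, eval_var, h2]
    exact or_iff_right one_ne_zero

/-! ### Cubes and their coordinates -/

theorem intersects_iff (q p : Cube3) : q.Intersects p ↔
    ∀ i, q.corner i ≤ p.corner i + p.side ∧ p.corner i ≤ q.corner i + q.side := by
  constructor
  · rintro ⟨v, hq, hp⟩ i
    exact ⟨(hq i).1.trans (hp i).2, (hp i).1.trans (hq i).2⟩
  · intro h
    refine ⟨fun i => max (q.corner i) (p.corner i), fun i => ⟨le_max_left _ _, max_le ?_ (h i).2⟩,
      fun i => ⟨le_max_right _ _, max_le (h i).1 ?_⟩⟩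
    · linarith [q.side_pos]
    · linarith [p.side_pos]

theorem getD_flatMap_record : ∀ (L : List Cube3) (i m : ℕ) (hi : i < L.length), m < 4 →
    (L.flatMap Cube3.record).getD (4 * i + m) 0 = L[i].record.getD m 0
  | x :: L, 0, m, _, hm => by
    rw [List.flatMap_cons, List.getD_append _ _ _ _ (by simpa [Cube3.record] using hm)]
    simp
  | x :: L, i + 1, m, hi, hm => by
    have h4 : x.record.length = 4 := rfl
    rw [List.flatMap_cons, List.getD_append_right _ _ _ _ (by omega), h4,
      show 4 * (i + 1) + m - 4 = 4 * i + m by omega,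
      getD_flatMap_record L i m (by simpa using hi) hm]
    rfl

/-- Two cubes intersect if and only if all of the six inequalities hold. -/
theorem low_le_high_iff {P Q : List Cube3} {i k : ℕ} (hi : i < Q.length) (hk : k < P.length) :
    (∀ j < 6, lowVal (fun x => (Q.flatMap Cube3.record).getD x 0) j i ≤
      highVal (fun x => (P.flatMap Cube3.record).getD x 0) j k) ↔ Q[i].Intersects P[k] := by
  have hQ := fun m hm => getD_flatMap_record Q i m hi hm
  have hP := fun m hm => getD_flatMap_record P k m hk hm
  rw [intersects_iff, Fin.forall_fin_succ, Fin.forall_fin_two]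
  constructor
  · intro h
    have h0 := h 0 (by omega)
    have h1 := h 1 (by omega)
    have h2 := h 2 (by omega)
    have h3 := h 3 (by omega)
    have h4 := h 4 (by omega)
    have h5 := h 5 (by omega)
    -- The last three inequalities are between opposite numbers.
    norm_num [lowVal, highVal, -List.getD_eq_getElem?_getD] at h0 h1 h2 h3 h4 h5
    have hQ0 := hQ 0 (by omega)
    have hP0 := hP 0 (by omega)
    simp only [add_zero] at hQ0 hP0
    simp only [hQ0, hP0, hQ 1 (by omega), hQ 2 (by omega), hQ 3 (by omega), hP 1 (by omega),
      hP 2 (by omega), hP 3 (by omega)] at h0 h1 h2 h3 h4 h5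
    simp [Cube3.record] at h0 h1 h2 h3 h4 h5
    refine ⟨⟨?_, ?_⟩, ⟨?_, ?_⟩, ⟨?_, ?_⟩⟩ <;> first | linarith | (simp; linarith)
  · rintro ⟨⟨h0, h3⟩, ⟨h1, h4⟩, ⟨h2, h5⟩⟩ j hj
    have hQ0 := hQ 0 (by omega)
    have hP0 := hP 0 (by omega)
    simp only [add_zero] at hQ0 hP0
    simp at h0 h1 h2 h3 h4 h5
    interval_cases j <;> norm_num [lowVal, highVal, -List.getD_eq_getElem?_getD] <;>
      simp only [hQ0, hP0, hQ 1 (by omega), hQ 2 (by omega), hQ 3 (by omega), hP 1 (by omega),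
        hP 2 (by omega), hP 3 (by omega)] <;> simp [Cube3.record] <;> linarith

/-- A pair of cubes without a common neighbor is a bad pair of the ranked instance. -/
theorem rankedInst_bad_iff (P Q R : List Cube3) (b B : ℕ) :
    (∃ p < P.length, ∃ r < R.length, (rankedInst (inputStore P Q R).reals P.length Q.length
      R.length b B).Bad p r) ↔ ¬ AllPairsHaveCommonNeighbor P Q R := by
  have key : ∀ (p r : ℕ) (hp : p < P.length) (hr : r < R.length),
      (rankedInst (inputStore P Q R).reals P.length Q.length R.length b B).Bad p r ↔
        ∀ q (hq : q < Q.length), ¬ (Q[q].Intersects P[p] ∧ Q[q].Intersects R[r]) := by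
    intro p r hp hr
    refine forall₂_congr fun q hq => not_congr (and_congr ?_ ?_)
    · rw [← low_le_high_iff hq hp]
      exact forall₂_congr fun j hj =>
        rank_lt_countIn (downClosed_le _ _) (Finset.mem_range.2 hq)
    · rw [← low_le_high_iff hq hr]
      exact forall₂_congr fun j hj =>
        rank_lt_countIn (downClosed_le _ _) (Finset.mem_range.2 hq)
  constructor
  · rintro ⟨p, hp, r, hr, hbad⟩ hall
    obtain ⟨q, hq, h⟩ := hall _ (List.getElem_mem hp) _ (List.getElem_mem hr)
    obtain ⟨i, hi, rfl⟩ := List.mem_iff_getElem.1 hq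
    exact (key p r hp hr).1 hbad i hi h
  · intro h
    unfold AllPairsHaveCommonNeighbor at h
    push Not at h
    obtain ⟨x, hx, y, hy, h⟩ := h
    obtain ⟨p, hp, rfl⟩ := List.mem_iff_getElem.1 hx
    obtain ⟨r, hr, rfl⟩ := List.mem_iff_getElem.1 hy
    exact ⟨p, hp, r, hr, (key p r hp hr).2 fun q hq hd => h _ (List.getElem_mem hq) hd.1 hd.2⟩

/-! ### The running time -/

theorem stepTime_le (l : ℕ) : stepTime l ≤ 1000 * (l + 2) ^ 6 := by
  have h1 : (l + 1) * (tabTime (l + 1) 2 10 + 50) ≤ 220 * (l + 2) ^ 6 := by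
    calc (l + 1) * (tabTime (l + 1) 2 10 + 50)
        ≤ (l + 2) * (170 * (l + 2) ^ 2 + 50 * (l + 2) ^ 2) := by
          refine Nat.mul_le_mul (by omega) (Nat.add_le_add (tabTime_le (l + 1) 2 10) ?_)
          exact Nat.le_mul_of_pos_right _ (by positivity)
      _ = 220 * (l + 2) ^ 3 := by ring
      _ ≤ 220 * (l + 2) ^ 6 :=
        Nat.mul_le_mul_left _ (Nat.pow_le_pow_right (by omega) (by omega))
  have h2 : tabTime (l + 1) 3 18 ≤ 238 * (l + 2) ^ 6 := (tabTime_le (l + 1) 3 18).trans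
    (Nat.mul_le_mul_left _ (Nat.pow_le_pow_right (by omega) (by omega)))
  have h3 : 1 ≤ (l + 2) ^ 6 := Nat.one_le_pow _ _ (by omega)
  unfold stepTime
  linarith

theorem tabTime_le_pow_six {l d c : ℕ} (hd : d ≤ 6) :
    tabTime (l + 1) d c ≤ (40 + 60 * d + c) * (l + 2) ^ 6 :=
  (tabTime_le (l + 1) d c).trans (Nat.mul_le_mul_left _ (Nat.pow_le_pow_right (by omega) hd))

theorem sweepTime_le {l B : ℕ} (hB : 1 ≤ B) :
    sweepTime l (4 * B) ≤ 15400 * (B * (l + 2) ^ 6) := by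
  have h1 := stepTime_le l
  have h2 := tabTime_le_pow_six (l := l) (d := 2) (c := 12) (by omega)
  have h3 : 1 ≤ (l + 2) ^ 6 := Nat.one_le_pow _ _ (by omega)
  set L := (l + 2) ^ 6
  have h4 : 4 * B * (3 * stepTime l + tabTime (l + 1) 2 12 + 150) ≤ 4 * B * (3322 * L) :=
    Nat.mul_le_mul_left _ (by linarith)
  have h5 : 1 * L ≤ B * L := Nat.mul_le_mul_right _ hB
  unfold sweepTime
  linarith

theorem cellTime_le (l N : ℕ) : cellTime l N ≤ 1300 * ((N + 1) * (l + 2) ^ 6) := by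
  have h1 := tabTime_le_pow_six (l := l) (d := 3) (c := 17) (by omega)
  have h2 : 1 ≤ (l + 2) ^ 6 := Nat.one_le_pow _ _ (by omega)
  set L := (l + 2) ^ 6
  have h3 : N * (2 * tabTime (l + 1) 3 17 + 700) ≤ N * (1200 * L) :=
    Nat.mul_le_mul_left _ (by linarith)
  have h4 : 0 ≤ N * L := Nat.zero_le _
  unfold cellTime
  linarith

theorem minTime_le (l N : ℕ) : minTime l N ≤ 700 * ((N + 1) * (l + 2) ^ 6) := by
  have h1 := tabTime_le_pow_six (l := l) (d := 6) (c := 40) (by omega)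
  have h2 : 1 ≤ (l + 2) ^ 6 := Nat.one_le_pow _ _ (by omega)
  set L := (l + 2) ^ 6
  have h3 : N * (tabTime (l + 1) 6 40 + 100) ≤ N * (600 * L) :=
    Nat.mul_le_mul_left _ (by linarith)
  have h4 : 0 ≤ N * L := Nat.zero_le _
  unfold minTime
  linarith

theorem countTime_le {l b : ℕ} (hb : 1 ≤ b) : countTime l b + 30 ≤ 340 * (b * (l + 2) ^ 6) := by
  have h1 : l + 2 ≤ (l + 2) ^ 6 := Nat.le_self_pow (by omega) _
  set L := (l + 2) ^ 6
  have h2 : b * ((l + 1) * 180 + 100) ≤ b * (280 * L) := Nat.mul_le_mul_left _ (by omega)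
  have h3 : 1 ≤ b * L := Nat.mul_pos hb (by omega)
  unfold countTime
  linarith

section TotalTime

variable {D : Inst} {N l : ℕ}

/-- The unit in which the running time is measured. -/
def Inst.unit (D : Inst) (N l : ℕ) : ℕ := D.b ^ 4 * (N + 1) * (l + 2) ^ 6

/-- Comparison of some products with the unit. -/
theorem Inst.le_unit (hb : IsBase N D.b) (hB : D.B = N / D.b + 1) :
    (N + 1) * (l + 2) ^ 6 ≤ D.unit N l ∧ (N + 1) * (D.B * (l + 2) ^ 6) ≤ 2 * D.unit N l ∧
      (N + 1) * (D.b * (l + 2) ^ 6) ≤ D.unit N l := by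
  have hb4 : 1 ≤ D.b ^ 4 := Nat.one_le_pow _ _ hb.pos
  have hB' : D.B ≤ 2 * D.b ^ 4 := by
    have : N / D.b ≤ D.b ^ 4 := by
      refine Nat.div_le_of_le_mul ?_
      calc N ≤ D.b ^ 5 := hb.pow
        _ = D.b * D.b ^ 4 := by ring
    omega
  have hbb : D.b ≤ D.b ^ 4 := Nat.le_self_pow (by omega) _
  unfold Inst.unit
  refine ⟨?_, ?_, ?_⟩
  · rw [mul_assoc]; exact Nat.le_mul_of_pos_left _ hb4
  · calc (N + 1) * (D.B * (l + 2) ^ 6) ≤ (N + 1) * (2 * D.b ^ 4 * (l + 2) ^ 6) :=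
          Nat.mul_le_mul_left _ (Nat.mul_le_mul_right _ hB')
      _ = 2 * (D.b ^ 4 * (N + 1) * (l + 2) ^ 6) := by ring
  · calc (N + 1) * (D.b * (l + 2) ^ 6) ≤ (N + 1) * (D.b ^ 4 * (l + 2) ^ 6) :=
          Nat.mul_le_mul_left _ (Nat.mul_le_mul_right _ hbb)
      _ = D.b ^ 4 * (N + 1) * (l + 2) ^ 6 := by ring

/-- The sweeps take time `N * B`, and `B` is about `N / b`, which is at most `b ^ 4`. -/
theorem Inst.cellsTime_le (hN : D.nP + D.nQ + D.nR = N) (hb : IsBase N D.b)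
    (hB : D.B = N / D.b + 1) : D.cellsTime l ≤ 33000 * D.unit N l := by
  obtain ⟨u1, u2, -⟩ := Inst.le_unit (l := l) hb hB
  have hL : 1 ≤ (l + 2) ^ 6 := Nat.one_le_pow _ _ (by omega)
  have hpos : 1 ≤ (N + 1) * (l + 2) ^ 6 := Nat.mul_pos (by omega) hL
  have h1 : D.b ^ 4 * (cellTime l N + 22) ≤ 1322 * D.unit N l := by
    calc D.b ^ 4 * (cellTime l N + 22) ≤ D.b ^ 4 * (1322 * ((N + 1) * (l + 2) ^ 6)) :=
          Nat.mul_le_mul_left _ (by have := cellTime_le l N; linarith)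
      _ = 1322 * D.unit N l := by unfold Inst.unit; ring
  have h2 : (D.nP + D.nR) * sweepTime l (4 * D.B) ≤ 15400 * (2 * D.unit N l) := by
    calc (D.nP + D.nR) * sweepTime l (4 * D.B) ≤ (N + 1) * (15400 * (D.B * (l + 2) ^ 6)) :=
          Nat.mul_le_mul (by omega) (sweepTime_le (hB ▸ Nat.succ_pos _))
      _ = 15400 * ((N + 1) * (D.B * (l + 2) ^ 6)) := by ring
      _ ≤ 15400 * (2 * D.unit N l) := Nat.mul_le_mul_left _ u2
  unfold Inst.cellsTime
  rw [hN]
  linarith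

theorem Inst.sideTime_le (hN : D.nP + D.nQ + D.nR = N) (hb : IsBase N D.b)
    (hB : D.B = N / D.b + 1) :
    D.sideTime l ≤ (33000 * splittings.length + 4300) * D.unit N l := by
  obtain ⟨u1, -, -⟩ := Inst.le_unit (l := l) hb hB
  have hL : 1 ≤ (l + 2) ^ 6 := Nat.one_le_pow _ _ (by omega)
  have hpos : 1 ≤ (N + 1) * (l + 2) ^ 6 := Nat.mul_pos (by omega) hL
  have h1 := minTime_le l (D.nP + D.nR)
  have h2 : (D.nP + D.nR + 1) * (l + 2) ^ 6 ≤ (N + 1) * (l + 2) ^ 6 :=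
    Nat.mul_le_mul_right _ (by omega)
  have h3 := Nat.mul_le_mul_left splittings.length (Inst.cellsTime_le (l := l) hN hb hB)
  unfold Inst.sideTime
  linarith

theorem Inst.rankTime_le (hN : D.nP + D.nQ + D.nR = N) (hb : IsBase N D.b)
    (hB : D.B = N / D.b + 1) : D.rankTime l ≤ 1000 * D.unit N l := by
  obtain ⟨u1, u2, u3⟩ := Inst.le_unit (l := l) hb hB
  have hL : 1 ≤ (l + 2) ^ 6 := Nat.one_le_pow _ _ (by omega)
  have hpos : 1 ≤ (N + 1) * (l + 2) ^ 6 := Nat.mul_pos (by omega) hL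
  have hBL : D.B * 1 ≤ D.B * (l + 2) ^ 6 := Nat.mul_le_mul_left _ hL
  have hB1 : 1 ≤ D.B := hB ▸ Nat.succ_pos _
  have h1 : D.nQ * (D.B * 150 + 100) ≤ (N + 1) * (250 * (D.B * (l + 2) ^ 6)) :=
    Nat.mul_le_mul (by omega) (by linarith)
  have h2 : N * (countTime l D.b + 30) ≤ (N + 1) * (340 * (D.b * (l + 2) ^ 6)) :=
    Nat.mul_le_mul (by omega) (countTime_le hb.pos)
  unfold Inst.rankTime
  rw [hN]
  linarith

theorem Inst.totalTime_le (hN : D.nP + D.nQ + D.nR = N) (hb : IsBase N D.b)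
    (hB : D.B = N / D.b + 1) :
    D.totalTime l ≤ (66000 * splittings.length + 20000) * D.unit N l := by
  obtain ⟨u1, -, -⟩ := Inst.le_unit (l := l) hb hB
  have hL : 1 ≤ (l + 2) ^ 6 := Nat.one_le_pow _ _ (by omega)
  have hNL : (N + 1) * 1 ≤ (N + 1) * (l + 2) ^ 6 := Nat.mul_le_mul_left _ hL
  have h1 := Inst.sideTime_le (l := l) hN hb hB
  have h2 := Inst.rankTime_le (l := l) hN hb hB
  have h3 : D.nQ * (tabTime (l + 1) 6 31 + 20) ≤ (N + 1) * (500 * (l + 2) ^ 6) := by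
    refine Nat.mul_le_mul (by omega) ?_
    have := tabTime_le_pow_six (l := l) (d := 6) (c := 31) (by omega)
    linarith
  unfold Inst.totalTime Inst.searchTime
  rw [hN]
  linarith

end TotalTime

/-- The bound in terms of the size parameter. -/
theorem exists_const (c : ℕ) : ∃ C : ℝ, ∀ n N b l : ℕ, 2 ≤ n → N ≤ 3 * (c * n) → IsBase N b →
    IsExp N l → ((b ^ 4 * (N + 1) * (l + 2) ^ 6 : ℕ) : ℝ) ≤
      C * (n : ℝ) ^ (9 / 5 : ℝ) * Real.log n ^ 6 := by
  set A : ℝ := 3 * c + 1 with hA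
  have hA1 : 1 ≤ A := by rw [hA]; have : (0 : ℝ) ≤ c := Nat.cast_nonneg c; linarith
  set G : ℝ := (Real.log (4 * A) / Real.log 2 + 2) / Real.log 2 + 1 / Real.log 2 with hG
  refine ⟨16 * A ^ (9 / 5 : ℝ) * G ^ 6, fun n N b l hn hN hb hl => ?_⟩
  have hlog2 : 0 < Real.log 2 := Real.log_pos (by norm_num)
  have hn2 : (2 : ℝ) ≤ n := by exact_mod_cast hn
  have hn0 : (0 : ℝ) ≤ n := by linarith
  have hlogn : Real.log 2 ≤ Real.log n := Real.log_le_log (by norm_num) hn2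
  have hNA : (N : ℝ) + 1 ≤ A * n := by
    have h : (N : ℝ) ≤ 3 * (c * n) := by exact_mod_cast hN
    rw [hA]; linarith
  have hAn : 1 ≤ A * n := by have : (0 : ℝ) ≤ N := Nat.cast_nonneg N; linarith
  have hl' : ((l : ℝ) + 2) ≤ G * Real.log n := by
    have h1 : (2 : ℝ) ^ l ≤ 4 * A * n := by
      have : ((2 ^ l : ℕ) : ℝ) ≤ ((2 * N + 4 : ℕ) : ℝ) := by exact_mod_cast hl.ge
      push_cast at this
      have hN0 : (0 : ℝ) ≤ N := Nat.cast_nonneg N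
      linarith
    have h2 : (l : ℝ) * Real.log 2 ≤ Real.log (4 * A) + Real.log n := by
      rw [← Real.log_mul (by positivity) (by positivity), ← Real.log_pow]
      exact Real.log_le_log (by positivity) h1
    have h3 : (l : ℝ) ≤ Real.log (4 * A) / Real.log 2 + Real.log n / Real.log 2 := by
      rw [← add_div, le_div_iff₀ hlog2]; exact h2
    have h4 : 0 ≤ Real.log (4 * A) / Real.log 2 + 2 := by
      have : 0 ≤ Real.log (4 * A) := Real.log_nonneg (by linarith)
      positivity
    have h5 : Real.log (4 * A) / Real.log 2 + 2 ≤
        (Real.log (4 * A) / Real.log 2 + 2) / Real.log 2 * Real.log n := by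
      rw [div_mul_eq_mul_div, le_div_iff₀ hlog2]
      exact mul_le_mul_of_nonneg_left hlogn h4
    rw [hG, add_mul, one_div_mul_eq_div]
    linarith
  -- `y` is the fifth root of the bound for the number of cubes.
  set y : ℝ := (A * n) ^ (1 / 5 : ℝ) with hy
  have hy1 : 1 ≤ y := Real.one_le_rpow hAn (by norm_num)
  have hy5 : y ^ 5 = A * n := by
    rw [hy, ← Real.rpow_natCast, ← Real.rpow_mul (by linarith)]
    norm_num
  have hy9 : y ^ 9 = A ^ (9 / 5 : ℝ) * (n : ℝ) ^ (9 / 5 : ℝ) := by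
    rw [hy, ← Real.rpow_natCast, ← Real.rpow_mul (by linarith), ← Real.mul_rpow (by linarith) hn0]
    norm_num
  have hby : (b : ℝ) ≤ 2 * y := by
    rcases hb.least with h | h
    · rw [h]; push_cast; linarith
    · have h1 : ((b : ℝ) - 1) ^ 5 ≤ y ^ 5 := by
        have : (((b - 1) ^ 5 : ℕ) : ℝ) ≤ N := by exact_mod_cast h.le
        rw [Nat.cast_pow, Nat.cast_sub hb.pos, Nat.cast_one] at this
        rw [hy5]; linarith
      have h2 := le_of_pow_le_pow_left₀ (by norm_num) (by linarith) h1
      linarith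
  have hX : ((b : ℝ) ^ 4 * (N + 1)) ≤ 16 * A ^ (9 / 5 : ℝ) * (n : ℝ) ^ (9 / 5 : ℝ) := by
    calc (b : ℝ) ^ 4 * (N + 1) ≤ (2 * y) ^ 4 * y ^ 5 := by
          rw [hy5]
          exact mul_le_mul (pow_le_pow_left₀ (Nat.cast_nonneg b) hby 4) hNA (by positivity)
            (by positivity)
      _ = 16 * y ^ 9 := by ring
      _ = 16 * A ^ (9 / 5 : ℝ) * (n : ℝ) ^ (9 / 5 : ℝ) := by rw [hy9]; ring
  push_cast
  calc (b : ℝ) ^ 4 * (N + 1) * ((l : ℝ) + 2) ^ 6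
      ≤ (16 * A ^ (9 / 5 : ℝ) * (n : ℝ) ^ (9 / 5 : ℝ)) * (G * Real.log n) ^ 6 :=
        mul_le_mul hX (pow_le_pow_left₀ (by positivity) hl' 6) (by positivity) (by positivity)
    _ = 16 * A ^ (9 / 5 : ℝ) * G ^ 6 * (n : ℝ) ^ (9 / 5 : ℝ) * Real.log n ^ 6 := by ring

/-- A word length of `32 * (Nat.log 2 N + 1)` suffices for all addresses and marks. -/
theorem wide_of_le {N w : ℕ} (h : 32 * (Nat.log 2 N + 1) ≤ w) : Wide N w := by
  set x := Nat.log 2 N + 1 with hx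
  have h1 : N + 1 ≤ 2 ^ x := Nat.lt_pow_succ_log_self (by norm_num) N
  have hx1 : 1 ≤ x := by omega
  unfold Wide
  calc 2 ^ 24 * (N + 1) ^ 6 ≤ 2 ^ 24 * (2 ^ x) ^ 6 :=
        Nat.mul_le_mul_left _ (Nat.pow_le_pow_left h1 6)
    _ = 2 ^ (24 + x * 6) := by rw [← pow_mul, ← pow_add]
    _ < 2 ^ w := Nat.pow_lt_pow_right (by norm_num) (by omega)

end RealRAM

/-- One program, for all word lengths of at least `κ (log₂ N + 1)` bits, where `N` is the number of
input cubes; `n` is the size parameter, and the three sets have at most `c * n` elements each. -/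
theorem mainTheorem6 :
    ∃ (prog : RealRAM.Cmd) (κ k : ℕ), 0 < κ ∧
      ∀ c : ℕ, ∃ C : ℝ, ∀ n : ℕ, 2 ≤ n → ∀ P Q R : List Cube3,
        P.length ≤ c * n → Q.length ≤ c * n → R.length ≤ c * n →
        ∀ w : ℕ, κ * (Nat.log 2 (P.length + Q.length + R.length) + 1) ≤ w →
          ∃ (t : ℕ) (s : RealRAM.Store),
            RealRAM.Exec w prog (RealRAM.inputStore P Q R) t s ∧
            (t : ℝ) ≤ C * (n : ℝ) ^ (9 / 5 : ℝ) * Real.log n ^ k ∧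
            (AllPairsHaveCommonNeighbor P Q R → s.output = 1) ∧
            (¬ AllPairsHaveCommonNeighbor P Q R → s.output = 0) := by
  refine ⟨RealRAM.decideProgram, 32, 6, by norm_num, fun c => ?_⟩
  obtain ⟨C, hC⟩ := RealRAM.exists_const c
  obtain ⟨S, hS⟩ : ∃ S, 66000 * RealRAM.splittings.length + 20000 = S := ⟨_, rfl⟩
  refine ⟨S * C, fun n hn P Q R hP hQ hR w hw => ?_⟩
  obtain ⟨t, s, hexec, b, l, D, hb, hl, hD, ht, hout, hiff⟩ := RealRAM.run_decideProgram
    (s := RealRAM.inputStore P Q R) (RealRAM.wide_of_le hw) ⟨rfl, rfl, rfl⟩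
    (fun a ha k => by simp [RealRAM.inputStore, ha])
  rw [hD, RealRAM.rankedInst_bad_iff] at hiff
  refine ⟨t, s, hexec, ?_, fun h => ?_, fun h => hiff.2 h⟩
  · have h1 : D.totalTime l ≤ S *
        (b ^ 4 * (P.length + Q.length + R.length + 1) * (l + 2) ^ 6) := by
      have e : D.b = b := by rw [hD]; rfl
      have := RealRAM.Inst.totalTime_le (D := D) (l := l) (N := P.length + Q.length + R.length)
        (by rw [hD]; rfl) (by rw [e]; exact hb) (by rw [hD]; rfl)
      rwa [RealRAM.Inst.unit, e, hS] at this
    have h2 := hC n _ b l hn (by omega) hb hl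
    calc (t : ℝ) ≤ ((S *
          (b ^ 4 * (P.length + Q.length + R.length + 1) * (l + 2) ^ 6) : ℕ) : ℝ) := by
          exact_mod_cast ht.trans h1
      _ = S *
          ((b ^ 4 * (P.length + Q.length + R.length + 1) * (l + 2) ^ 6 : ℕ) : ℝ) :=
          Nat.cast_mul _ _
      _ ≤ S * (C * (n : ℝ) ^ (9 / 5 : ℝ) * Real.log n ^ 6) :=
          mul_le_mul_of_nonneg_left h2 (Nat.cast_nonneg _)
      _ = S * C * (n : ℝ) ^ (9 / 5 : ℝ) * Real.log n ^ 6 := by ring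
  · rcases hout with h0 | h1
    · exact absurd h (hiff.1 h0)
    · exact h1
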